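/- Let $d\ge 3$. Let $\phi:\mathbb S^3\to SU(2)$ be the bijection $$\phi(a,b,c,d)=\begin{pmatrix} a+ib & c-id\\ -c-id & a-ib\end{pmatrix},$$ and let $U\in SU(2)$ act on $v\in\mathbb S^3$ by the left-isoclinic rotation $U\cdot v=\phi^{-1}(U\phi(v))$ and the right-isoclinic rotation $v\cdot U=\phi^{-1}(\phi(v)U)$. **The model.** Let $\Lambda\subset\mathbb Z^d$ be finite, with set $\vec E(\Lambda)$ of oriented nearest-neighbour edges. The disorder $\omega=(\Omega_{i,j})_{(i,j)\in\vec E(\Lambda)}$ consists of $SU(2)$-valued random variables with $\Omega_{j,i}=\Omega_{i,j}^*$, independent over undirected edges, each with law $Z_\beta^{-1}e^{\beta\,\mathrm{Re}\,\mathrm{Tr}\,\Omega}\,d\mu(\Omega)$, where $\mu$ is the normalized Haar measure on $SU(2)$; write $\mathbb E_\beta$ for its expectation. Given $\omega$, the quenched Gibbs measure $\langle\cdot\rangle_{\omega,\beta,\Lambda}$ (free boundary conditions) on $(\mathbb S^3)^\Lambda$ has density proportional to $$\exp\Big(\tfrac\beta2\sum_{(i,j)\in\vec E(\Lambda)}\mathrm{Re}\,\mathrm{Tr}\big[\phi(S_i)^*\,\Omega_{i,j}\,\phi(S_j)\big]\Big)=\exp\Big(\beta\sum_{(i,j)\in\vec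 E(\Lambda)}\langle S_i,\Omega_{i,j}\cdot S_j\rangle\Big)$$ with respect to the product of the uniform probability measures on $\mathbb S^3$. For $B\subset\mathbb Z^d$ and $v\in\mathbb S^3$, let $\langle\cdot\rangle^{B,v}_{\omega,\beta,\Lambda}$ be the same measure with the spins in $B\cap\Lambda$ fixed to be equal to $v$. (The temperature of the spins and the parameter of the disorder are the same $\beta$: this is the Nishimori line.) **Symmetry.** For all $\beta$, $\Lambda$, $\omega$ and $g\in SU(2)$, the global right-isoclinic rotation $(S_i)_i\mapsto(S_i\cdot g)_i$ leaves $\langle\cdot\rangle_{\omega,\beta,\Lambda}$ invariant, and it maps $\langle\cdot\rangle^{B,v}_{\omega,\beta,\Lambda}$ to $\langle\cdot\rangle^{B,v\cdot g}_{\omega,\beta,\Lambda}$ for all $B$ and $v$. **Long-range order and symmetry breaking.** There are constants $\beta^*,a>0$, depending only on $d$, such that for all $\beta\ge\beta^*$ the number $m_\beta:=1-\sqrt{a\log\beta/\beta}$ is strictly positive and: 1. (long-range order) for every finite $\Lambda\subset\mathbb Z^d$ and all $x,y\in\Lambda$ such that every lattice point of the open ball $B\big(\tfrac{x+y}2,2\|x-y\|_2\big)$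 lies in $\Lambda$, $$\mathbb E_\beta\big[\langle S_x\cdot S_y\rangle_{\omega,\beta,\Lambda}\big]\ \ge\ m_\beta ;$$ 2. (breaking of the right-isoclinic symmetry: spontaneous magnetization) with $\Lambda_n=\{-n,\dots,n\}^d$, for every $v\in\mathbb S^3$ and all sets $B_n\subseteq\Lambda_n$ that contain the interior boundary of $\Lambda_n$ (the points of $\Lambda_n$ with a nearest neighbour outside $\Lambda_n$), $$\liminf_{n\to\infty}\ \mathbb E_\beta\big[\langle S_0\cdot v\rangle^{B_n,v}_{\omega,\beta,\Lambda_n}\big]\ \ge\ m_\beta .$$ -/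

import Mathlib

namespace IsoclinicO4

open MeasureTheory Matrix

noncomputable section

/-! ### The group SU(2), its Haar probability measure, and the sphere -/

/-- The group `SU(2)`. -/
abbrev SU2 : Type := Matrix.specialUnitaryGroup (Fin 2) ℂ

instance : MeasurableSpace SU2 := borel SU2

instance : BorelSpace SU2 := ⟨rfl⟩

instance : IsTopologicalGroup SU2 where
  continuous_mul := continuous_mul
  continuous_inv := by
    refine Continuous.subtype_mk ?_ _
    exact continuous_star.comp continuous_subtype_val

instance : CompactSpace SU2 := by
  have hK : IsCompact (Set.pi Set.univ fun _ : Fin 2 => Set.pi Set.univ fun _ : Fin 2 =>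
      Metric.closedBall (0 : ℂ) 1) :=
    isCompact_univ_pi fun _ => isCompact_univ_pi fun _ => isCompact_closedBall _ _
  have hc : IsClosed {M : Matrix (Fin 2) (Fin 2) ℂ | star M * M = 1 ∧ M.det = 1} := by
    refine IsClosed.inter (isClosed_eq ?_ continuous_const) (isClosed_eq ?_ continuous_const)
    · exact continuous_star.mul continuous_id
    · exact Continuous.matrix_det continuous_id
  have hs : {M : Matrix (Fin 2) (Fin 2) ℂ | star M * M = 1 ∧ M.det = 1}
      = (Matrix.specialUnitaryGroup (Fin 2) ℂ : Set (Matrix (Fin 2) (Fin 2) ℂ)) := by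
    ext M
    simp [Matrix.mem_specialUnitaryGroup_iff, Matrix.mem_unitaryGroup_iff']
  rw [hs] at hc
  refine isCompact_iff_compactSpace.mp (IsCompact.of_isClosed_subset hK hc ?_)
  intro M hM i _ j _
  have := entry_norm_bound_of_unitary (Matrix.specialUnitaryGroup_le_unitaryGroup hM) i j
  simpa using this

/-- The normalized Haar measure on `SU(2)`. -/
def haarSU2 : Measure SU2 := Measure.haarMeasure ⊤

/-- The unit sphere `S³ ⊂ ℝ⁴`. -/
abbrev S3 : Type := Metric.sphere (0 : EuclideanSpace ℝ (Fin 4)) 1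

/-- The normalized uniform (rotation invariant) measure on `S³`. -/
def uniformS3 : Measure S3 :=
  ((volume : Measure (EuclideanSpace ℝ (Fin 4))).toSphere Set.univ)⁻¹ •
    (volume : Measure (EuclideanSpace ℝ (Fin 4))).toSphere

/-! ### The identification of the sphere with SU(2) and isoclinic rotations -/

/-- The matrix attached to `(a, b, c, d) ∈ ℝ⁴`. -/
def phiMat (v : EuclideanSpace ℝ (Fin 4)) : Matrix (Fin 2) (Fin 2) ℂ :=
  !![(v 0 : ℂ) + Complex.I * v 1, (v 2 : ℂ) - Complex.I * v 3;
     -(v 2 : ℂ) - Complex.I * v 3, (v 0 : ℂ) - Complex.I * v 1]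

theorem sum_sq_S3 (v : S3) :
    v.1 0 ^ 2 + v.1 1 ^ 2 + v.1 2 ^ 2 + v.1 3 ^ 2 = 1 := by
  have h := v.2
  rw [mem_sphere_zero_iff_norm] at h
  have h2 := EuclideanSpace.real_norm_sq_eq v.1
  rw [h, Fin.sum_univ_four] at h2
  linarith

theorem phiMat_mem (v : S3) : phiMat v.1 ∈ Matrix.specialUnitaryGroup (Fin 2) ℂ := by
  have h := sum_sq_S3 v
  rw [Matrix.mem_specialUnitaryGroup_iff, Matrix.mem_unitaryGroup_iff]
  constructor
  · ext i j
    fin_cases i <;> fin_cases j <;>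
      simp [phiMat, Matrix.mul_apply, Fin.sum_univ_two, Complex.ext_iff] <;>
      constructor <;> linarith
  · simp [phiMat, Matrix.det_fin_two, Complex.ext_iff]
    constructor <;> linarith

theorem SU2_entries (U : SU2) :
    U.1 1 1 = star (U.1 0 0) ∧ U.1 1 0 = -star (U.1 0 1) := by
  have h1 : U.1 * star U.1 = 1 :=
    Matrix.mem_unitaryGroup_iff.mp (Matrix.mem_specialUnitaryGroup_iff.mp U.2).1
  have h2 : U.1.det = 1 := (Matrix.mem_specialUnitaryGroup_iff.mp U.2).2
  have h3 : U.1.adjugate = star U.1 := by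
    calc U.1.adjugate = U.1.adjugate * (U.1 * star U.1) := by rw [h1, mul_one]
      _ = star U.1 := by rw [← mul_assoc, Matrix.adjugate_mul, h2, one_smul, one_mul]
  rw [Matrix.adjugate_fin_two] at h3
  have a := congrFun (congrFun h3 0) 0
  have b := congrFun (congrFun h3 1) 0
  simp [Matrix.star_apply] at a b
  refine ⟨by simpa using a, ?_⟩
  change U.1 1 0 = -(starRingEnd ℂ) (U.1 0 1)
  linear_combination -b

/-- The identification `φ : S³ ≃ SU(2)`. -/
def phi : S3 ≃ SU2 where
  toFun v := ⟨phiMat v.1, phiMat_mem v⟩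
  invFun U := ⟨!₂[(U.1 0 0).re, (U.1 0 0).im, (U.1 0 1).re, -(U.1 0 1).im], by
    have h1 : U.1 * star U.1 = 1 :=
      Matrix.mem_unitaryGroup_iff.mp (Matrix.mem_specialUnitaryGroup_iff.mp U.2).1
    have a := congrArg Complex.re (congrFun (congrFun h1 0) 0)
    simp [Matrix.mul_apply, Fin.sum_univ_two, Matrix.star_apply] at a
    rw [mem_sphere_zero_iff_norm, ← sq_eq_sq₀ (norm_nonneg _) zero_le_one,
      EuclideanSpace.real_norm_sq_eq, Fin.sum_univ_four]
    simp
    linarith⟩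
  left_inv v := by
    apply Subtype.ext
    ext i
    fin_cases i <;> simp [phiMat]
  right_inv U := by
    obtain ⟨h1, h2⟩ := SU2_entries U
    apply Subtype.ext
    ext i j
    fin_cases i <;> fin_cases j <;> simp [phiMat, h1, h2, Complex.ext_iff]

/-- The left-isoclinic rotation `U · v = φ⁻¹(U φ(v))`. -/
def leftIsoclinic (U : SU2) (v : S3) : S3 := phi.symm (U * phi v)

/-- The right-isoclinic rotation `v · U = φ⁻¹(φ(v) U)`. -/
def rightIsoclinic (U : SU2) (v : S3) : S3 := phi.symm (phi v * U)

/-- `Re Tr M`. -/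
def reTr (M : Matrix (Fin 2) (Fin 2) ℂ) : ℝ := (Matrix.trace M).re

/-- The trace form is twice the Euclidean inner product. -/
theorem reTr_star_phi_mul (v w : S3) :
    reTr (star (phi v).1 * (phi w).1) = 2 * inner ℝ v.1 w.1 := by
  simp [reTr, phi, phiMat, Matrix.trace, Fin.sum_univ_two, Matrix.mul_apply, Matrix.star_apply,
    PiLp.inner_apply, Fin.sum_univ_four]
  ring

theorem reTr_coupling (v w : S3) (U : SU2) :
    reTr (star (phi v).1 * U.1 * (phi w).1) = 2 * inner ℝ v.1 (leftIsoclinic U w).1 := by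
  rw [← reTr_star_phi_mul, leftIsoclinic, Equiv.apply_symm_apply, mul_assoc]
  rfl

/-! ### The lattice, the disorder and the quenched Gibbs measures -/

/-- Nearest neighbours in `ℤᵈ`. -/
def Adj {d : ℕ} (i j : Fin d → ℤ) : Prop := ∑ k, |i k - j k| = 1

instance {d : ℕ} (i j : Fin d → ℤ) : Decidable (Adj i j) :=
  inferInstanceAs (Decidable (_ = _))

theorem Adj.symm {d : ℕ} {i j : Fin d → ℤ} (h : Adj i j) : Adj j i := by
  unfold Adj at *
  simpa only [abs_sub_comm] using h

theorem not_adj_self {d : ℕ} (i : Fin d → ℤ) : ¬ Adj i i := by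
  simp [Adj]

/-- The set of oriented edges `(i, j)` of `Λ` (each undirected edge occurs twice). -/
def orientedEdges {d : ℕ} (Λ : Finset (Fin d → ℤ)) : Finset (Λ × Λ) :=
  Finset.univ.filter fun e => Adj e.1.1 e.2.1

open Classical in
/-- The set of positively oriented edges of `Λ`: each undirected edge occurs once, oriented in
the direction of the increasing coordinate. -/
def posEdges {d : ℕ} (Λ : Finset (Fin d → ℤ)) : Finset (Λ × Λ) :=
  Finset.univ.filter fun e => Adj e.1.1 e.2.1 ∧ e.1.1 ≤ e.2.1

/-- A disorder configuration: one element of `SU(2)` for each undirected edge. -/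
abbrev Disorder {d : ℕ} (Λ : Finset (Fin d → ℤ)) : Type := posEdges Λ → SU2

/-- A spin configuration on `Λ`. -/
abbrev Spins {d : ℕ} (Λ : Finset (Fin d → ℤ)) : Type := Λ → S3

/-- The field `Ω_{i,j}` on oriented edges determined by the disorder: it satisfies
`Ω_{j,i} = Ω_{i,j}^*` (and is set to `1` off the edges). -/
def coupling {d : ℕ} {Λ : Finset (Fin d → ℤ)} (ω : Disorder Λ) (i j : Λ) : SU2 :=
  if h : (i, j) ∈ posEdges Λ then ω ⟨(i, j), h⟩
  else if h : (j, i) ∈ posEdges Λ then star (ω ⟨(j, i), h⟩)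
  else 1

theorem coupling_swap {d : ℕ} {Λ : Finset (Fin d → ℤ)} (ω : Disorder Λ) (i j : Λ) :
    coupling ω j i = star (coupling ω i j) := by
  unfold coupling
  by_cases h1 : (i, j) ∈ posEdges Λ <;> by_cases h2 : (j, i) ∈ posEdges Λ
  · exfalso
    simp only [posEdges, Finset.mem_filter, Finset.mem_univ, true_and] at h1 h2
    have h3 : i.1 = j.1 := le_antisymm h1.2 h2.2
    exact not_adj_self j.1 (h3 ▸ h1.1)
  · simp [h1, h2]
  · simp [h1, h2]
  · simp [h1, h2]

/-- The single-edge law `dρ_u(Ω) = Z⁻¹ exp(u Re Tr Ω) dμ(Ω)`, with `μ` the Haar measure. -/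
def rho (u : ℝ) : Measure SU2 := haarSU2.tilted fun Ω => u * reTr Ω.1

/-- The law of the disorder: independent over undirected edges with law `ρ_u`. (As `ρ_u` is
invariant under `Ω ↦ Ω^*`, every `Ω_{i,j}` has law `ρ_u`.) -/
def disorderLaw {d : ℕ} (u : ℝ) (Λ : Finset (Fin d → ℤ)) : Measure (Disorder Λ) :=
  Measure.pi fun _ => rho u

/-- The action `∑_{(i,j)} Re Tr(φ(S_i)^* Ω_{i,j} φ(S_j))` over oriented edges. -/
def action {d : ℕ} {Λ : Finset (Fin d → ℤ)} (ω : Disorder Λ) (S : Spins Λ) : ℝ :=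
  ∑ e ∈ orientedEdges Λ,
    reTr (star (phi (S e.1)).1 * (coupling ω e.1 e.2).1 * (phi (S e.2)).1)

/-- The a priori spin measure with free boundary conditions. -/
def freeSpins {d : ℕ} (Λ : Finset (Fin d → ℤ)) : Measure (Spins Λ) :=
  Measure.pi fun _ => uniformS3

/-- The a priori spin measure with spins in `B` fixed to the value `v`. -/
def fixedSpins {d : ℕ} (Λ B : Finset (Fin d → ℤ)) (v : S3) : Measure (Spins Λ) :=
  Measure.pi fun i => if i.1 ∈ B then Measure.dirac v else uniformS3

/-- The quenched Gibbs measure with free boundary conditions: density proportional to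
`exp((β/2) * action)`. -/
def freeGibbs {d : ℕ} (β : ℝ) (Λ : Finset (Fin d → ℤ)) (ω : Disorder Λ) : Measure (Spins Λ) :=
  (freeSpins Λ).tilted fun S => β / 2 * action ω S

/-- The quenched Gibbs measure with Dirichlet boundary condition `v` on the sites of `B`. -/
def dirichletGibbs {d : ℕ} (β : ℝ) (Λ B : Finset (Fin d → ℤ)) (v : S3) (ω : Disorder Λ) :
    Measure (Spins Λ) :=
  (fixedSpins Λ B v).tilted fun S => β / 2 * action ω S

/-- The averaged quenched expectation on the Nishimori line `u = β`, free boundary conditions. -/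
def avgFree {d : ℕ} (β : ℝ) (Λ : Finset (Fin d → ℤ)) (f : Spins Λ → ℝ) : ℝ :=
  ∫ ω, (∫ S, f S ∂(freeGibbs β Λ ω)) ∂(disorderLaw β Λ)

/-- The averaged quenched expectation on the Nishimori line `u = β`, with Dirichlet boundary
condition `v` on `B`. -/
def avgDirichlet {d : ℕ} (β : ℝ) (Λ B : Finset (Fin d → ℤ)) (v : S3) (f : Spins Λ → ℝ) : ℝ :=
  ∫ ω, (∫ S, f S ∂(dirichletGibbs β Λ B v ω)) ∂(disorderLaw β Λ)

/-- The box `{-n, …, n}ᵈ`. -/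
def box (d n : ℕ) : Finset (Fin d → ℤ) := Fintype.piFinset fun _ => Finset.Icc (-(n : ℤ)) n

theorem zero_mem_box (d n : ℕ) : (0 : Fin d → ℤ) ∈ box d n := by
  simp [box]

open Classical in
/-- The interior boundary of `Λ`: the points of `Λ` with a nearest neighbour outside `Λ`. -/
def innerBoundary {d : ℕ} (Λ : Finset (Fin d → ℤ)) : Finset (Fin d → ℤ) :=
  Λ.filter fun i => ∃ j, Adj i j ∧ j ∉ Λ

/-- The inclusion `ℤᵈ ⊂ ℝᵈ` (Euclidean norm). -/
def toE {d : ℕ} (x : Fin d → ℤ) : EuclideanSpace ℝ (Fin d) := WithLp.toLp 2 fun k => (x k : ℝ)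

end

end IsoclinicO4

open IsoclinicO4 MeasureTheory Filter

/-! ### `SU(2)` as unit quaternions: trace form, isoclinic rotations, invariant measures. -/

namespace IsoclinicO4

open MeasureTheory Matrix Pointwise

noncomputable section

/-! On the Nishimori line the spins behave like a signal planted in the disorder: after a gauge
transformation by the spins, the Boltzmann weight is the density of the disorder (`gibbsWeight_eq`).
Hence the averaged two-point function is the mean square norm of the Gibbs average of the relative
rotation φ(S_x)φ(S_y)⁻¹ (`corr_eq`). A conditional mean is the best quadratic estimator, so every
function of the disorder that estimates this rotation well bounds the correlation from below
(`le_corr_of_estimator`). Pinned spins do no harm, because only gauge transformations that are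
trivial at the pinned sites are needed.

Let λ be the mean of ½ Re Tr Ω. The product of the disorder along a path of length L, divided by
λ^L, is an unbiased estimator, but its second moment λ^(-2L) is useless. Averaged over a random
directed path, the second moment becomes E[λ^(-2N)], with N the number of edges shared by two
independent paths (`le_corr_of_paths`). So one needs a law on paths with fixed endpoints for which N
has an exponential moment 1 + O(1 - λ), uniformly in L. The paths used are unpredictable: each
transverse coordinate is a sum, over scales 16^k, of random piecewise linear functions of height
8^k. Given the path at times at distance at least s, a prescribed position is hit with probability
O(s^(-3/4)) per transverse coordinate, hence O(s^(-3/2)) for two of them. This is summable, and a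
renewal argument yields `exists_exponential_intersection`. The need for two transverse coordinates
is where d ≥ 3 enters.

At low temperature 1 - λ = O(log β / β) (`exists_one_sub_lam_le`). This bounds 1 - corr for
neighbours and for displacements (2m, m, m); a boundedly long chain of these reaches every other
displacement through the approximate triangle inequality `one_sub_corr_le`. The resulting bound is
linear in log β / β, hence below the square root for large β. The magnetization at the origin is the
two-point function between the origin and a pinned boundary site, so it obeys the same estimate. -/

instance : SecondCountableTopology SU2 :=
  haveI : SecondCountableTopology (Matrix (Fin 2) (Fin 2) ℂ) :=
    inferInstanceAs (SecondCountableTopology (Fin 2 → Fin 2 → ℂ))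
  TopologicalSpace.Subtype.secondCountableTopology _

/-- Half of the real part of the trace. -/
def chi (U : SU2) : ℝ := reTr U.1 / 2

/-- The unit vector of `ℝ⁴` attached to an element of `SU(2)`. -/
def vec (U : SU2) : EuclideanSpace ℝ (Fin 4) := (phi.symm U).1

theorem inv_coe (U : SU2) : (U⁻¹).1 = star U.1 := rfl

theorem chi_mul_comm (U V : SU2) : chi (U * V) = chi (V * U) := by
  simp only [chi, reTr, Submonoid.coe_mul]
  rw [Matrix.trace_mul_comm]

theorem chi_conj (g U : SU2) : chi (g⁻¹ * U * g) = chi U := by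
  rw [chi_mul_comm]; simp

theorem chi_inv (U : SU2) : chi U⁻¹ = chi U := by
  rw [chi, inv_coe, chi, reTr, reTr, Matrix.star_eq_conjTranspose, Matrix.trace_conjTranspose]
  simp

theorem chi_one : chi 1 = 1 := by
  simp [chi, reTr]

theorem inner_vec (U V : SU2) : inner ℝ (vec U) (vec V) = chi (U⁻¹ * V) := by
  have h := reTr_star_phi_mul (phi.symm U) (phi.symm V)
  rw [Equiv.apply_symm_apply, Equiv.apply_symm_apply] at h
  rw [vec, vec, chi, Submonoid.coe_mul, inv_coe, h]
  ring

theorem inner_eq_chi (v w : S3) : inner ℝ v.1 w.1 = chi ((phi v)⁻¹ * phi w) := by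
  rw [← inner_vec, vec, vec, Equiv.symm_apply_apply, Equiv.symm_apply_apply]

theorem norm_vec (U : SU2) : ‖vec U‖ = 1 := by
  have := (phi.symm U).2
  rwa [mem_sphere_zero_iff_norm] at this

theorem abs_chi_le_one (U : SU2) : |chi U| ≤ 1 := by
  have h := abs_real_inner_le_norm (vec 1) (vec U)
  rw [inner_vec, norm_vec, norm_vec] at h
  simpa using h

theorem continuous_chi : Continuous chi := by
  unfold chi reTr
  exact (Complex.continuous_re.comp (Continuous.matrix_trace continuous_subtype_val)).div_const _

theorem continuous_phi : Continuous phi := by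
  refine Continuous.subtype_mk ?_ _
  refine continuous_matrix fun i j => ?_
  have h (k : Fin 4) : Continuous fun v : S3 => ((v.1 k : ℝ) : ℂ) := by fun_prop
  fin_cases i <;> fin_cases j <;> simp [phiMat] <;> fun_prop

theorem continuous_phi_symm : Continuous phi.symm :=
  (Continuous.continuous_symm_of_equiv_compact_to_t2 (f := phi) continuous_phi)

theorem continuous_vec : Continuous vec :=
  continuous_subtype_val.comp continuous_phi_symm

theorem phi_leftIsoclinic (g : SU2) (v : S3) : phi (leftIsoclinic g v) = g * phi v := by
  simp [leftIsoclinic]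

theorem phi_rightIsoclinic (g : SU2) (v : S3) : phi (rightIsoclinic g v) = phi v * g := by
  simp [rightIsoclinic]

theorem phiMat_add (v w : EuclideanSpace ℝ (Fin 4)) : phiMat (v + w) = phiMat v + phiMat w := by
  ext i j
  fin_cases i <;> fin_cases j <;> simp [phiMat] <;> ring

theorem phiMat_smul (r : ℝ) (v : EuclideanSpace ℝ (Fin 4)) :
    phiMat (r • v) = (r : ℂ) • phiMat v := by
  ext i j
  fin_cases i <;> fin_cases j <;> simp [phiMat] <;> ring

/-- The coordinates of a matrix of the form `phiMat v`. -/
def coords (M : Matrix (Fin 2) (Fin 2) ℂ) : EuclideanSpace ℝ (Fin 4) :=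
  !₂[(M 0 0).re, (M 0 0).im, (M 0 1).re, -(M 0 1).im]

theorem vec_eq_coords (U : SU2) : vec U = coords U.1 := rfl

theorem coords_add (M N : Matrix (Fin 2) (Fin 2) ℂ) : coords (M + N) = coords M + coords N := by
  ext i
  fin_cases i <;> simp [coords]; ring

theorem coords_smul (r : ℝ) (M : Matrix (Fin 2) (Fin 2) ℂ) :
    coords ((r : ℂ) • M) = r • coords M := by
  ext i
  fin_cases i <;> simp [coords]

/-- The linear isometry `v ↦ φ⁻¹(g φ(v) h)` of `ℝ⁴`. -/
def isoclinic (g h : SU2) : EuclideanSpace ℝ (Fin 4) →ₗᵢ[ℝ] EuclideanSpace ℝ (Fin 4) where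
  toFun v := coords (g.1 * phiMat v * h.1)
  map_add' v w := by rw [phiMat_add, mul_add, add_mul, coords_add]
  map_smul' r v := by
    rw [phiMat_smul, mul_smul_comm, smul_mul_assoc, coords_smul]; rfl
  norm_map' v := by
    -- On the sphere the norm is preserved because a product in `SU2` is again a unit quaternion;
    -- homogeneity then covers all of ℝ⁴.
    have key (u : S3) : ‖coords (g.1 * phiMat u.1 * h.1)‖ = 1 := norm_vec (g * phi u * h)
    change ‖coords (g.1 * phiMat v * h.1)‖ = ‖v‖
    rcases eq_or_ne v 0 with rfl | hv
    · have := coords_smul 0 (g.1 * phiMat 0 * h.1)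
      have h0 : phiMat 0 = 0 := by simpa using phiMat_smul 0 0
      have h1 : coords 0 = 0 := by simpa using coords_smul 0 0
      simp [h0, h1]
    · have hv' : ‖v‖ ≠ 0 := norm_ne_zero_iff.mpr hv
      have hu : ‖v‖⁻¹ • v ∈ Metric.sphere (0 : EuclideanSpace ℝ (Fin 4)) 1 := by
        rw [mem_sphere_zero_iff_norm, norm_smul, norm_inv, norm_norm, inv_mul_cancel₀ hv']
      have h1 : v = ‖v‖ • (‖v‖⁻¹ • v) := by rw [smul_smul, mul_inv_cancel₀ hv', one_smul]
      conv_lhs => rw [h1]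
      rw [phiMat_smul, mul_smul_comm, smul_mul_assoc, coords_smul, norm_smul, norm_norm,
        key ⟨_, hu⟩, mul_one]

instance : IsProbabilityMeasure uniformS3 := by
  refine ⟨?_⟩
  rw [uniformS3, Measure.smul_apply, smul_eq_mul]
  refine ENNReal.inv_mul_cancel ?_ (measure_ne_top _ _)
  rw [Measure.measure_univ_ne_zero]
  exact Measure.toSphere_ne_zero _

/-- The uniform measure of a set is, up to normalization, the Lebesgue measure of the cone over it.
The map extends to a linear isometry of ℝ⁴, which sends cones to cones and preserves volume. -/
theorem measurePreserving_isoclinic (g h : SU2) :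
    MeasurePreserving (fun v : S3 => phi.symm (g * phi v * h)) uniformS3 uniformS3 := by
  have hc : Continuous (fun v : S3 => phi.symm (g * phi v * h)) :=
    continuous_phi_symm.comp ((continuous_const.mul continuous_phi).mul continuous_const)
  refine ⟨hc.measurable, ?_⟩
  ext s hs
  rw [Measure.map_apply hc.measurable hs, uniformS3, Measure.smul_apply, Measure.smul_apply,
    Measure.toSphere_apply' _ hs, Measure.toSphere_apply' _ (hc.measurable hs)]
  congr 2
  set A := (isoclinic g h).toLinearIsometryEquiv rfl with hA
  have hset : Set.Ioo (0 : ℝ) 1 • ((↑) '' ((fun v : S3 => phi.symm (g * phi v * h)) ⁻¹' s)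
      : Set (EuclideanSpace ℝ (Fin 4))) =
      A ⁻¹' (Set.Ioo (0 : ℝ) 1 • ((↑) '' s : Set (EuclideanSpace ℝ (Fin 4)))) := by
    ext v
    simp only [Set.mem_smul, Set.mem_preimage, Set.mem_image]
    constructor
    · rintro ⟨r, hr, _, ⟨u, hu, rfl⟩, rfl⟩
      refine ⟨r, hr, _, ⟨_, hu, rfl⟩, ?_⟩
      rw [map_smul]; rfl
    · rintro ⟨r, hr, _, ⟨u, hu, rfl⟩, hv⟩
      refine ⟨r, hr, _, ⟨phi.symm (g⁻¹ * phi u * h⁻¹), ?_, rfl⟩, ?_⟩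
      · simpa [mul_assoc] using hu
      · apply A.injective
        rw [← hv, map_smul]
        congr 1
        have : A (phi.symm (g⁻¹ * phi u * h⁻¹)).1 = vec (g * phi (phi.symm (g⁻¹ * phi u * h⁻¹)) * h) := rfl
        rw [this]
        simp [mul_assoc, vec]
  rw [hset]
  exact A.measurePreserving.measure_preimage_equiv (f := A.toHomeomorph.toMeasurableEquiv) _

theorem measurePreserving_leftIsoclinic (g : SU2) :
    MeasurePreserving (leftIsoclinic g) uniformS3 uniformS3 := by
  have h := measurePreserving_isoclinic g 1
  simp only [mul_one] at h
  exact h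

theorem measurePreserving_rightIsoclinic (g : SU2) :
    MeasurePreserving (rightIsoclinic g) uniformS3 uniformS3 := by
  have h := measurePreserving_isoclinic 1 g
  simp only [one_mul] at h
  exact h

instance : IsProbabilityMeasure haarSU2 :=
  ⟨by simpa [haarSU2] using Measure.haarMeasure_self (K₀ := (⊤ : TopologicalSpace.PositiveCompacts SU2))⟩

instance : haarSU2.IsHaarMeasure := inferInstanceAs (Measure.haarMeasure _).IsHaarMeasure

/-- Right invariance comes from compactness: the image of Haar measure under a right translation is
again a Haar probability measure, hence the same one. -/
theorem measurePreserving_mul_haarSU2 (g h : SU2) :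
    MeasurePreserving (fun U : SU2 => g * U * h) haarSU2 haarSU2 := by
  have h1 : MeasurePreserving (fun U : SU2 => g * U) haarSU2 haarSU2 :=
    measurePreserving_mul_left haarSU2 g
  have h2 : MeasurePreserving (fun U : SU2 => U * h) haarSU2 haarSU2 := by
    refine ⟨measurable_mul_const h, ?_⟩
    have : IsProbabilityMeasure (Measure.map (fun x : SU2 => x * h) haarSU2) :=
      Measure.isProbabilityMeasure_map (measurable_mul_const h).aemeasurable
    have : (Measure.map (fun x : SU2 => x * h) haarSU2).IsHaarMeasure :=
      Measure.isHaarMeasure_map_mul_right haarSU2 h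
    exact Measure.isHaarMeasure_eq_of_isProbabilityMeasure _ _
  exact h2.comp h1

end

noncomputable section

/-! ### Product measures -/

theorem pi_tilted {ι α : Type*} [Fintype ι] [MeasurableSpace α] (μ : Measure α)
    [IsProbabilityMeasure μ] (f : α → ℝ) (hf : Integrable (fun x => Real.exp (f x)) μ) :
    (Measure.pi fun _ : ι => μ.tilted f) =
      (Measure.pi fun _ : ι => μ).tilted fun x => ∑ i, f (x i) := by
  classical
  have := isProbabilityMeasure_tilted hf
  refine Measure.pi_eq fun s hs => ?_
  rw [tilted_apply_eq_ofReal_integral' _ (MeasurableSet.univ_pi hs), ← integral_indicator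
    (MeasurableSet.univ_pi hs)]
  have h1 : (fun x : ι → α => (Set.univ.pi s).indicator (fun x => Real.exp (∑ i, f (x i)) /
      ∫ x, Real.exp (∑ i, f (x i)) ∂(Measure.pi fun _ : ι => μ)) x) =
      fun x => ∏ i, (s i).indicator (fun y => Real.exp (f y) / ∫ y, Real.exp (f y) ∂μ) (x i) := by
    funext x
    simp_rw [Real.exp_sum, integral_fintype_prod_eq_prod (fun _ y => Real.exp (f y))]
    by_cases hx : x ∈ Set.univ.pi s
    · rw [Set.indicator_of_mem hx, ← Finset.prod_div_distrib]
      exact Finset.prod_congr rfl fun i _ => by rw [Set.indicator_of_mem (hx i trivial)]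
    · rw [Set.indicator_of_notMem hx]
      obtain ⟨i, hi⟩ : ∃ i, x i ∉ s i := by simpa using hx
      exact (Finset.prod_eq_zero (Finset.mem_univ i) (Set.indicator_of_notMem hi _)).symm
  rw [h1, integral_fintype_prod_eq_prod
    (fun i => (s i).indicator (fun y => Real.exp (f y) / ∫ y, Real.exp (f y) ∂μ)),
    ENNReal.ofReal_prod_of_nonneg]
  · refine Finset.prod_congr rfl fun i _ => ?_
    rw [tilted_apply_eq_ofReal_integral' _ (hs i), ← integral_indicator (hs i)]
  · intro i _
    refine integral_nonneg fun y => Set.indicator_nonneg (fun y _ => ?_) y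
    have := integral_nonneg (μ := μ) (f := fun y => Real.exp (f y)) fun y => (Real.exp_pos (f y)).le
    positivity

/-- Resampling one coordinate independently does not change a product law. This is how a single edge
variable is integrated out later, without splitting the index set. -/
theorem measurePreserving_update {ι : Type*} [Fintype ι] [DecidableEq ι] {α : ι → Type*}
    [∀ i, MeasurableSpace (α i)] (μ : ∀ i, Measure (α i)) [∀ i, IsProbabilityMeasure (μ i)]
    (e : ι) :
    MeasurePreserving (fun p : (∀ i, α i) × α e => Function.update p.1 e p.2)
      ((Measure.pi μ).prod (μ e)) (Measure.pi μ) := by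
  have hm : Measurable (fun p : (∀ i, α i) × α e => Function.update p.1 e p.2) := by
    refine measurable_pi_iff.mpr fun i => ?_
    by_cases h : i = e
    · subst h
      simpa using measurable_snd
    · simp only [ne_eq, h, not_false_eq_true, Function.update_of_ne]
      exact (measurable_pi_apply i).comp measurable_fst
  refine ⟨hm, ?_⟩
  refine (Measure.pi_eq fun s hs => ?_).symm
  rw [Measure.map_apply hm (MeasurableSet.univ_pi hs)]
  have : (fun p : (∀ i, α i) × α e => Function.update p.1 e p.2) ⁻¹' (Set.univ.pi s) =
      (Set.univ.pi (Function.update s e Set.univ)) ×ˢ s e := by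
    ext ⟨x, y⟩
    simp only [Set.mem_preimage, Set.mem_pi, Set.mem_univ, true_imp_iff, Set.mem_prod]
    constructor
    · intro h
      refine ⟨fun i => ?_, by simpa using h e⟩
      by_cases hi : i = e
      · subst hi; simp
      · simpa [hi] using h i
    · rintro ⟨h1, h2⟩ i
      by_cases hi : i = e
      · subst hi; simpa using h2
      · simpa [hi] using h1 i
  rw [this, Measure.prod_prod, Measure.pi_pi, ← Finset.mul_prod_erase _ _ (Finset.mem_univ e),
    ← Finset.mul_prod_erase Finset.univ (fun i => μ i (s i)) (Finset.mem_univ e), mul_comm]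
  simp only [Function.update_self, measure_univ, one_mul]
  congr 1
  exact Finset.prod_congr rfl fun i hi => by simp [Finset.ne_of_mem_erase hi]

theorem integral_pi_eq_integral_update {ι : Type*} [Fintype ι] [DecidableEq ι] {α : ι → Type*}
    [∀ i, MeasurableSpace (α i)] (μ : ∀ i, Measure (α i)) [∀ i, IsProbabilityMeasure (μ i)]
    (e : ι) {F : (∀ i, α i) → ℝ} (hF : Integrable F (Measure.pi μ)) :
    ∫ x, F x ∂(Measure.pi μ) = ∫ x, ∫ y, F (Function.update x e y) ∂(μ e) ∂(Measure.pi μ) := by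
  have h := measurePreserving_update μ e
  have h2 := h.integrable_comp_of_integrable hF
  calc ∫ x, F x ∂(Measure.pi μ)
      = ∫ x, F x ∂(((Measure.pi μ).prod (μ e)).map fun p => Function.update p.1 e p.2) := by
        rw [h.map_eq]
    _ = _ := by
        rw [integral_map h.measurable.aemeasurable (by rw [h.map_eq]; exact hF.1)]
        exact integral_prod _ h2

/-! ### The edges of the lattice, the action and gauge transformations -/

variable {d : ℕ}

/-- Two coordinates moving in opposite directions would already give ℓ¹ distance 2. Consequently
every undirected edge has an orientation in `posEdges`. -/
theorem Adj.le_or_le {i j : Fin d → ℤ} (h : Adj i j) : i ≤ j ∨ j ≤ i := by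
  by_contra hcon
  rw [not_or, Pi.le_def, Pi.le_def] at hcon
  push Not at hcon
  obtain ⟨⟨a, ha⟩, b, hb⟩ := hcon
  have hab : a ≠ b := by rintro rfl; omega
  unfold Adj at h
  have h2 : ∑ k ∈ {a, b}, |i k - j k| ≤ ∑ k, |i k - j k| :=
    Finset.sum_le_sum_of_subset_of_nonneg (Finset.subset_univ _) fun _ _ _ => abs_nonneg _
  rw [h, Finset.sum_pair hab] at h2
  have := abs_pos.mpr (sub_ne_zero.mpr ha.ne')
  have := abs_pos.mpr (sub_ne_zero.mpr hb.ne)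
  omega

theorem mem_posEdges {Λ : Finset (Fin d → ℤ)} {e : Λ × Λ} :
    e ∈ posEdges Λ ↔ Adj e.1.1 e.2.1 ∧ e.1.1 ≤ e.2.1 := by
  simp [posEdges]

theorem swap_notMem_posEdges {Λ : Finset (Fin d → ℤ)} {i j : Λ} (h : (i, j) ∈ posEdges Λ) :
    (j, i) ∉ posEdges Λ := by
  intro h2
  rw [mem_posEdges] at h h2
  have h3 : i.1 = j.1 := le_antisymm h.2 h2.2
  exact not_adj_self j.1 (h3 ▸ h.1)

theorem mem_posEdges_or {Λ : Finset (Fin d → ℤ)} {i j : Λ} (h : Adj i.1 j.1) :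
    (i, j) ∈ posEdges Λ ∨ (j, i) ∈ posEdges Λ := by
  rcases h.le_or_le with h1 | h1
  · exact Or.inl (mem_posEdges.mpr ⟨h, h1⟩)
  · exact Or.inr (mem_posEdges.mpr ⟨h.symm, h1⟩)

theorem coupling_of_mem {Λ : Finset (Fin d → ℤ)} (ω : Disorder Λ) {i j : Λ}
    (h : (i, j) ∈ posEdges Λ) : coupling ω i j = ω ⟨(i, j), h⟩ := by
  simp [coupling, h]

theorem coupling_of_swap_mem {Λ : Finset (Fin d → ℤ)} (ω : Disorder Λ) {i j : Λ}
    (h : (j, i) ∈ posEdges Λ) : coupling ω i j = (ω ⟨(j, i), h⟩)⁻¹ := by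
  rw [coupling_swap, coupling_of_mem ω h]; rfl

theorem reTr_eq_chi (U : SU2) : reTr U.1 = 2 * chi U := by
  unfold chi; ring

/-- The two orientations of an edge contribute equally, since the trace form is invariant under
inversion; with `reTr = 2 * chi` this makes the factor 4. -/
theorem action_eq {Λ : Finset (Fin d → ℤ)} (ω : Disorder Λ) (S : Spins Λ) :
    action ω S = ∑ e : posEdges Λ, 4 * chi ((phi (S e.1.1))⁻¹ * ω e * phi (S e.1.2)) := by
  classical
  have hterm (e : Λ × Λ) :
      reTr (star (phi (S e.1)).1 * (coupling ω e.1 e.2).1 * (phi (S e.2)).1) =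
        2 * chi ((phi (S e.1))⁻¹ * coupling ω e.1 e.2 * phi (S e.2)) := by
    rw [← reTr_eq_chi]; rfl
  have hsplit : orientedEdges Λ = posEdges Λ ∪ (posEdges Λ).map (Equiv.prodComm _ _).toEmbedding := by
    ext ⟨i, j⟩
    simp only [orientedEdges, Finset.mem_filter, Finset.mem_univ, true_and, Finset.mem_union,
      Finset.mem_map_equiv]
    constructor
    · exact mem_posEdges_or
    · rintro (h | h)
      · exact (mem_posEdges.mp h).1
      · exact (mem_posEdges.mp h).1.symm
  have hdisj : Disjoint (posEdges Λ) ((posEdges Λ).map (Equiv.prodComm _ _).toEmbedding) := by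
    rw [Finset.disjoint_left]
    rintro ⟨i, j⟩ h h2
    exact swap_notMem_posEdges h (by simpa using h2)
  rw [action, hsplit, Finset.sum_union hdisj, Finset.sum_map, ← Finset.sum_add_distrib,
    ← Finset.sum_coe_sort (posEdges Λ)]
  refine Finset.sum_congr rfl fun e _ => ?_
  obtain ⟨⟨i, j⟩, he⟩ := e
  rw [hterm, hterm]
  simp only [Equiv.coe_toEmbedding, Equiv.prodComm_apply, Prod.swap]
  rw [coupling_of_mem ω he, coupling_of_swap_mem ω he,
    ← chi_inv ((phi (S j))⁻¹ * (ω ⟨(i, j), he⟩)⁻¹ * phi (S i))]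
  simp only [_root_.mul_inv_rev, inv_inv, mul_assoc]
  ring

/-- The gauge transformation `Ω_{i,j} ↦ θ_i Ω_{i,j} θ_j⁻¹` of the disorder. -/
def gauge {Λ : Finset (Fin d → ℤ)} (θ : Λ → SU2) (ω : Disorder Λ) : Disorder Λ :=
  fun e => θ e.1.1 * ω e * (θ e.1.2)⁻¹

theorem coupling_gauge {Λ : Finset (Fin d → ℤ)} (θ : Λ → SU2) (ω : Disorder Λ) {i j : Λ}
    (h : Adj i.1 j.1) : coupling (gauge θ ω) i j = θ i * coupling ω i j * (θ j)⁻¹ := by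
  rcases mem_posEdges_or h with h | h
  · rw [coupling_of_mem _ h, coupling_of_mem _ h]; rfl
  · rw [coupling_of_swap_mem _ h, coupling_of_swap_mem _ h, gauge]
    simp only [_root_.mul_inv_rev, inv_inv, mul_assoc]

/-- The product of the Haar measures over the undirected edges. -/
def haarDisorder (Λ : Finset (Fin d → ℤ)) : Measure (Disorder Λ) := Measure.pi fun _ => haarSU2

instance (Λ : Finset (Fin d → ℤ)) : IsProbabilityMeasure (haarDisorder Λ) :=
  inferInstanceAs (IsProbabilityMeasure (Measure.pi _))

theorem measurePreserving_gauge {Λ : Finset (Fin d → ℤ)} (θ : Λ → SU2) :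
    MeasurePreserving (gauge θ) (haarDisorder Λ) (haarDisorder Λ) :=
  measurePreserving_pi (fun _ : posEdges Λ => haarSU2) (fun _ : posEdges Λ => haarSU2)
    (f := fun e U => θ e.1.1 * U * (θ e.1.2)⁻¹)
    fun e => measurePreserving_mul_haarSU2 (θ e.1.1) (θ e.1.2)⁻¹

theorem continuous_gauge {Λ : Finset (Fin d → ℤ)} (θ : Λ → SU2) : Continuous (gauge θ) :=
  continuous_pi fun e => (continuous_const.mul (continuous_apply e)).mul continuous_const

/-- The (unnormalized) density of the disorder law with respect to the Haar measure. -/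
def disorderWeight {Λ : Finset (Fin d → ℤ)} (β : ℝ) (ω : Disorder Λ) : ℝ :=
  Real.exp (∑ e, β * reTr (ω e).1)

/-- The Boltzmann weight. -/
def gibbsWeight {Λ : Finset (Fin d → ℤ)} (β : ℝ) (ω : Disorder Λ) (S : Spins Λ) : ℝ :=
  Real.exp (β / 2 * action ω S)

/-- The Nishimori condition enters here: the same β multiplies both exponents. The reference spin
`v` cancels by conjugation invariance of the trace, and makes the gauge trivial wherever the spin
equals `v`. -/
theorem gibbsWeight_eq {Λ : Finset (Fin d → ℤ)} (β : ℝ) (ω : Disorder Λ) (S : Spins Λ) (v : S3) :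
    gibbsWeight β ω S = disorderWeight β (gauge (fun i => phi v * (phi (S i))⁻¹) ω) := by
  rw [gibbsWeight, disorderWeight, action_eq, Finset.mul_sum]
  congr 1
  refine Finset.sum_congr rfl fun e _ => ?_
  rw [reTr_eq_chi, gauge, ← chi_conj (phi v)⁻¹ ((phi (S e.1.1))⁻¹ * ω e * phi (S e.1.2))]
  simp only [_root_.mul_inv_rev, inv_inv, mul_assoc]
  ring

theorem gibbsWeight_gauge {Λ : Finset (Fin d → ℤ)} (β : ℝ) (θ : Λ → SU2) (ω : Disorder Λ)
    (S : Spins Λ) :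
    gibbsWeight β (gauge θ ω) (fun i => leftIsoclinic (θ i) (S i)) = gibbsWeight β ω S := by
  rw [gibbsWeight, gibbsWeight, action_eq, action_eq]
  simp only [phi_leftIsoclinic, gauge, _root_.mul_inv_rev, mul_assoc, inv_mul_cancel_left]

/-- A common right factor conjugates every edge term, which the trace does not see. -/
theorem action_rightIsoclinic {Λ : Finset (Fin d → ℤ)} (ω : Disorder Λ) (S : Spins Λ) (g : SU2) :
    action ω (fun i => rightIsoclinic g (S i)) = action ω S := by
  rw [action_eq, action_eq]
  refine Finset.sum_congr rfl fun e _ => ?_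
  rw [← chi_conj g ((phi (S e.1.1))⁻¹ * ω e * phi (S e.1.2))]
  simp only [phi_rightIsoclinic, _root_.mul_inv_rev, mul_assoc]

end

noncomputable section

variable {d : ℕ}

/-! ### Integrals of continuous functions on compact spaces -/

theorem integrable_of_continuous {X E : Type*} [TopologicalSpace X] [CompactSpace X]
    [MeasurableSpace X] [OpensMeasurableSpace X] [NormedAddCommGroup E] [SecondCountableTopology E]
    [SecondCountableTopology X]
    {μ : Measure X} [IsFiniteMeasure μ] {f : X → E} (hf : Continuous f) : Integrable f μ :=
  hf.integrable_of_hasCompactSupport (HasCompactSupport.of_compactSpace f)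

theorem integral_swap_of_continuous {X Y E : Type*} [TopologicalSpace X] [TopologicalSpace Y]
    [CompactSpace X] [CompactSpace Y] [MeasurableSpace X] [MeasurableSpace Y]
    [OpensMeasurableSpace X] [OpensMeasurableSpace Y] [NormedAddCommGroup E] [NormedSpace ℝ E]
    {μ : Measure X} {ν : Measure Y} [IsFiniteMeasure μ] [IsFiniteMeasure ν] {f : X → Y → E}
    (hf : Continuous f.uncurry) :
    ∫ x, (∫ y, f x y ∂ν) ∂μ = ∫ y, (∫ x, f x y ∂μ) ∂ν :=
  integral_integral_swap_of_hasCompactSupport hf (HasCompactSupport.of_compactSpace _)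

theorem continuous_integral_of_continuous {X Y E : Type*} [TopologicalSpace X] [TopologicalSpace Y]
    [CompactSpace X] [T2Space X] [FirstCountableTopology X]
    [CompactSpace Y] [MeasurableSpace Y]
    [OpensMeasurableSpace Y] [NormedAddCommGroup E] [NormedSpace ℝ E]
    [SecondCountableTopology E]
    {ν : Measure Y} [IsFiniteMeasure ν] {f : X → Y → E}
    (hf : Continuous f.uncurry) : Continuous fun x => ∫ y, f x y ∂ν := by
  simpa using continuous_parametric_integral_of_continuous (μ := ν) hf isCompact_univ

/-! ### Averages of quenched expectations -/

variable {Λ : Finset (Fin d → ℤ)}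

theorem continuous_action : Continuous fun p : Disorder Λ × Spins Λ => action p.1 p.2 := by
  simp_rw [action_eq]
  refine continuous_finsetSum _ fun e _ => continuous_const.mul (continuous_chi.comp ?_)
  have h (i : Λ) : Continuous fun p : Disorder Λ × Spins Λ => phi (p.2 i) :=
    continuous_phi.comp ((continuous_apply i).comp continuous_snd)
  exact ((h _).inv.mul ((continuous_apply e).comp continuous_fst)).mul (h _)

theorem continuous_gibbsWeight (β : ℝ) :
    Continuous fun p : Disorder Λ × Spins Λ => gibbsWeight β p.1 p.2 :=
  Real.continuous_exp.comp (continuous_const.mul continuous_action)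

theorem continuous_disorderWeight (β : ℝ) :
    Continuous fun ω : Disorder Λ => disorderWeight β ω := by
  refine Real.continuous_exp.comp (continuous_finsetSum _ fun e _ => continuous_const.mul ?_)
  simp_rw [reTr_eq_chi]
  exact continuous_const.mul (continuous_chi.comp (continuous_apply e))

theorem integrable_exp_reTr (u : ℝ) : Integrable (fun U : SU2 => Real.exp (u * reTr U.1)) haarSU2 := by
  refine integrable_of_continuous ?_
  simp_rw [reTr_eq_chi]
  exact Real.continuous_exp.comp (continuous_const.mul (continuous_const.mul continuous_chi))

instance (u : ℝ) : IsProbabilityMeasure (rho u) :=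
  isProbabilityMeasure_tilted (integrable_exp_reTr u)

instance (u : ℝ) (Λ : Finset (Fin d → ℤ)) : IsProbabilityMeasure (disorderLaw u Λ) :=
  inferInstanceAs (IsProbabilityMeasure (Measure.pi _))

theorem disorderLaw_eq (u : ℝ) (Λ : Finset (Fin d → ℤ)) :
    disorderLaw u Λ = (haarDisorder Λ).tilted fun ω => ∑ e, u * reTr (ω e).1 :=
  pi_tilted haarSU2 (fun U => u * reTr U.1) (integrable_exp_reTr u)

/-- The normalization of the disorder weight. -/
def disorderNorm (β : ℝ) (Λ : Finset (Fin d → ℤ)) : ℝ :=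
  ∫ ω, disorderWeight β ω ∂(haarDisorder Λ)

theorem disorderNorm_pos (β : ℝ) (Λ : Finset (Fin d → ℤ)) : 0 < disorderNorm β Λ :=
  integral_exp_pos (integrable_of_continuous (continuous_disorderWeight β))

theorem integral_disorderLaw (β : ℝ) (g : Disorder Λ → ℝ) :
    ∫ ω, g ω ∂(disorderLaw β Λ) =
      (∫ ω, disorderWeight β ω * g ω ∂(haarDisorder Λ)) / disorderNorm β Λ := by
  rw [disorderLaw_eq, integral_tilted, ← integral_div]
  refine integral_congr_ae (Eventually.of_forall fun ω => ?_)
  simp only [smul_eq_mul]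
  rw [div_mul_eq_mul_div]; rfl

/-- The average over the disorder of the quenched expectation with a priori spin measure `ν`. -/
def quenchedAvg (β : ℝ) (ν : Measure (Spins Λ)) (f : Spins Λ → ℝ) : ℝ :=
  ∫ ω, (∫ S, f S ∂(ν.tilted fun S => β / 2 * action ω S)) ∂(disorderLaw β Λ)

/-- The quenched partition function. -/
def partitionFn (β : ℝ) (ν : Measure (Spins Λ)) (ω : Disorder Λ) : ℝ :=
  ∫ S, gibbsWeight β ω S ∂ν

theorem integral_gibbs (β : ℝ) (ν : Measure (Spins Λ)) (ω : Disorder Λ) (f : Spins Λ → ℝ) :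
    ∫ S, f S ∂(ν.tilted fun S => β / 2 * action ω S) =
      (∫ S, gibbsWeight β ω S * f S ∂ν) / partitionFn β ν ω := by
  rw [integral_tilted, ← integral_div]
  refine integral_congr_ae (Eventually.of_forall fun S => ?_)
  simp only [smul_eq_mul]
  rw [div_mul_eq_mul_div]; rfl

theorem quenchedAvg_const_mul (β : ℝ) (ν : Measure (Spins Λ)) (c : ℝ) (f : Spins Λ → ℝ) :
    quenchedAvg β ν (fun S => c * f S) = c * quenchedAvg β ν f := by
  simp only [quenchedAvg, integral_const_mul]

variable (ν : Measure (Spins Λ)) [IsProbabilityMeasure ν]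

theorem integrable_gibbsWeight (β : ℝ) (ω : Disorder Λ) :
    Integrable (fun S => gibbsWeight β ω S) ν := by
  have h : Continuous fun S : Spins Λ => (ω, S) := by fun_prop
  have hc := (continuous_gibbsWeight (Λ := Λ) β).comp h
  exact integrable_of_continuous hc

theorem partitionFn_pos (β : ℝ) (ω : Disorder Λ) : 0 < partitionFn β ν ω :=
  integral_exp_pos (integrable_gibbsWeight ν β ω)

theorem continuous_partitionFn (β : ℝ) : Continuous (partitionFn β ν) :=
  continuous_integral_of_continuous (continuous_gibbsWeight β)

theorem continuous_integral_gibbs (β : ℝ) {f : Spins Λ → ℝ} (hf : Continuous f) :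
    Continuous fun ω => ∫ S, f S ∂(ν.tilted fun S => β / 2 * action ω S) := by
  simp_rw [integral_gibbs]
  refine Continuous.div ?_ (continuous_partitionFn ν β) fun ω => (partitionFn_pos ν β ω).ne'
  exact continuous_integral_of_continuous
    ((continuous_gibbsWeight β).mul (hf.comp continuous_snd))

instance (β : ℝ) (ω : Disorder Λ) :
    IsProbabilityMeasure (ν.tilted fun S => β / 2 * action ω S) :=
  isProbabilityMeasure_tilted (integrable_gibbsWeight ν β ω)

theorem quenchedAvg_mono (β : ℝ) {f g : Spins Λ → ℝ} (hf : Continuous f) (hg : Continuous g)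
    (h : ∀ S, f S ≤ g S) : quenchedAvg β ν f ≤ quenchedAvg β ν g :=
  integral_mono (integrable_of_continuous (continuous_integral_gibbs ν β hf))
    (integrable_of_continuous (continuous_integral_gibbs ν β hg))
    fun _ => integral_mono (integrable_of_continuous hf) (integrable_of_continuous hg) h

theorem quenchedAvg_add (β : ℝ) {f g : Spins Λ → ℝ} (hf : Continuous f) (hg : Continuous g) :
    quenchedAvg β ν (fun S => f S + g S) = quenchedAvg β ν f + quenchedAvg β ν g := by
  rw [quenchedAvg, quenchedAvg, quenchedAvg,
    ← integral_add (integrable_of_continuous (continuous_integral_gibbs ν β hf))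
    (integrable_of_continuous (continuous_integral_gibbs ν β hg))]
  refine integral_congr_ae (Eventually.of_forall fun ω => ?_)
  exact integral_add (integrable_of_continuous hf) (integrable_of_continuous hg)

theorem quenchedAvg_const (β c : ℝ) : quenchedAvg β ν (fun _ => c) = c := by
  simp [quenchedAvg]

/-- The averaged two-point function. -/
def corr (β : ℝ) (ν : Measure (Spins Λ)) (x y : Λ) : ℝ :=
  quenchedAvg β ν fun S => inner ℝ (S x).1 (S y).1

theorem continuous_inner_spins (x y : Λ) :
    Continuous fun S : Spins Λ => (inner ℝ (S x).1 (S y).1 : ℝ) := by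
  fun_prop

theorem corr_self (β : ℝ) (x : Λ) : corr β ν x x = 1 := by
  have (S : Spins Λ) : (inner ℝ (S x).1 (S x).1 : ℝ) = 1 := by
    rw [inner_eq_chi, inv_mul_cancel, chi_one]
  simp only [corr, this, quenchedAvg_const]

/-- For unit vectors, 1 minus the inner product is half the squared distance, so this is ‖a - c‖² ≤
2‖a - b‖² + 2‖b - c‖², averaged. It replaces the triangle inequality in the chaining. -/
theorem one_sub_corr_le (β : ℝ) (x y z : Λ) :
    1 - corr β ν x z ≤ 2 * (1 - corr β ν x y) + 2 * (1 - corr β ν y z) := by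
  have key : quenchedAvg β ν (fun S => 2 * inner ℝ (S x).1 (S y).1 + 2 * inner ℝ (S y).1 (S z).1)
      ≤ quenchedAvg β ν (fun S => 3 + inner ℝ (S x).1 (S z).1) := by
    refine quenchedAvg_mono ν β (by fun_prop) (by fun_prop) fun S => ?_
    have h (i : Λ) : ‖(S i).1‖ = 1 := by
      have := (S i).2
      rwa [mem_sphere_zero_iff_norm] at this
    have h1 := real_inner_self_nonneg (x := (S x).1 + (S z).1 - (2 : ℝ) • (S y).1)
    simp only [inner_sub_left, inner_sub_right, inner_add_left, inner_add_right,
      real_inner_smul_left, real_inner_smul_right, real_inner_self_eq_norm_sq, h] at h1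
    rw [real_inner_comm (S x).1 (S z).1, real_inner_comm (S x).1 (S y).1,
      real_inner_comm (S y).1 (S z).1] at h1
    rw [norm_smul, h] at h1
    norm_num at h1
    linarith
  rw [quenchedAvg_add ν β (by fun_prop) (by fun_prop),
    quenchedAvg_add ν β (by fun_prop) (by fun_prop), quenchedAvg_const_mul, quenchedAvg_const_mul,
    quenchedAvg_const] at key
  unfold corr
  linarith

end

noncomputable section

variable {d : ℕ} {Λ : Finset (Fin d → ℤ)}

/-! ### The Nishimori identity and the estimator bound -/

instance (B : Finset (Fin d → ℤ)) (v : S3) (i : Λ) :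
    IsProbabilityMeasure (if i.1 ∈ B then Measure.dirac v else uniformS3) := by
  split_ifs <;> infer_instance

instance (Λ B : Finset (Fin d → ℤ)) (v : S3) : IsProbabilityMeasure (fixedSpins Λ B v) :=
  inferInstanceAs (IsProbabilityMeasure (Measure.pi _))

theorem freeSpins_eq_fixedSpins (Λ : Finset (Fin d → ℤ)) (v : S3) :
    freeSpins Λ = fixedSpins Λ ∅ v := by
  simp [freeSpins, fixedSpins]

theorem measurePreserving_fixedSpins (B : Finset (Fin d → ℤ)) (v w : S3) (f : Λ → S3 → S3)
    (hf : ∀ i, MeasurePreserving (f i) uniformS3 uniformS3)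
    (hB : ∀ i : Λ, i.1 ∈ B → f i v = w) :
    MeasurePreserving (fun (S : Spins Λ) i => f i (S i)) (fixedSpins Λ B v) (fixedSpins Λ B w) := by
  refine measurePreserving_pi _ _ fun i => ?_
  split_ifs with h
  · refine ⟨(hf i).measurable, ?_⟩
    rw [Measure.map_dirac' (hf i).measurable, hB i h]
  · exact hf i

theorem ae_fixedSpins (B : Finset (Fin d → ℤ)) (v : S3) (i : Λ) (hi : i.1 ∈ B) :
    ∀ᵐ S ∂(fixedSpins Λ B v), S i = v := by
  have h : ∀ᵐ s ∂(if i.1 ∈ B then Measure.dirac v else uniformS3), s = v := by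
    rw [if_pos hi, ae_dirac_eq]; rfl
  exact (Measure.quasiMeasurePreserving_eval
    (fun i : Λ => if i.1 ∈ B then Measure.dirac v else uniformS3) i).ae h

/-- The vector of `ℝ⁴` attached to the relative rotation of the spins at `x` and `y`. -/
def relVec (x y : Λ) (S : Spins Λ) : EuclideanSpace ℝ (Fin 4) :=
  vec (phi (S x) * (phi (S y))⁻¹)

theorem continuous_relVec (x y : Λ) : Continuous (relVec x y) :=
  continuous_vec.comp ((continuous_phi.comp (continuous_apply x)).mul
    (continuous_phi.comp (continuous_apply y)).inv)

/-- The gauge transformation attached to a spin configuration. -/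
def spinGauge (v : S3) (S : Spins Λ) (i : Λ) : SU2 := phi (S i) * (phi v)⁻¹

theorem gauge_gauge (θ τ : Λ → SU2) (ω : Disorder Λ) :
    gauge θ (gauge τ ω) = gauge (fun i => θ i * τ i) ω := by
  funext e
  simp only [gauge, _root_.mul_inv_rev, mul_assoc]

theorem gauge_one (ω : Disorder Λ) : gauge (fun _ => 1) ω = ω := by
  funext e
  simp [gauge]

theorem gibbsWeight_spinGauge (β : ℝ) (v : S3) (S : Spins Λ) (ω : Disorder Λ) :
    gibbsWeight β (gauge (spinGauge v S) ω) S = disorderWeight β ω := by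
  rw [gibbsWeight_eq β _ S v, gauge_gauge]
  simp [spinGauge, gauge_one]

variable (β : ℝ) (B : Finset (Fin d → ℤ)) (v : S3)

/-- Change variables by rotating each spin with `θ i`. The uniform factors are invariant, and the
Dirac factors survive because `θ` is trivial on `B`. -/
theorem integral_gibbsWeight_gauge (θ : Λ → SU2) (hθ : ∀ i : Λ, i.1 ∈ B → θ i = 1)
    (ω : Disorder Λ) {f : Spins Λ → ℝ} (hf : Continuous f) :
    ∫ S, gibbsWeight β (gauge θ ω) S * f S ∂(fixedSpins Λ B v) =
      ∫ S, gibbsWeight β ω S * f (fun i => leftIsoclinic (θ i) (S i)) ∂(fixedSpins Λ B v) := by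
  have hmp := measurePreserving_fixedSpins B v v (fun i => leftIsoclinic (θ i))
    (fun i => measurePreserving_leftIsoclinic (θ i))
    (fun i hi => by simp [hθ i hi, leftIsoclinic])
  have hc : Continuous fun S => gibbsWeight β (gauge θ ω) S * f S := by
    have h : Continuous fun S : Spins Λ => (gauge θ ω, S) := by fun_prop
    exact ((continuous_gibbsWeight β).comp h).mul hf
  have h1 := integral_map (μ := fixedSpins Λ B v) hmp.measurable.aemeasurable
    (f := fun S => gibbsWeight β (gauge θ ω) S * f S) hc.aestronglyMeasurable
  rw [hmp.map_eq] at h1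
  rw [h1]
  simp only [gibbsWeight_gauge]

theorem partitionFn_gauge (θ : Λ → SU2) (hθ : ∀ i : Λ, i.1 ∈ B → θ i = 1) (ω : Disorder Λ) :
    partitionFn β (fixedSpins Λ B v) (gauge θ ω) = partitionFn β (fixedSpins Λ B v) ω := by
  simpa [partitionFn] using
    integral_gibbsWeight_gauge β B v θ hθ ω (f := fun _ => 1) continuous_const

theorem integral_comp_gauge (θ : Λ → SU2) {F : Disorder Λ → ℝ} (hF : Continuous F) :
    ∫ ω, F (gauge θ ω) ∂(haarDisorder Λ) = ∫ ω, F ω ∂(haarDisorder Λ) := by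
  have hmp := measurePreserving_gauge (Λ := Λ) θ
  have h1 := integral_map (μ := haarDisorder Λ) hmp.measurable.aemeasurable (f := F)
    hF.aestronglyMeasurable
  rw [hmp.map_eq] at h1
  exact h1.symm

/-- In the gauge of a configuration `T`, the two-point function of `S` becomes an overlap between
the replicas `S` and `T`; this is the source of the squared norm in the Nishimori identity. -/
theorem inner_relVec (x y : Λ) (S T : Spins Λ) :
    inner ℝ (relVec x y S) (relVec x y T) =
      inner ℝ (leftIsoclinic (spinGauge v T x)⁻¹ (S x)).1
        (leftIsoclinic (spinGauge v T y)⁻¹ (S y)).1 := by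
  rw [relVec, relVec, inner_vec, inner_eq_chi, phi_leftIsoclinic, phi_leftIsoclinic, spinGauge,
    spinGauge, ← chi_conj (phi (S y)) _]
  simp only [_root_.mul_inv_rev, mul_assoc, inv_inv, inv_mul_cancel_left]

/-- Joint averages over disorder and spins decouple after a gauge transformation. -/
theorem integral_integral_gibbsWeight {G : Disorder Λ → Spins Λ → ℝ}
    (hG : Continuous fun p : Disorder Λ × Spins Λ => G p.1 p.2) :
    ∫ ω, ∫ S, gibbsWeight β ω S * G ω S ∂(fixedSpins Λ B v) ∂(haarDisorder Λ) =
      disorderNorm β Λ * ∫ S, ∫ ω, G (gauge (spinGauge v S) ω) S ∂(disorderLaw β Λ)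
        ∂(fixedSpins Λ B v) := by
  rw [integral_swap_of_continuous ((continuous_gibbsWeight β).mul hG), ← integral_const_mul]
  refine integral_congr_ae (Eventually.of_forall fun S => ?_)
  have hS : Continuous fun ω : Disorder Λ => (ω, S) := by fun_prop
  have := integral_comp_gauge (spinGauge v S)
    (((continuous_gibbsWeight β).mul hG).comp hS)
  simp only [Function.comp_def, Pi.mul_apply, gibbsWeight_spinGauge] at this
  simp only
  rw [← this, integral_disorderLaw, mul_div_cancel₀ _ (disorderNorm_pos β Λ).ne']

/-- The Nishimori identity for the averaged two-point function. -/
theorem corr_eq (x y : Λ) :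
    disorderNorm β Λ * corr β (fixedSpins Λ B v) x y =
      ∫ ω, ‖∫ S, gibbsWeight β ω S • relVec x y S ∂(fixedSpins Λ B v)‖ ^ 2 /
        partitionFn β (fixedSpins Λ B v) ω ∂(haarDisorder Λ) := by
  set ν := fixedSpins Λ B v with hν
  have hZc := continuous_partitionFn ν β
  have hZ0 := fun ω => (partitionFn_pos ν β ω).ne'
  set A : Disorder Λ → ℝ := fun ω =>
    (∫ S, gibbsWeight β ω S * inner ℝ (S x).1 (S y).1 ∂ν) / partitionFn β ν ω with hA
  have hAc : Continuous A := by
    refine Continuous.div ?_ hZc hZ0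
    exact continuous_integral_of_continuous ((continuous_gibbsWeight β).mul
      ((continuous_inner_spins x y).comp continuous_snd))
  have h0 : disorderNorm β Λ * corr β ν x y = ∫ ω, disorderWeight β ω * A ω ∂(haarDisorder Λ) := by
    rw [corr, quenchedAvg, integral_disorderLaw, mul_div_cancel₀ _ (disorderNorm_pos β Λ).ne']
    simp only [integral_gibbs, hA]
  have hNc : Continuous fun p : Disorder Λ × Spins Λ =>
      (∫ S, gibbsWeight β p.1 S * inner ℝ (relVec x y S) (relVec x y p.2) ∂ν) := by
    refine continuous_integral_of_continuous ?_
    have h1 : Continuous fun q : (Disorder Λ × Spins Λ) × Spins Λ => (q.1.1, q.2) := by fun_prop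
    refine ((continuous_gibbsWeight β).comp h1).mul (Continuous.inner ?_ ?_)
    · exact (continuous_relVec x y).comp continuous_snd
    · exact (continuous_relVec x y).comp (continuous_snd.comp continuous_fst)
  -- Gauging by `S'` turns the disorder density into the Boltzmann weight of `S'`, which thereby
  -- becomes a second replica. Agreement with `v` on `B` keeps the gauge trivial at the pinned
  -- sites.
  have hstep (S' : Spins Λ) (hS' : ∀ i : Λ, i.1 ∈ B → S' i = v) :
      ∫ ω, disorderWeight β ω * A ω ∂(haarDisorder Λ) =
        ∫ ω, gibbsWeight β ω S' *
          ((∫ S, gibbsWeight β ω S * inner ℝ (relVec x y S) (relVec x y S') ∂ν) /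
            partitionFn β ν ω) ∂(haarDisorder Λ) := by
    rw [← integral_comp_gauge (fun i => (spinGauge v S' i)⁻¹)
      (F := fun ω => disorderWeight β ω * A ω) ((continuous_disorderWeight β).mul hAc)]
    refine integral_congr_ae (Eventually.of_forall fun ω => ?_)
    have hθ : ∀ i : Λ, i.1 ∈ B → (spinGauge v S' i)⁻¹ = 1 := fun i hi => by
      simp [spinGauge, hS' i hi]
    have h1 : disorderWeight β (gauge (fun i => (spinGauge v S' i)⁻¹) ω) = gibbsWeight β ω S' := by
      rw [gibbsWeight_eq β ω S' v]
      simp [spinGauge]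
    simp only [hA]
    rw [h1, hν, partitionFn_gauge β B v _ hθ,
      integral_gibbsWeight_gauge β B v _ hθ ω (continuous_inner_spins x y)]
    simp only [inner_relVec v]
  have hae : ∀ᵐ S' ∂ν, ∀ i : Λ, i.1 ∈ B → S' i = v := by
    rw [eventually_all]
    intro i
    by_cases hi : i.1 ∈ B
    · filter_upwards [ae_fixedSpins B v i hi] with S hS _ using hS
    · exact Eventually.of_forall fun _ h => absurd h hi
  -- The left side does not involve `S'`, so it may be averaged over the probability measure `ν`.
  have hconst : ∫ ω, disorderWeight β ω * A ω ∂(haarDisorder Λ) =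
      ∫ S', ∫ ω, gibbsWeight β ω S' *
          ((∫ S, gibbsWeight β ω S * inner ℝ (relVec x y S) (relVec x y S') ∂ν) /
            partitionFn β ν ω) ∂(haarDisorder Λ) ∂ν := by
    rw [← integral_congr_ae (hae.mono fun S' hS' => hstep S' hS')]
    simp
  rw [h0, hconst, ← integral_swap_of_continuous]
  · refine integral_congr_ae (Eventually.of_forall fun ω => ?_)
    have hω : Continuous fun S : Spins Λ => (ω, S) := by fun_prop
    have hint : Integrable (fun S => gibbsWeight β ω S • relVec x y S) ν :=
      integrable_of_continuous
        (((continuous_gibbsWeight β).comp hω).smul (continuous_relVec x y))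
    have hin (c : EuclideanSpace ℝ (Fin 4)) :
        inner ℝ c (∫ S, gibbsWeight β ω S • relVec x y S ∂ν) =
          ∫ S, gibbsWeight β ω S * inner ℝ (relVec x y S) c ∂ν := by
      rw [← integral_inner hint]
      simp only [real_inner_smul_right, real_inner_comm]
    simp only [mul_div_assoc', integral_div]
    congr 1
    rw [← real_inner_self_eq_norm_sq, hin]
    refine integral_congr_ae (Eventually.of_forall fun S => ?_)
    simp only
    rw [← hin, real_inner_comm]
  · exact (continuous_gibbsWeight β).mul (hNc.div (hZc.comp continuous_fst) fun p => hZ0 p.1)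

/-- If m is the Gibbs mean of the relative rotation, then 2⟨T, m⟩ - ‖T‖² ≤ ‖m‖² pointwise in the
disorder. On average the right side is the correlation, and the left side is computed by
`integral_integral_gibbsWeight`, which decouples disorder and spins. -/
theorem le_corr_of_estimator (x y : Λ) {T : Disorder Λ → EuclideanSpace ℝ (Fin 4)}
    (hT : Continuous T) {a b : ℝ}
    (ha : ∀ S : Spins Λ, ∫ ω, inner ℝ (relVec x y S) (T (gauge (spinGauge v S) ω))
      ∂(disorderLaw β Λ) = a)
    (hb : ∀ S : Spins Λ, ∫ ω, ‖T (gauge (spinGauge v S) ω)‖ ^ 2 ∂(disorderLaw β Λ) = b) :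
    2 * a - b ≤ corr β (fixedSpins Λ B v) x y := by
  set ν := fixedSpins Λ B v with hν
  have hc0 := disorderNorm_pos β Λ
  have hG : Continuous fun p : Disorder Λ × Spins Λ =>
      2 * inner ℝ (relVec x y p.2) (T p.1) - ‖T p.1‖ ^ 2 := by
    have h1 := (continuous_relVec x y).comp (continuous_snd (X := Disorder Λ))
    have h2 := hT.comp (continuous_fst (Y := Spins Λ))
    exact (continuous_const.mul (h1.inner h2)).sub (h2.norm.pow 2)
  have hE := integral_integral_gibbsWeight β B v
    (G := fun ω S => 2 * inner ℝ (relVec x y S) (T ω) - ‖T ω‖ ^ 2) hG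
  have hval (S : Spins Λ) : ∫ ω, (2 * inner ℝ (relVec x y S) (T (gauge (spinGauge v S) ω))
      - ‖T (gauge (spinGauge v S) ω)‖ ^ 2) ∂(disorderLaw β Λ) = 2 * a - b := by
    have hTg : Continuous fun ω => T (gauge (spinGauge v S) ω) := hT.comp (continuous_gauge _)
    rw [integral_sub, integral_const_mul, ha, hb]
    · exact integrable_of_continuous (continuous_const.mul (continuous_const.inner hTg))
    · exact integrable_of_continuous (hTg.norm.pow 2)
  simp only [hval, integral_const, probReal_univ, one_smul] at hE
  rw [← mul_le_mul_iff_right₀ hc0, ← hE, corr_eq]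
  have hWS : Continuous fun p : Disorder Λ × Spins Λ => gibbsWeight β p.1 p.2 • relVec x y p.2 :=
    (continuous_gibbsWeight β).smul ((continuous_relVec x y).comp continuous_snd)
  refine integral_mono (integrable_of_continuous ?_) (integrable_of_continuous ?_) fun ω => ?_
  · exact continuous_integral_of_continuous ((continuous_gibbsWeight β).mul hG)
  · refine Continuous.div ?_ (continuous_partitionFn _ β) fun ω => (partitionFn_pos _ β ω).ne'
    exact (continuous_integral_of_continuous hWS).norm.pow 2
  · have hω : Continuous fun S : Spins Λ => (ω, S) := by fun_prop
    have hint : Integrable (fun S => gibbsWeight β ω S • relVec x y S) ν :=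
      integrable_of_continuous
        (((continuous_gibbsWeight β).comp hω).smul (continuous_relVec x y))
    have hZ := partitionFn_pos ν β ω
    have hL : ∫ S, gibbsWeight β ω S * (2 * inner ℝ (relVec x y S) (T ω) - ‖T ω‖ ^ 2) ∂ν =
        2 * inner ℝ (T ω) (∫ S, gibbsWeight β ω S • relVec x y S ∂ν)
          - ‖T ω‖ ^ 2 * partitionFn β ν ω := by
      rw [← integral_inner hint, partitionFn, ← integral_const_mul, ← integral_const_mul,
        ← integral_sub]
      · refine integral_congr_ae (Eventually.of_forall fun S => ?_)
        simp only [real_inner_smul_right]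
        rw [real_inner_comm]; ring
      · exact (hint.const_inner _).const_mul _
      · exact (integrable_gibbsWeight ν β ω).const_mul _
    simp only
    rw [hL]
    set V := ∫ S, gibbsWeight β ω S • relVec x y S ∂ν
    rw [le_div_iff₀ hZ]
    have h1 := abs_le.mp (abs_real_inner_le_norm (T ω) V)
    -- Cauchy–Schwarz followed by completing the square, with the partition function cleared from
    -- the denominator.
    nlinarith [sq_nonneg (‖V‖ - ‖T ω‖ * partitionFn β ν ω), h1.2, hZ, mul_le_mul_of_nonneg_right h1.2 hZ.le]

end

noncomputable section

variable {d : ℕ} {Λ : Finset (Fin d → ℤ)}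

/-! ### The mean of the disorder -/

/-- The mean of `chi` under the single-edge law. -/
def lam (u : ℝ) : ℝ := ∫ U, chi U ∂(rho u)

theorem integral_rho_conj (u : ℝ) (g : SU2) {f : SU2 → ℝ} (hf : Continuous f) :
    ∫ U, f (g * U * g⁻¹) ∂(rho u) = ∫ U, f U ∂(rho u) := by
  rw [rho, integral_tilted, integral_tilted]
  have hmp := measurePreserving_mul_haarSU2 g g⁻¹
  have hchi (U : SU2) : chi (g * U * g⁻¹) = chi U := by simpa using chi_conj g⁻¹ U
  have hc : Continuous fun U : SU2 =>
      (Real.exp (u * reTr U.1) / ∫ x, Real.exp (u * reTr x.1) ∂haarSU2) • f U := by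
    simp_rw [reTr_eq_chi]
    exact ((Real.continuous_exp.comp (continuous_const.mul
      (continuous_const.mul continuous_chi))).div_const _).smul hf
  have h1 := integral_map (μ := haarSU2) hmp.measurable.aemeasurable hc.aestronglyMeasurable
  rw [hmp.map_eq] at h1
  rw [h1]
  simp only [reTr_eq_chi, hchi]

/-- A coordinate vector, as a point of the sphere. -/
def basisS3 (k : Fin 4) : S3 := ⟨EuclideanSpace.single k 1, by simp⟩

theorem chi_eq_vec (U : SU2) : chi U = vec U 0 := by
  have h := (SU2_entries U).1
  simp [chi, reTr, vec_eq_coords, coords, Matrix.trace, Fin.sum_univ_two, h]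

/-- Conjugation by an imaginary unit is a half turn that flips the orthogonal imaginary directions.
As `rho` is invariant under conjugation, such half turns force the imaginary part of its mean to
vanish. -/
theorem vec_conj_one (U : SU2) (i : Fin 4) (hi : i = 2 ∨ i = 3) :
    vec (phi (basisS3 1) * U * (phi (basisS3 1))⁻¹) i = -vec U i := by
  rw [vec_eq_coords, vec_eq_coords, Submonoid.coe_mul, Submonoid.coe_mul, inv_coe]
  rcases hi with rfl | rfl <;>
    simp [coords, phi, phiMat, basisS3, Matrix.mul_apply, Fin.sum_univ_two, Matrix.star_apply,
      Matrix.vecMul, dotProduct]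

theorem vec_conj_two (U : SU2) :
    vec (phi (basisS3 2) * U * (phi (basisS3 2))⁻¹) 1 = -vec U 1 := by
  have h := (SU2_entries U).1
  rw [vec_eq_coords, vec_eq_coords, Submonoid.coe_mul, Submonoid.coe_mul, inv_coe]
  simp [coords, phi, phiMat, basisS3, Matrix.mul_apply, Fin.sum_univ_two, Matrix.star_apply, h,
    Matrix.vecMul, dotProduct]

theorem continuous_vec_apply (i : Fin 4) : Continuous fun U => vec U i :=
  (EuclideanSpace.proj (𝕜 := ℝ) i).continuous.comp continuous_vec

theorem integral_vec (u : ℝ) (i : Fin 4) (hi : i ≠ 0) : ∫ U, vec U i ∂(rho u) = 0 := by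
  have key (g : SU2) (h : ∀ U, vec (g * U * g⁻¹) i = -vec U i) : ∫ U, vec U i ∂(rho u) = 0 := by
    have h1 := integral_rho_conj u g (continuous_vec_apply i)
    simp only [h, integral_neg] at h1
    linarith
  fin_cases i
  · exact absurd rfl hi
  · exact key _ vec_conj_two
  · exact key _ fun U => vec_conj_one U 2 (Or.inl rfl)
  · exact key _ fun U => vec_conj_one U 3 (Or.inr rfl)

/-- The mean of the single-edge law is the scalar `lam u`, so averaging a fresh edge only multiplies
by that scalar. -/
theorem integral_chi_mul (u : ℝ) (a : SU2) : ∫ U, chi (a * U) ∂(rho u) = chi a * lam u := by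
  have h (U : SU2) : chi (a * U) = ∑ i, vec a⁻¹ i * vec U i := by
    have := inner_vec a⁻¹ U
    rw [inv_inv, PiLp.inner_apply] at this
    rw [← this]
    refine Finset.sum_congr rfl fun i _ => ?_
    simp [mul_comm]
  simp only [h]
  rw [integral_finsetSum]
  · simp only [integral_const_mul]
    rw [Finset.sum_eq_single 0]
    · rw [← chi_eq_vec, chi_inv, lam]
      simp only [chi_eq_vec]
    · intro i _ hi
      rw [integral_vec u i hi, mul_zero]
    · simp
  · intro i _
    exact (integrable_of_continuous (continuous_vec_apply i)).const_mul _

theorem integral_chi_mul_inv (u : ℝ) (a : SU2) : ∫ U, chi (a * U⁻¹) ∂(rho u) = chi a * lam u := by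
  -- Cayley–Hamilton in `SU(2)`: U + U⁻¹ is the scalar 2 `chi U`.
  have h (U : SU2) : chi (a * U⁻¹) = 2 * chi a * chi U - chi (a * U) := by
    have h1 := inner_vec a⁻¹ U⁻¹
    have h2 := inner_vec a⁻¹ U
    rw [inv_inv] at h1 h2
    have e (U : SU2) : vec U⁻¹ = !₂[vec U 0, - vec U 1, - vec U 2, - vec U 3] := by
      have h' := (SU2_entries U).2
      ext i
      fin_cases i <;> simp [vec_eq_coords, coords, inv_coe, Matrix.star_apply, h']
    rw [← h1, ← h2, ← chi_inv a, chi_eq_vec, chi_eq_vec, PiLp.inner_apply, PiLp.inner_apply,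
      Fin.sum_univ_four, Fin.sum_univ_four, e U]
    simp
    ring
  simp only [h]
  rw [integral_sub, integral_const_mul, integral_chi_mul, ← lam]
  · ring
  · exact (integrable_of_continuous continuous_chi).const_mul _
  · exact integrable_of_continuous (continuous_chi.comp (continuous_const.mul continuous_id))

/-! ### Products of the disorder along paths -/

theorem coupling_update_of_ne [DecidableEq (posEdges Λ)] (ω : Disorder Λ) (e : posEdges Λ) (g : SU2)
    {i j : Λ} (h1 : e.1 ≠ (i, j)) (h2 : e.1 ≠ (j, i)) :
    coupling (Function.update ω e g) i j = coupling ω i j := by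
  have hne {a b : Λ} (h : e.1 ≠ (a, b)) (hab : (a, b) ∈ posEdges Λ) :
      (⟨(a, b), hab⟩ : posEdges Λ) ≠ e := fun hh => h (by rw [← hh])
  unfold coupling
  split_ifs with h h'
  · rw [Function.update_of_ne (hne h1 h)]
  · rw [Function.update_of_ne (hne h2 h')]
  · rfl

theorem continuous_coupling (i j : Λ) : Continuous fun ω : Disorder Λ => coupling ω i j := by
  unfold coupling
  split_ifs with h h'
  · exact continuous_apply _
  · exact (continuous_apply (⟨(j, i), h'⟩ : posEdges Λ)).inv
  · exact continuous_const

open Classical in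
theorem integral_chi_coupling (u : ℝ) {i j : Λ} (hij : Adj i.1 j.1) {A : Disorder Λ → SU2}
    (hA : Continuous A)
    (hinv : ∀ (ω : Disorder Λ) (e : posEdges Λ) (g : SU2), e.1 = (i, j) ∨ e.1 = (j, i) →
      A (Function.update ω e g) = A ω) :
    ∫ ω, chi (A ω * coupling ω i j) ∂(disorderLaw u Λ) =
      lam u * ∫ ω, chi (A ω) ∂(disorderLaw u Λ) := by
  have hint : Integrable (fun ω => chi (A ω * coupling ω i j)) (disorderLaw u Λ) :=
    integrable_of_continuous (continuous_chi.comp (hA.mul (continuous_coupling i j)))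
  rw [← integral_const_mul]
  rcases mem_posEdges_or hij with h | h
  · rw [disorderLaw, integral_pi_eq_integral_update (fun _ => rho u) ⟨(i, j), h⟩ hint]
    refine integral_congr_ae (Eventually.of_forall fun ω => ?_)
    have h1 (g : SU2) : coupling (Function.update ω ⟨(i, j), h⟩ g) i j = g := by
      rw [coupling_of_mem _ h, Function.update_self]
    simp only [hinv ω ⟨(i, j), h⟩ _ (Or.inl rfl), h1]
    rw [integral_chi_mul, mul_comm]
  · rw [disorderLaw, integral_pi_eq_integral_update (fun _ => rho u) ⟨(j, i), h⟩ hint]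
    refine integral_congr_ae (Eventually.of_forall fun ω => ?_)
    have h1 (g : SU2) : coupling (Function.update ω ⟨(j, i), h⟩ g) i j = g⁻¹ := by
      rw [coupling_of_swap_mem _ h, Function.update_self]
    simp only [hinv ω ⟨(j, i), h⟩ _ (Or.inr rfl), h1]
    rw [integral_chi_mul_inv, mul_comm]

/-- The product of the disorder along the first `n` steps of a path. -/
def pathProd (p : ℕ → Λ) (ω : Disorder Λ) : ℕ → SU2
  | 0 => 1
  | n + 1 => pathProd p ω n * coupling ω (p n) (p (n + 1))

theorem continuous_pathProd (p : ℕ → Λ) (n : ℕ) : Continuous fun ω => pathProd p ω n := by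
  induction n with
  | zero => exact continuous_const
  | succ n ih => exact ih.mul (continuous_coupling _ _)

theorem pathProd_gauge (p : ℕ → Λ) (θ : Λ → SU2) (ω : Disorder Λ) (n : ℕ)
    (hp : ∀ t < n, Adj (p t).1 (p (t + 1)).1) :
    pathProd p (gauge θ ω) n = θ (p 0) * pathProd p ω n * (θ (p n))⁻¹ := by
  induction n with
  | zero => simp [pathProd]
  | succ n ih =>
    rw [pathProd, pathProd, ih fun t ht => hp t (by omega), coupling_gauge _ _ (hp n (by omega))]
    simp only [mul_assoc, inv_mul_cancel_left]

theorem pathProd_update [DecidableEq (posEdges Λ)] (p : ℕ → Λ) (ω : Disorder Λ) (e : posEdges Λ)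
    (g : SU2) (n : ℕ) (h1 : ∀ t < n, e.1 ≠ (p t, p (t + 1)))
    (h2 : ∀ t < n, e.1 ≠ (p (t + 1), p t)) :
    pathProd p (Function.update ω e g) n = pathProd p ω n := by
  induction n with
  | zero => rfl
  | succ n ih =>
    rw [pathProd, pathProd, ih (fun t ht => h1 t (by omega)) (fun t ht => h2 t (by omega)),
      coupling_update_of_ne _ _ _ (h1 n (by omega)) (h2 n (by omega))]

/-- A path of length `L` inside `Λ` along which the height function `ht` increases by one at each
step. -/
structure IsDirectedPath (ht : Λ → ℤ) (L : ℕ) (p : ℕ → Λ) : Prop where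
  adj : ∀ t < L, Adj (p t).1 (p (t + 1)).1
  height : ∀ t ≤ L, ht (p t) = t

/-- Step `t` joins heights `t` and `t + 1`, so an edge reveals the time at which it is used.
Different steps, even of different paths, therefore involve independent disorder. -/
theorem IsDirectedPath.edge_ne {ht : Λ → ℤ} {L : ℕ} {p q : ℕ → Λ} (hp : IsDirectedPath ht L p)
    (hq : IsDirectedPath ht L q) {s t : ℕ} (hs : s < L) (hst : t < s) {e : Λ × Λ}
    (he : e = (q s, q (s + 1)) ∨ e = (q (s + 1), q s)) :
    e ≠ (p t, p (t + 1)) ∧ e ≠ (p (t + 1), p t) := by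
  have h1 := hp.height t (by omega)
  have h2 := hp.height (t + 1) (by omega)
  have h3 := hq.height s (by omega)
  have h4 := hq.height (s + 1) (by omega)
  constructor <;>
  · rintro rfl
    rcases he with he | he <;>
    · have e1 := congrArg (fun x => ht x.1) he
      have e2 := congrArg (fun x => ht x.2) he
      simp only [h1, h2, h3, h4] at e1 e2
      omega

theorem IsDirectedPath.integral_chi_pathProd {ht : Λ → ℤ} {L : ℕ} {p : ℕ → Λ}
    (hp : IsDirectedPath ht L p) (u : ℝ) {n : ℕ} (hn : n ≤ L) :
    ∫ ω, chi (pathProd p ω n) ∂(disorderLaw u Λ) = lam u ^ n := by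
  classical
  induction n with
  | zero => simp [pathProd, chi_one]
  | succ n ih =>
    simp only [pathProd]
    rw [integral_chi_coupling u (hp.adj n (by omega)) (continuous_pathProd p n), ih (by omega),
      pow_succ']
    intro ω e g he
    exact pathProd_update p ω e g n (fun t ht => (hp.edge_ne hp (by omega) ht he).1)
      (fun t ht => (hp.edge_ne hp (by omega) ht he).2)

open Classical in
-- Induct on the last step. A common last edge conjugates the rest and drops out of the trace; two
-- distinct last edges are each fresh, and each contributes a factor `lam u`.
theorem IsDirectedPath.integral_chi_pathProd_pair {ht : Λ → ℤ} {L : ℕ} {p q : ℕ → Λ}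
    (hp : IsDirectedPath ht L p) (hq : IsDirectedPath ht L q) (u : ℝ) {n : ℕ} (hn : n ≤ L) :
    ∫ ω, chi ((pathProd p ω n)⁻¹ * pathProd q ω n) ∂(disorderLaw u Λ) =
      ∏ t ∈ Finset.range n, if p t = q t ∧ p (t + 1) = q (t + 1) then 1 else lam u ^ 2 := by
  induction n with
  | zero => simp [pathProd, chi_one]
  | succ n ih =>
    rw [Finset.prod_range_succ, ← ih (by omega)]
    have hinv (p q : ℕ → Λ) (hp : IsDirectedPath ht L p) (hq : IsDirectedPath ht L q)
        (ω : Disorder Λ) (e : posEdges Λ) (g : SU2)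
        (he : e.1 = (q n, q (n + 1)) ∨ e.1 = (q (n + 1), q n)) :
        pathProd p (Function.update ω e g) n = pathProd p ω n :=
      pathProd_update p ω e g n (fun t ht => (hp.edge_ne hq (by omega) ht he).1)
        (fun t ht => (hp.edge_ne hq (by omega) ht he).2)
    split_ifs with h
    · simp only [pathProd, h.1, h.2, mul_one]
      refine integral_congr_ae (Eventually.of_forall fun ω => ?_)
      simp only
      rw [← chi_conj (coupling ω (q n) (q (n + 1))) ((pathProd p ω n)⁻¹ * pathProd q ω n)]
      simp only [_root_.mul_inv_rev, mul_assoc]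
    · have hP := continuous_pathProd p n
      have hQ := continuous_pathProd q n
      have hC := continuous_coupling (p n) (p (n + 1))
      have e1 (ω : Disorder Λ) : (pathProd p ω (n + 1))⁻¹ * pathProd q ω (n + 1) =
          (pathProd p ω n * coupling ω (p n) (p (n + 1)))⁻¹ * pathProd q ω n
            * coupling ω (q n) (q (n + 1)) := by
        simp only [pathProd, mul_assoc]
      simp only [e1]
      rw [integral_chi_coupling u (hq.adj n (by omega))
        (A := fun ω => (pathProd p ω n * coupling ω (p n) (p (n + 1)))⁻¹ * pathProd q ω n)
        ((hP.mul hC).inv.mul hQ)]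
      · have e2 (ω : Disorder Λ) :
            chi ((pathProd p ω n * coupling ω (p n) (p (n + 1)))⁻¹ * pathProd q ω n) =
            chi ((pathProd q ω n)⁻¹ * pathProd p ω n * coupling ω (p n) (p (n + 1))) := by
          rw [← chi_inv]
          simp only [_root_.mul_inv_rev, inv_inv, mul_assoc]
        simp only [e2]
        rw [integral_chi_coupling u (hp.adj n (by omega))
          (A := fun ω => (pathProd q ω n)⁻¹ * pathProd p ω n) (hQ.inv.mul hP)]
        · have e3 (ω : Disorder Λ) : chi ((pathProd q ω n)⁻¹ * pathProd p ω n) =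
              chi ((pathProd p ω n)⁻¹ * pathProd q ω n) := by
            rw [← chi_inv]
            simp only [_root_.mul_inv_rev, inv_inv]
          simp only [e3]
          ring
        · intro ω e g he
          rw [hinv q p hq hp ω e g he, hinv p p hp hp ω e g he]
      · intro ω e g he
        rw [hinv p q hp hq ω e g he, hinv q q hq hq ω e g he, coupling_update_of_ne]
        -- The two last edges differ: equal orientation contradicts `h`, opposite orientation
        -- contradicts the heights.
        all_goals
          intro h'
          have h1 := hp.height n (by omega)
          have h2 := hp.height (n + 1) (by omega)
          have h3 := hq.height n (by omega)
          have h4 := hq.height (n + 1) (by omega)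
          rcases he with he | he
          all_goals
            rw [he, Prod.mk.injEq] at h'
            have e1 := congrArg ht h'.1
            have e2 := congrArg ht h'.2
            first
            | omega
            | exact h ⟨h'.1.symm, h'.2.symm⟩
            | exact h ⟨h'.2.symm, h'.1.symm⟩

open Classical in
/-- Lower bound on the two-point function by the average over a family of directed paths. -/
theorem le_corr_of_paths {Γ : Type*} [Fintype Γ] [Nonempty Γ] (β : ℝ) (hlam : 0 < lam β)
    (B : Finset (Fin d → ℤ)) (v : S3) {x y : Λ} {ht : Λ → ℤ} {L : ℕ} (p : Γ → ℕ → Λ)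
    (hp : ∀ γ, IsDirectedPath ht L (p γ)) (h0 : ∀ γ, p γ 0 = x) (hL : ∀ γ, p γ L = y) :
    2 - (∑ γ, ∑ γ', ∏ t ∈ Finset.range L,
        if p γ t = p γ' t ∧ p γ (t + 1) = p γ' (t + 1) then (lam β ^ 2)⁻¹ else 1) /
          (Fintype.card Γ : ℝ) ^ 2 ≤
      corr β (fixedSpins Λ B v) x y := by
  set N : ℝ := (Fintype.card Γ : ℝ) with hN
  have hN0 : N ≠ 0 := Nat.cast_ne_zero.mpr Fintype.card_ne_zero
  -- Each path product has mean `lam β ^ L` along the relative rotation; this normalization makes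
  -- the estimator unbiased, which is `a = 1`.
  set T : Disorder Λ → EuclideanSpace ℝ (Fin 4) := fun ω =>
    (N⁻¹ * (lam β ^ L)⁻¹) • ∑ γ, vec (pathProd (p γ) ω L) with hT
  have hTc : Continuous T := by
    have h1 : Continuous fun ω => ∑ γ, vec (pathProd (p γ) ω L) :=
      continuous_finsetSum _ fun γ _ => continuous_vec.comp (continuous_pathProd _ _)
    exact h1.const_smul (N⁻¹ * (lam β ^ L)⁻¹)
  have hg (S : Spins Λ) (ω : Disorder Λ) (γ : Γ) : pathProd (p γ) (gauge (spinGauge v S) ω) L =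
      spinGauge v S x * pathProd (p γ) ω L * (spinGauge v S y)⁻¹ := by
    rw [pathProd_gauge _ _ _ _ (hp γ).adj, h0, hL]
  have hpow : lam β ^ L ≠ 0 := (pow_pos hlam L).ne'
  have key := le_corr_of_estimator β B v x y hTc (a := 1)
    (b := (∑ γ, ∑ γ', ∏ t ∈ Finset.range L,
        if p γ t = p γ' t ∧ p γ (t + 1) = p γ' (t + 1) then (lam β ^ 2)⁻¹ else 1) / N ^ 2) ?_ ?_
  · linarith
  · intro S
    have h1 (ω : Disorder Λ) (γ : Γ) :
        inner ℝ (relVec x y S) (vec (pathProd (p γ) (gauge (spinGauge v S) ω) L)) =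
          chi (pathProd (p γ) ω L) := by
      rw [relVec, inner_vec, hg, ← chi_conj ((phi v) * (phi (S y))⁻¹) (pathProd (p γ) ω L)]
      simp only [spinGauge, _root_.mul_inv_rev, inv_inv, mul_assoc, inv_mul_cancel_left]
    simp only [hT, real_inner_smul_right, inner_sum, h1]
    rw [integral_const_mul, integral_finsetSum]
    · simp only [(hp _).integral_chi_pathProd β le_rfl, Finset.sum_const, Finset.card_univ,
        nsmul_eq_mul, ← hN]
      field_simp
    · exact fun γ _ => integrable_of_continuous (continuous_chi.comp (continuous_pathProd _ _))
  · intro S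
    have h1 (ω : Disorder Λ) (γ γ' : Γ) :
        inner ℝ (vec (pathProd (p γ) (gauge (spinGauge v S) ω) L))
          (vec (pathProd (p γ') (gauge (spinGauge v S) ω) L)) =
          chi ((pathProd (p γ) ω L)⁻¹ * pathProd (p γ') ω L) := by
      rw [inner_vec, hg, hg, ← chi_conj (spinGauge v S y)⁻¹ ((pathProd (p γ) ω L)⁻¹ * _)]
      simp only [_root_.mul_inv_rev, inv_inv, mul_assoc, inv_mul_cancel_left]
    have h2 (ω : Disorder Λ) : ‖T (gauge (spinGauge v S) ω)‖ ^ 2 =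
        (N⁻¹ * (lam β ^ L)⁻¹) ^ 2 *
          ∑ γ, ∑ γ', chi ((pathProd (p γ) ω L)⁻¹ * pathProd (p γ') ω L) := by
      simp only [hT]
      rw [norm_smul, mul_pow, Real.norm_eq_abs, sq_abs, ← real_inner_self_eq_norm_sq, sum_inner]
      simp only [inner_sum, h1]
    have hint (γ γ' : Γ) : Integrable
        (fun ω => chi ((pathProd (p γ) ω L)⁻¹ * pathProd (p γ') ω L)) (disorderLaw β Λ) :=
      integrable_of_continuous (continuous_chi.comp
        ((continuous_pathProd _ _).inv.mul (continuous_pathProd _ _)))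
    simp only [h2]
    rw [integral_const_mul, integral_finsetSum _ fun γ _ => integrable_finsetSum _ fun γ' _ => hint γ γ',
      Finset.sum_div, Finset.mul_sum]
    refine Finset.sum_congr rfl fun γ _ => ?_
    rw [integral_finsetSum _ fun γ' _ => hint γ γ', Finset.sum_div, Finset.mul_sum]
    refine Finset.sum_congr rfl fun γ' _ => ?_
    rw [(hp γ).integral_chi_pathProd_pair (hp γ') β le_rfl]
    -- The normalization cancels the factors of unshared edges, so only shared edges carry a cost.
    have h3 : ∏ t ∈ Finset.range L,
        (if p γ t = p γ' t ∧ p γ (t + 1) = p γ' (t + 1) then (lam β ^ 2)⁻¹ else 1) =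
        ((lam β ^ L)⁻¹) ^ 2 * ∏ t ∈ Finset.range L,
        (if p γ t = p γ' t ∧ p γ (t + 1) = p γ' (t + 1) then 1 else lam β ^ 2) := by
      have h4 : ((lam β ^ L)⁻¹) ^ 2 = ∏ _t ∈ Finset.range L, (lam β ^ 2)⁻¹ := by
        rw [Finset.prod_const, Finset.card_range, inv_pow, inv_pow, ← pow_mul, ← pow_mul, mul_comm]
      rw [h4, ← Finset.prod_mul_distrib]
      refine Finset.prod_congr rfl fun t _ => ?_
      split_ifs
      · simp
      · rw [inv_mul_cancel₀ (pow_pos hlam 2).ne']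
    rw [h3]
    field_simp

end

noncomputable section

/-! ### Concentration of the single-edge law -/

theorem one_sub_chi_inv_mul (U V : SU2) :
    1 - chi (U⁻¹ * V) = (∑ i, (vec U i - vec V i) ^ 2) / 2 := by
  have h1 : inner ℝ (vec U - vec V) (vec U - vec V) = 2 - 2 * chi (U⁻¹ * V) := by
    rw [inner_sub_left, inner_sub_right, inner_sub_right, real_inner_self_eq_norm_sq,
      real_inner_self_eq_norm_sq, norm_vec, norm_vec, real_inner_comm (vec U) (vec V), inner_vec]
    ring
  rw [real_inner_self_eq_norm_sq, EuclideanSpace.real_norm_sq_eq] at h1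
  simp only [PiLp.sub_apply] at h1
  rw [h1]; ring

theorem abs_vec_le_one (U : SU2) (i : Fin 4) : |vec U i| ≤ 1 := by
  have := PiLp.norm_apply_le (vec U) i
  rwa [norm_vec, Real.norm_eq_abs] at this

/-- The ball of elements of `SU(2)` with `1 - chi U ≤ r`. -/
def chiBall (r : ℝ) : Set SU2 := {U | 1 - chi U ≤ r}

theorem measurableSet_chiBall (r : ℝ) : MeasurableSet (chiBall r) :=
  (isClosed_le (continuous_const.sub continuous_chi) continuous_const).measurableSet

/-- Pigeonhole: cells of side 2/N cut the sphere into at most (N+1)⁴ pieces, and a left translate of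
each nonempty piece lies in the ball, because four squared differences of at most (2/N)² give 1 -
`chi` ≤ 8/N². -/
theorem le_haarSU2_chiBall {N : ℕ} (hN : 0 < N) :
    ((N + 1 : ℝ) ^ 4)⁻¹ ≤ haarSU2.real (chiBall (8 / N ^ 2)) := by
  have hN' : (0 : ℝ) < N := by exact_mod_cast hN
  set cell : (Fin 4 → Fin (N + 1)) → Set SU2 := fun c =>
    {U | ∀ k, ⌊(vec U k + 1) / 2 * N⌋₊ = c k} with hcell
  have hcover : (Set.univ : Set SU2) ⊆ ⋃ c, cell c := by
    intro U _
    rw [Set.mem_iUnion]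
    refine ⟨fun k => ⟨⌊(vec U k + 1) / 2 * N⌋₊, ?_⟩, fun k => rfl⟩
    rw [Nat.lt_succ_iff]
    have h1 := (abs_le.mp (abs_vec_le_one U k)).2
    refine Nat.floor_le_of_le ?_
    nlinarith
  have hle (c : Fin 4 → Fin (N + 1)) : haarSU2 (cell c) ≤ haarSU2 (chiBall (8 / N ^ 2)) := by
    rcases (cell c).eq_empty_or_nonempty with h | ⟨g, hg⟩
    · rw [h, measure_empty]; exact zero_le
    · rw [← measure_preimage_mul haarSU2 g⁻¹ (chiBall (8 / N ^ 2))]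
      refine measure_mono fun U hU => ?_
      rw [Set.mem_preimage, chiBall, Set.mem_ofPred_eq, one_sub_chi_inv_mul]
      have hk (k : Fin 4) : (vec g k - vec U k) ^ 2 ≤ (2 / N) ^ 2 := by
        have e : ⌊(vec g k + 1) / 2 * N⌋₊ = ⌊(vec U k + 1) / 2 * N⌋₊ := (hg k).trans (hU k).symm
        have hnn (V : SU2) : 0 ≤ (vec V k + 1) / 2 * N := by
          have h1 := (abs_le.mp (abs_vec_le_one V k)).1
          have : 0 ≤ vec V k + 1 := by linarith
          positivity
        have a1 := Nat.floor_le (hnn g)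
        have a2 := Nat.lt_floor_add_one ((vec g k + 1) / 2 * N)
        have b1 := Nat.floor_le (hnn U)
        have b2 := Nat.lt_floor_add_one ((vec U k + 1) / 2 * N)
        rw [e] at a1 a2
        rw [sq_le_sq, abs_of_pos (show (0 : ℝ) < 2 / N by positivity), abs_le]
        constructor
        · rw [neg_le, le_div_iff₀ hN']; linarith
        · rw [le_div_iff₀ hN']; linarith
      have := Finset.sum_le_sum fun k (_ : k ∈ Finset.univ) => hk k
      rw [Finset.sum_const, Finset.card_univ, Fintype.card_fin, nsmul_eq_mul] at this
      calc _ ≤ (((4 : ℕ) : ℝ) * (2 / N) ^ 2) / 2 := by linarith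
        _ = 8 / N ^ 2 := by push_cast; field_simp; norm_num
  have h1 : 1 ≤ ((N + 1) ^ 4 : ℕ) * haarSU2 (chiBall (8 / N ^ 2)) := by
    calc (1 : ENNReal) = haarSU2 Set.univ := measure_univ.symm
      _ ≤ haarSU2 (⋃ c, cell c) := measure_mono hcover
      _ ≤ ∑ c, haarSU2 (cell c) := measure_iUnion_fintype_le _ _
      _ ≤ ∑ _c : Fin 4 → Fin (N + 1), haarSU2 (chiBall (8 / N ^ 2)) :=
        Finset.sum_le_sum fun c _ => hle c
      _ = _ := by
        rw [Finset.sum_const, Finset.card_univ, nsmul_eq_mul]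
        simp
  have h2 := ENNReal.toReal_mono (ENNReal.mul_ne_top (ENNReal.natCast_ne_top _) (measure_ne_top _ _)) h1
  rw [ENNReal.toReal_mul, ENNReal.toReal_natCast, ENNReal.toReal_one] at h2
  rw [inv_le_iff_one_le_mul₀' (by positivity)]
  exact_mod_cast h2

theorem le_integral_exp_chi {β : ℝ} (hβ : 1 ≤ β) :
    (Real.exp 16 * (81 * β ^ 2))⁻¹ ≤ ∫ U, Real.exp (-2 * β * (1 - chi U)) ∂haarSU2 := by
  -- At this scale the ball has radius at most 8/β, so the exponent is at least -16 there; 81 = 3⁴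
  -- comes from N + 1 ≤ 3√β.
  set N := ⌈Real.sqrt β⌉₊ with hN
  have hs1 : 1 ≤ Real.sqrt β := Real.one_le_sqrt.mpr hβ
  have hsN : Real.sqrt β ≤ N := Nat.le_ceil _
  have hNs : (N : ℝ) < Real.sqrt β + 1 := Nat.ceil_lt_add_one (by linarith)
  have hN0 : 0 < N := Nat.ceil_pos.mpr (by linarith)
  have hsq : Real.sqrt β ^ 2 = β := Real.sq_sqrt (by linarith)
  have hball := le_haarSU2_chiBall hN0
  have hN' : (0 : ℝ) < N := by exact_mod_cast hN0
  have hint : Integrable (fun U : SU2 => Real.exp (-2 * β * (1 - chi U))) haarSU2 :=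
    integrable_of_continuous
      (Real.continuous_exp.comp (continuous_const.mul (continuous_const.sub continuous_chi)))
  calc (Real.exp 16 * (81 * β ^ 2))⁻¹ = Real.exp (-16) * (81 * β ^ 2)⁻¹ := by
        rw [mul_inv, Real.exp_neg]
    _ ≤ Real.exp (-16) * ((N + 1 : ℝ) ^ 4)⁻¹ := by
        gcongr
        calc ((N : ℝ) + 1) ^ 4 ≤ (3 * Real.sqrt β) ^ 4 := by gcongr; linarith
          _ = 81 * (Real.sqrt β ^ 2) ^ 2 := by ring
          _ = 81 * β ^ 2 := by rw [hsq]
    _ ≤ Real.exp (-16) * haarSU2.real (chiBall (8 / N ^ 2)) := by gcongr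
    _ = ∫ _U in chiBall (8 / N ^ 2), Real.exp (-16) ∂haarSU2 := by
        rw [setIntegral_const, smul_eq_mul, mul_comm]
    _ ≤ ∫ U in chiBall (8 / N ^ 2), Real.exp (-2 * β * (1 - chi U)) ∂haarSU2 := by
        refine setIntegral_mono_on (integrable_const _) hint.integrableOn
          (measurableSet_chiBall _) fun U hU => ?_
        rw [Real.exp_le_exp]
        have h1 : 1 - chi U ≤ 8 / N ^ 2 := hU
        have h2 : 8 / (N : ℝ) ^ 2 ≤ 8 / β := by
          gcongr
          rw [← hsq]; gcongr
        have h3 : β * (1 - chi U) ≤ β * (8 / β) := by gcongr; linarith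
        rw [mul_div_cancel₀ _ (by linarith)] at h3
        linarith
    _ ≤ _ := setIntegral_le_integral hint (Eventually.of_forall fun U => (Real.exp_pos _).le)

/-- Split at 1 - `chi` = s. Below s the contribution is at most s times the normalization Z. Above
it the weight is at most exp(-2βs) = β⁻³, which is smaller than Z, of order at least β⁻², by a
factor of order 1/β. -/
theorem exists_one_sub_lam_le :
    ∃ C : ℝ, 0 < C ∧ ∀ β : ℝ, 3 ≤ β → 1 - lam β ≤ C * (Real.log β / β) := by
  refine ⟨3 / 2 + 162 * Real.exp 16, by positivity, fun β hβ => ?_⟩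
  have hβ0 : 0 < β := by linarith
  have hlog : 1 ≤ Real.log β := by
    rw [Real.le_log_iff_exp_le hβ0]
    exact Real.exp_one_lt_three.le.trans hβ
  set Z := ∫ U, Real.exp (-2 * β * (1 - chi U)) ∂haarSU2 with hZ
  have hZle := le_integral_exp_chi (β := β) (by linarith)
  rw [← hZ] at hZle
  have hZ0 : 0 < Z := lt_of_lt_of_le (by positivity) hZle
  have hexp (U : SU2) : Real.exp (β * reTr U.1) =
      Real.exp (2 * β) * Real.exp (-2 * β * (1 - chi U)) := by
    rw [← Real.exp_add, reTr_eq_chi]; congr 1; ring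
  have hcδ : Continuous fun U : SU2 => 1 - chi U := continuous_const.sub continuous_chi
  have hce : Continuous fun U : SU2 => Real.exp (-2 * β * (1 - chi U)) :=
    Real.continuous_exp.comp (continuous_const.mul hcδ)
  have hE : 1 - lam β = (∫ U, (1 - chi U) * Real.exp (-2 * β * (1 - chi U)) ∂haarSU2) / Z := by
    have h1 : 1 - lam β = ∫ U, (1 - chi U) ∂(rho β) := by
      rw [integral_sub (integrable_const _) (integrable_of_continuous continuous_chi), lam]
      simp
    rw [h1, rho, integral_tilted, ← integral_div]
    simp only [hexp, integral_const_mul, smul_eq_mul]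
    refine integral_congr_ae (Eventually.of_forall fun U => ?_)
    simp only
    rw [← hZ]
    field_simp
  -- The factor 3/2 gives one power of β more than the lower bound on Z requires.
  set s := 3 / 2 * (Real.log β / β) with hs
  have hbound : ∫ U, (1 - chi U) * Real.exp (-2 * β * (1 - chi U)) ∂haarSU2 ≤
      s * Z + 2 * Real.exp (-2 * β * s) := by
    have h1 : s * Z + 2 * Real.exp (-2 * β * s) =
        ∫ U, (s * Real.exp (-2 * β * (1 - chi U)) + 2 * Real.exp (-2 * β * s)) ∂haarSU2 := by
      rw [integral_add ((integrable_of_continuous hce).const_mul _) (integrable_const _),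
        integral_const_mul]
      simp [hZ]
    rw [h1]
    refine integral_mono (integrable_of_continuous (hcδ.mul hce))
      (((integrable_of_continuous hce).const_mul _).add (integrable_const _)) fun U => ?_
    have hU := abs_le.mp (abs_chi_le_one U)
    have hs0 : 0 ≤ s := by positivity
    have e0 := Real.exp_pos (-2 * β * (1 - chi U))
    have e1 := Real.exp_pos (-2 * β * s)
    simp only
    rcases le_total (1 - chi U) s with h | h
    · nlinarith [mul_le_mul_of_nonneg_right h e0.le]
    · have h2 : Real.exp (-2 * β * (1 - chi U)) ≤ Real.exp (-2 * β * s) := by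
        rw [Real.exp_le_exp]
        nlinarith
      have h3 : (1 - chi U) * Real.exp (-2 * β * (1 - chi U)) ≤ 2 * Real.exp (-2 * β * s) :=
        mul_le_mul (by linarith) h2 e0.le (by norm_num)
      have h4 := mul_nonneg hs0 e0.le
      linarith
  have hes : Real.exp (-2 * β * s) = (β ^ 3)⁻¹ := by
    have : -2 * β * s = -(3 * Real.log β) := by rw [hs]; field_simp
    rw [this, Real.exp_neg, show (3 : ℝ) * Real.log β = ((3 : ℕ) : ℝ) * Real.log β by norm_num,
      Real.exp_nat_mul, Real.exp_log hβ0]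
  rw [hE, div_le_iff₀ hZ0]
  refine hbound.trans ?_
  have h5 : 2 * Real.exp (-2 * β * s) ≤ 162 * Real.exp 16 * (Real.log β / β) * Z := by
    calc 2 * Real.exp (-2 * β * s) = 162 * Real.exp 16 * (1 / β) * (Real.exp 16 * (81 * β ^ 2))⁻¹ := by
          rw [hes]; field_simp; norm_num
      _ ≤ 162 * Real.exp 16 * (Real.log β / β) * Z := by gcongr
  rw [hs]
  linarith

end

noncomputable section

/-! ### Exponential moments of renewal-type counting variables -/

/-- Exchanging `x i` with `a` is an involution of the pairs `(x, a)`: resampling preserves the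
uniform law. -/
theorem card_mul_sum_pi {ι : Type*} [Fintype ι] [DecidableEq ι] {A : ι → Type*}
    [∀ i, Fintype (A i)] (i : ι) (f : (∀ i, A i) → ℝ) :
    (Fintype.card (A i) : ℝ) * ∑ x, f x = ∑ x, ∑ a, f (Function.update x i a) := by
  have h1 : ∑ x, ∑ a, f (Function.update x i a) =
      ∑ p : (∀ i, A i) × A i, f (Function.update p.1 i p.2) := by
    rw [Fintype.sum_prod_type]
  have h2 : (Fintype.card (A i) : ℝ) * ∑ x, f x = ∑ p : (∀ i, A i) × A i, f p.1 := by
    rw [Fintype.sum_prod_type, Finset.mul_sum]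
    simp
  rw [h1, h2]
  refine Finset.sum_nbij' (fun p => (Function.update p.1 i p.2, p.1 i))
    (fun p => (Function.update p.1 i p.2, p.1 i)) ?_ ?_ ?_ ?_ ?_ <;> simp

open Classical in
-- Conditioning on all coordinates except `i`, phrased by counting: `g` is then constant and `H` has
-- probability at most `q`.
theorem sum_mul_indicator_le {ι : Type*} [Fintype ι] [DecidableEq ι] {A : ι → Type*}
    [∀ i, Fintype (A i)] [∀ i, Nonempty (A i)] (i : ι) {g : (∀ i, A i) → ℝ} (hg : ∀ x, 0 ≤ g x)
    (hgi : ∀ x a, g (Function.update x i a) = g x) {H : (∀ i, A i) → Prop} {q : ℝ}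
    (hH : ∀ x, ((Finset.univ.filter fun a => H (Function.update x i a)).card : ℝ) ≤
      q * Fintype.card (A i)) :
    ∑ x, g x * (if H x then 1 else 0) ≤ q * ∑ x, g x := by
  have hc : (0 : ℝ) < Fintype.card (A i) := by exact_mod_cast Fintype.card_pos
  rw [← mul_le_mul_iff_right₀ hc, card_mul_sum_pi i]
  calc ∑ x, ∑ a, g (Function.update x i a) * (if H (Function.update x i a) then 1 else 0)
      = ∑ x, g x * ((Finset.univ.filter fun a => H (Function.update x i a)).card : ℝ) := by
        refine Finset.sum_congr rfl fun x _ => ?_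
        simp only [hgi]
        rw [← Finset.mul_sum, Finset.sum_boole]
    _ ≤ ∑ x, g x * (q * Fintype.card (A i)) :=
        Finset.sum_le_sum fun x _ => mul_le_mul_of_nonneg_left (hH x) (hg x)
    _ = (Fintype.card (A i) : ℝ) * (q * ∑ x, g x) := by
        rw [← Finset.sum_mul]; ring

/-- Expand the product according to the last index at which the summand `ε * h s` is chosen. -/
theorem prod_one_add_eq (ε : ℝ) (h : ℕ → ℝ) (m : ℕ) :
    ∏ s ∈ Finset.range m, (1 + ε * h s) =
      1 + ∑ s ∈ Finset.range m, ε * (h s * ∏ r ∈ Finset.range s, (1 + ε * h r)) := by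
  induction m with
  | zero => simp
  | succ m ih =>
    rw [Finset.prod_range_succ, Finset.sum_range_succ, mul_add, mul_one]
    conv_lhs => rw [ih]
    rw [ih]; ring

/-- If, given the occurrences up to time `s`, an occurrence at time `u > s` has weight at most
`q (u - s)`, then the number of occurrences has a small exponential moment. -/
theorem sum_prod_one_add_le {Γ : Type*} [Fintype Γ] (h : ℕ → Γ → ℝ) (hh : ∀ u x, 0 ≤ h u x)
    (q : ℕ → ℝ) {Q ε : ℝ} (hε : 0 ≤ ε) (hQε : ε * Q ≤ 1 / 2) (m : ℕ)
    (hQ : ∀ m, ∑ j ∈ Finset.range m, q (j + 1) ≤ Q)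
    (h0 : ∀ u < m, ∑ x, h u x ≤ q (u + 1) * Fintype.card Γ)
    (h1 : ∀ u < m, ∀ s < u, ∑ x, h s x * (∏ r ∈ Finset.range s, (1 + ε * h r x)) * h u x ≤
      q (u - s) * ∑ x, h s x * (∏ r ∈ Finset.range s, (1 + ε * h r x))) :
    ∑ x, ∏ s ∈ Finset.range m, (1 + ε * h s x) ≤ (1 + 2 * Q * ε) * Fintype.card Γ := by
  -- The weight of an occurrence at `u`, together with the product over earlier times. Expanding
  -- that product by its last occurrence gives the renewal inequality `hrec`.
  set Ψ : ℕ → ℝ := fun u => ∑ x, h u x * ∏ r ∈ Finset.range u, (1 + ε * h r x) with hΨ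
  have hΨ0 (u : ℕ) : 0 ≤ Ψ u := Finset.sum_nonneg fun x _ => mul_nonneg (hh u x)
    (Finset.prod_nonneg fun r _ => by have := mul_nonneg hε (hh r x); linarith)
  have hrec (u : ℕ) (hu : u < m) :
      Ψ u ≤ q (u + 1) * Fintype.card Γ + ε * ∑ s ∈ Finset.range u, q (u - s) * Ψ s := by
    have e1 : Ψ u = ∑ x, h u x + ε * ∑ s ∈ Finset.range u,
        ∑ x, h s x * (∏ r ∈ Finset.range s, (1 + ε * h r x)) * h u x := by
      rw [Finset.sum_comm, Finset.mul_sum, ← Finset.sum_add_distrib]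
      refine Finset.sum_congr rfl fun x _ => ?_
      rw [prod_one_add_eq, mul_add, mul_one, Finset.mul_sum, Finset.mul_sum]
      congr 1
      exact Finset.sum_congr rfl fun s _ => by ring
    rw [e1]
    refine add_le_add (h0 u hu) (mul_le_mul_of_nonneg_left (Finset.sum_le_sum fun s hs => ?_) hε)
    exact h1 u hu s (Finset.mem_range.mp hs)
  have hsum : ∑ u ∈ Finset.range m, Ψ u ≤
      Q * Fintype.card Γ + ε * (Q * ∑ s ∈ Finset.range m, Ψ s) := by
    calc ∑ u ∈ Finset.range m, Ψ u
        ≤ ∑ u ∈ Finset.range m, (q (u + 1) * Fintype.card Γ +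
            ε * ∑ s ∈ Finset.range u, q (u - s) * Ψ s) :=
          Finset.sum_le_sum fun u hu => hrec u (Finset.mem_range.mp hu)
      _ = (∑ u ∈ Finset.range m, q (u + 1)) * Fintype.card Γ +
            ε * ∑ u ∈ Finset.range m, ∑ s ∈ Finset.range u, q (u - s) * Ψ s := by
          rw [Finset.sum_add_distrib, Finset.sum_mul, Finset.mul_sum]
      _ ≤ Q * Fintype.card Γ + ε * (Q * ∑ s ∈ Finset.range m, Ψ s) := by
          refine add_le_add (mul_le_mul_of_nonneg_right (hQ m) (Nat.cast_nonneg _))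
            (mul_le_mul_of_nonneg_left ?_ hε)
          have hsw : ∑ u ∈ Finset.range m, ∑ s ∈ Finset.range u, q (u - s) * Ψ s =
              ∑ s ∈ Finset.range m, ∑ u ∈ Finset.Ico (s + 1) m, q (u - s) * Ψ s := by
            refine Finset.sum_comm' fun u s => ?_
            simp only [Finset.mem_range, Finset.mem_Ico]
            omega
          rw [hsw, Finset.mul_sum]
          refine Finset.sum_le_sum fun s _ => ?_
          rw [← Finset.sum_mul]
          refine mul_le_mul_of_nonneg_right ?_ (hΨ0 s)
          rw [Finset.sum_Ico_eq_sum_range]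
          refine le_trans (le_of_eq ?_) (hQ (m - (s + 1)))
          refine Finset.sum_congr rfl fun j _ => ?_
          congr 1; omega
  have hS0 : 0 ≤ ∑ s ∈ Finset.range m, Ψ s := Finset.sum_nonneg fun s _ => hΨ0 s
  -- Since `ε * Q ≤ 1 / 2`, the sum on the right is absorbed on the left at the price of a factor 2.
  have hfin : ∑ s ∈ Finset.range m, Ψ s ≤ 2 * Q * Fintype.card Γ := by nlinarith
  have e2 : ∑ x, ∏ s ∈ Finset.range m, (1 + ε * h s x) =
      Fintype.card Γ + ε * ∑ s ∈ Finset.range m, Ψ s := by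
    simp_rw [fun x => prod_one_add_eq ε (fun s => h s x) m, Finset.sum_add_distrib, hΨ]
    rw [Finset.sum_comm, Finset.mul_sum]
    simp [Finset.mul_sum]
  rw [e2]
  nlinarith [mul_le_mul_of_nonneg_left hfin hε]

/-! ### Unpredictable lattice functions -/

/-- The piecewise linear interpolation of the values `X j` at the points `j * L`. -/
def interp (L : ℕ) (X : ℕ → ℝ) (t : ℕ) : ℝ :=
  X (t / L) * (1 - (t % L : ℕ) / L) + X (t / L + 1) * ((t % L : ℕ) / L)

theorem interp_succ_sub {L : ℕ} (hL : 0 < L) (X : ℕ → ℝ) (t : ℕ) :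
    interp L X (t + 1) - interp L X t = (X (t / L + 1) - X (t / L)) / L := by
  have hL' : (L : ℝ) ≠ 0 := by exact_mod_cast hL.ne'
  have h1 := Nat.div_add_mod t L
  have h2 := Nat.mod_lt t hL
  unfold interp
  rcases Nat.lt_or_ge (t % L + 1) L with h | h
  · have e1 : (t + 1) / L = t / L := by
      rw [Nat.div_eq_iff hL]
      have h3 := mul_comm (t / L) L
      omega
    have e2 : (t + 1) % L = t % L + 1 := by
      have := Nat.div_add_mod (t + 1) L
      rw [e1] at this
      omega
    rw [e1, e2]
    push_cast
    field_simp
    ring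
  · have h3 : t % L + 1 = L := by omega
    have e0 : t + 1 = L * (t / L + 1) := by rw [mul_add, mul_one]; omega
    have e1 : (t + 1) / L = t / L + 1 := by rw [e0, Nat.mul_div_cancel_left _ hL]
    have e2 : (t + 1) % L = 0 := by rw [e0, Nat.mul_mod_right]
    have e3 : ((t % L : ℕ) : ℝ) = L - 1 := by
      rw [eq_sub_iff_add_eq]; exact_mod_cast h3
    rw [e1, e2, e3]
    field_simp
    push_cast
    ring

/-- The node `j` acts through a tent function that vanishes outside the open interval from (j-1)L to
(j+1)L; the hypothesis avoids truncated subtraction. -/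
theorem interp_congr {L : ℕ} (hL : 0 < L) {X Y : ℕ → ℝ} {j t : ℕ} (hXY : ∀ i ≠ j, X i = Y i)
    (ht : t + L ≤ j * L ∨ (j + 1) * L ≤ t) : interp L X t = interp L Y t := by
  have h1 := Nat.div_add_mod t L
  have h2 := Nat.mod_lt t hL
  have a1 : t / L ≠ j := by
    rintro rfl
    have h3 := mul_comm (t / L) L
    have h4 := add_mul (t / L) 1 L
    omega
  unfold interp
  rw [hXY _ a1]
  by_cases a2 : t / L + 1 = j
  · have : t % L = 0 := by
      subst a2
      have h3 := mul_comm (t / L) L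
      have h4 := add_mul (t / L) 1 L
      have h5 := add_mul (t / L + 1) 1 L
      omega
    simp [this]
  · rw [hXY _ a2]

/-- The sum over the scales `16 ^ (k + 1)` of the interpolations. -/
def bump (n : ℕ) (X : ℕ → ℕ → ℝ) (t : ℕ) : ℝ :=
  ∑ k ∈ Finset.range n, interp (16 ^ (k + 1)) (X k) t

/-- The rounded multiscale function. -/
def profile (n : ℕ) (X : ℕ → ℕ → ℝ) (t : ℕ) : ℤ := ⌊((t : ℝ) + bump n X t) / 2⌋

/-- Node values of size at most 8^(k+1) at spacing 16^(k+1) give slopes at most 2^(-(k+1)), whose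
sum is below 1. With the drift `t` and the division by 2 in `profile`, increments are then 0 or 1.
-/
theorem abs_bump_succ_sub_le (n : ℕ) {X : ℕ → ℕ → ℝ} (h0 : ∀ k j, 0 ≤ X k j)
    (h1 : ∀ k j, X k j ≤ 8 ^ (k + 1)) (t : ℕ) : |bump n X (t + 1) - bump n X t| ≤ 1 := by
  rw [bump, bump, ← Finset.sum_sub_distrib]
  calc |∑ k ∈ Finset.range n, (interp (16 ^ (k + 1)) (X k) (t + 1) - interp (16 ^ (k + 1)) (X k) t)|
      ≤ ∑ k ∈ Finset.range n, (1 / 2 : ℝ) ^ (k + 1) := by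
        refine (Finset.abs_sum_le_sum_abs _ _).trans (Finset.sum_le_sum fun k _ => ?_)
        rw [interp_succ_sub (by positivity), abs_div]
        have e : (1 / 2 : ℝ) ^ (k + 1) = 8 ^ (k + 1) / 16 ^ (k + 1) := by
          rw [← div_pow]; norm_num
        rw [e]
        push_cast
        rw [abs_of_pos (show (0 : ℝ) < 16 ^ (k + 1) by positivity)]
        gcongr
        rw [abs_le]
        constructor <;> linarith [h0 k (t / 16 ^ (k + 1)), h0 k (t / 16 ^ (k + 1) + 1),
          h1 k (t / 16 ^ (k + 1)), h1 k (t / 16 ^ (k + 1) + 1)]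
    _ ≤ 1 := by
        have : ∀ m : ℕ, ∑ k ∈ Finset.range m, (1 / 2 : ℝ) ^ (k + 1) = 1 - (1 / 2) ^ m := by
          intro m
          induction m with
          | zero => simp
          | succ m ih => rw [Finset.sum_range_succ, ih]; ring
        rw [this]
        have : (0 : ℝ) < (1 / 2) ^ n := by positivity
        linarith

theorem profile_succ (n : ℕ) {X : ℕ → ℕ → ℝ} (h0 : ∀ k j, 0 ≤ X k j)
    (h1 : ∀ k j, X k j ≤ 8 ^ (k + 1)) (t : ℕ) :
    profile n X (t + 1) = profile n X t ∨ profile n X (t + 1) = profile n X t + 1 := by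
  have h := abs_le.mp (abs_bump_succ_sub_le n h0 h1 t)
  have a : profile n X t ≤ profile n X (t + 1) := by
    refine Int.floor_le_floor ?_
    push_cast; linarith
  have b : profile n X (t + 1) ≤ profile n X t + 1 := by
    unfold profile
    rw [← Int.floor_add_one]
    refine Int.floor_le_floor ?_
    push_cast; linarith
  omega

/-- A half-open unit interval contains at most four points of a progression with step at least 1/4.
-/
theorem card_filter_floor_le {N : ℕ} {c : ℝ} (hc : 1 / 4 ≤ c) (r : ℝ) (m : ℤ) :
    (Finset.univ.filter fun a : Fin N => ⌊r + c * (a : ℕ)⌋ = m).card ≤ 4 := by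
  set s := Finset.univ.filter fun a : Fin N => ⌊r + c * (a : ℕ)⌋ = m with hs
  rcases s.eq_empty_or_nonempty with h | h
  · simp [h]
  · have hmin := s.min'_mem h
    set a0 := s.min' h
    have hsub : s.map Fin.valEmbedding ⊆ Finset.Ico (a0 : ℕ) (a0 + 4) := by
      intro a ha
      rw [Finset.mem_map] at ha
      obtain ⟨b, hb, rfl⟩ := ha
      have hle : a0 ≤ b := s.min'_le b hb
      rw [Finset.mem_Ico]
      refine ⟨hle, ?_⟩
      rw [hs, Finset.mem_filter, Int.floor_eq_iff] at hb hmin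
      by_contra hcon
      have h4 : ((a0 : ℕ) : ℝ) + 4 ≤ ((b : ℕ) : ℝ) := by
        simp only [Fin.valEmbedding_apply] at hcon
        exact_mod_cast not_lt.mp hcon
      nlinarith [hb.2.1, hb.2.2, hmin.2.1, hmin.2.2]
    have := Finset.card_le_card hsub
    rwa [Finset.card_map, Nat.card_Ico, Nat.add_sub_cancel_left] at this

end

/-! ### Random profiles and the exponential intersection property. -/

noncomputable section

/-- The node values of a configuration, set to zero at the nodes whose support is not contained in
`[0, n]`. -/
def nodes {n : ℕ} (x : ∀ i : Fin n × Fin (n + 1), Fin (8 ^ (i.1.1 + 1))) (k j : ℕ) : ℝ :=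
  if h : k < n ∧ j < n + 1 ∧ 1 ≤ j ∧ (j + 1) * 16 ^ (k + 1) ≤ n then
    ((x (⟨k, h.1⟩, ⟨j, h.2.1⟩) : ℕ) : ℝ)
  else 0

section Nodes

variable {n : ℕ} (x : ∀ i : Fin n × Fin (n + 1), Fin (8 ^ (i.1.1 + 1)))

theorem nodes_nonneg (k j : ℕ) : 0 ≤ nodes x k j := by
  unfold nodes
  split_ifs <;> positivity

theorem nodes_le (k j : ℕ) : nodes x k j ≤ 8 ^ (k + 1) := by
  unfold nodes
  split_ifs with h
  · have := (x (⟨k, h.1⟩, ⟨j, h.2.1⟩)).2.le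
    exact_mod_cast this
  · positivity

theorem profile_zero : profile n (nodes x) 0 = 0 := by
  have : bump n (nodes x) 0 = 0 :=
    Finset.sum_eq_zero fun k _ => by simp [interp, nodes]
  simp [profile, this]

/-- Nodes whose tent would leave `[0, n]` are switched off, so all profiles share their endpoints.
-/
theorem profile_last : profile n (nodes x) n = ⌊(n : ℝ) / 2⌋ := by
  have : bump n (nodes x) n = 0 := by
    refine Finset.sum_eq_zero fun k _ => ?_
    have h1 : n < (n / 16 ^ (k + 1) + 1) * 16 ^ (k + 1) :=
      Nat.lt_mul_of_div_lt (Nat.lt_succ_self _) (by positivity)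
    have h2 := add_mul (n / 16 ^ (k + 1) + 1) 1 (16 ^ (k + 1))
    have e1 : nodes x k (n / 16 ^ (k + 1)) = 0 := by
      unfold nodes; rw [dif_neg]; omega
    have e2 : nodes x k (n / 16 ^ (k + 1) + 1) = 0 := by
      unfold nodes; rw [dif_neg]; omega
    simp [interp, e1, e2]
  simp [profile, this]

theorem nodes_update_of_ne (i : Fin n × Fin (n + 1)) (a : Fin (8 ^ (i.1.1 + 1))) {k j : ℕ}
    (h : k ≠ i.1 ∨ j ≠ i.2) : nodes (Function.update x i a) k j = nodes x k j := by
  unfold nodes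
  split_ifs with h'
  · rw [Function.update_of_ne]
    rintro rfl
    simp at h
  · rfl

theorem nodes_update_self (i : Fin n × Fin (n + 1)) (a : Fin (8 ^ (i.1.1 + 1)))
    (h1 : 1 ≤ i.2.1) (h2 : (i.2.1 + 1) * 16 ^ (i.1.1 + 1) ≤ n) :
    nodes (Function.update x i a) i.1 i.2 = (a : ℕ) := by
  unfold nodes
  rw [dif_pos ⟨i.1.2, i.2.2, h1, h2⟩]
  simp

end Nodes

/-- The value at `t` is a convex combination of two nodes, one of which has weight at least 1/2. -/
theorem exists_interp_weight {L : ℕ} (hL : 0 < L) (t : ℕ) :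
    ∃ j : ℕ, ∃ w : ℝ, 1 / 2 ≤ w ∧ (j = t / L ∨ j = t / L + 1) ∧
      ∀ X Y : ℕ → ℝ, (∀ i ≠ j, X i = Y i) → interp L X t - interp L Y t = w * (X j - Y j) := by
  have hL' : (0 : ℝ) < L := by exact_mod_cast hL
  rcases le_total ((t % L : ℕ) / L : ℝ) (1 / 2) with h | h
  · refine ⟨t / L, 1 - (t % L : ℕ) / L, by linarith, Or.inl rfl, fun X Y hXY => ?_⟩
    unfold interp
    rw [hXY (t / L + 1) (by omega)]
    ring
  · refine ⟨t / L + 1, (t % L : ℕ) / L, h, Or.inr rfl, fun X Y hXY => ?_⟩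
    unfold interp
    rw [hXY (t / L) (by omega)]
    ring

/-- Take the scale-`k` node with the larger weight at `t`. Its tent stays within two spacings of
`t`, and the margins guarantee that it is active. After halving, its weight is at least 1/4, so each
value at `t` arises from at most four node values. -/
theorem exists_resampling_site {n k t : ℕ} (hk : k < n) (h1 : 2 * 16 ^ (k + 1) ≤ t)
    (h2 : t + 2 * 16 ^ (k + 1) ≤ n) :
    ∃ i : Fin n × Fin (n + 1), i.1.1 = k ∧
      (∀ r, (r + 2 * 16 ^ (k + 1) ≤ t ∨ t + 2 * 16 ^ (k + 1) ≤ r) →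
        ∀ x a, profile n (nodes (Function.update x i a)) r = profile n (nodes x) r) ∧
      ∀ x m, (Finset.univ.filter fun a =>
        profile n (nodes (Function.update x i a)) t = m).card ≤ 4 := by
  set L := 16 ^ (k + 1) with hL
  have hL0 : 0 < L := by positivity
  obtain ⟨j, w, hw, hj, hX⟩ := exists_interp_weight hL0 t
  have d1 := Nat.div_add_mod t L
  have d2 := Nat.mod_lt t hL0
  have d3 := mul_comm (t / L) L
  have d4 := add_mul (t / L) 1 L
  have d5 := add_mul (t / L + 1) 1 L
  have hjL : t < (j + 1) * L ∧ (j + 1) * L ≤ t + 2 * L := by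
    rcases hj with rfl | rfl <;> omega
  have hj1 : 1 ≤ j := by
    by_contra h0
    have : j = 0 := by omega
    subst this
    omega
  have hj2 : (j + 1) * L ≤ n := hjL.2.trans h2
  have hj3 : j < n + 1 := by
    have := Nat.le_mul_of_pos_right (j + 1) hL0
    omega
  have d6 := add_mul j 1 L
  refine ⟨(⟨k, hk⟩, ⟨j, hj3⟩), rfl, ?_, ?_⟩
  · intro r hr x a
    have : bump n (nodes (Function.update x (⟨k, hk⟩, ⟨j, hj3⟩) a)) r = bump n (nodes x) r := by
      refine Finset.sum_congr rfl fun k' _ => ?_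
      by_cases hkk : k' = k
      · subst hkk
        refine interp_congr hL0 (j := j) (fun i hi => nodes_update_of_ne _ _ _ (Or.inr hi)) ?_
        omega
      · congr 1
        funext i
        exact nodes_update_of_ne _ _ _ (Or.inl hkk)
    rw [profile, profile, this]
  · intro x m
    have hb (a : Fin (8 ^ (k + 1))) :
        bump n (nodes (Function.update x (⟨k, hk⟩, ⟨j, hj3⟩) a)) t =
          bump n (nodes x) t - w * nodes x k j + w * (a : ℕ) := by
      have hs := nodes_update_self x (⟨k, hk⟩, ⟨j, hj3⟩) a hj1 hj2
      have e : bump n (nodes (Function.update x (⟨k, hk⟩, ⟨j, hj3⟩) a)) t - bump n (nodes x) t =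
          w * ((a : ℕ) - nodes x k j) := by
        rw [bump, bump, ← Finset.sum_sub_distrib, Finset.sum_eq_single k]
        · rw [hX _ (nodes x k) fun i hi => nodes_update_of_ne _ _ _ (Or.inr hi)]
          simp only at hs
          rw [hs]
        · intro k' _ hkk
          rw [sub_eq_zero]
          congr 1
          funext i
          exact nodes_update_of_ne _ _ _ (Or.inl hkk)
        · intro h; exact absurd (Finset.mem_range.mpr hk) h
      linarith
    have := card_filter_floor_le (N := 8 ^ (k + 1)) (c := w / 2) (by linarith)
      (((t : ℝ) + (bump n (nodes x) t - w * nodes x k j)) / 2) m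
    refine le_trans (le_of_eq ?_) this
    congr 1
    refine Finset.filter_congr fun a _ => ?_
    rw [profile, hb]
    ring_nf

/-- The configurations: two independent uniform values at each node. -/
abbrev NodeConfig (n : ℕ) : Type :=
  ∀ i : Fin n × Fin (n + 1), Fin (8 ^ (i.1.1 + 1)) × Fin (8 ^ (i.1.1 + 1))

/-- The first transverse coordinate. -/
def profileFst {n : ℕ} (x : NodeConfig n) (t : ℕ) : ℤ := profile n (nodes fun i => (x i).1) t

/-- The second transverse coordinate. -/
def profileSnd {n : ℕ} (x : NodeConfig n) (t : ℕ) : ℤ := profile n (nodes fun i => (x i).2) t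

/-- The configuration passes at time `t` through a prescribed transverse position. -/
def Hits {n : ℕ} (m : ℕ → ℤ × ℤ) (t : ℕ) (x : NodeConfig n) : Prop :=
  profileFst x t = (m t).1 ∧ profileSnd x t = (m t).2

open Classical in
-- The two transverse coordinates are resampled independently at the same node, giving 4 · 4
-- favourable pairs out of 64^(k+1).
theorem exists_resampling_site_hits {n k t : ℕ} (m : ℕ → ℤ × ℤ) (hk : k < n)
    (h1 : 2 * 16 ^ (k + 1) ≤ t) (h2 : t + 2 * 16 ^ (k + 1) ≤ n) :
    ∃ i : Fin n × Fin (n + 1), i.1.1 = k ∧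
      (∀ r, (r + 2 * 16 ^ (k + 1) ≤ t ∨ t + 2 * 16 ^ (k + 1) ≤ r) →
        ∀ x a, Hits m r (Function.update x i a) ↔ Hits m r x) ∧
      ∀ x, (Finset.univ.filter fun a => Hits m t (Function.update x i a)).card ≤ 16 := by
  obtain ⟨i, hi, hind, hcard⟩ := exists_resampling_site hk h1 h2
  have u1 (x : NodeConfig n) (a) : (fun i' => (Function.update x i a i').1) =
      Function.update (fun i' => (x i').1) i a.1 := by
    funext i'
    by_cases h : i' = i
    · subst h; simp
    · simp [h]
  have u2 (x : NodeConfig n) (a) : (fun i' => (Function.update x i a i').2) =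
      Function.update (fun i' => (x i').2) i a.2 := by
    funext i'
    by_cases h : i' = i
    · subst h; simp
    · simp [h]
  refine ⟨i, hi, fun r hr x a => ?_, fun x => ?_⟩
  · unfold Hits profileFst profileSnd
    rw [u1, u2, hind r hr, hind r hr]
  · have c1 := hcard (fun i' => (x i').1) (m t).1
    have c2 := hcard (fun i' => (x i').2) (m t).2
    refine (Finset.card_le_card (t := (Finset.univ.filter fun a =>
        profile n (nodes (Function.update (fun i' => (x i').1) i a)) t = (m t).1) ×ˢ
      (Finset.univ.filter fun a =>
        profile n (nodes (Function.update (fun i' => (x i').2) i a)) t = (m t).2)) ?_).trans ?_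
    · intro a ha
      rw [Finset.mem_filter] at ha
      have h := ha.2
      unfold Hits profileFst profileSnd at h
      rw [u1, u2] at h
      simp [h.1, h.2]
    · rw [Finset.card_product]
      nlinarith

/-- The bound on the conditional probability of a coincidence after a time gap `s`. -/
def gapBound (s : ℕ) : ℝ := 16 / 64 ^ Nat.log 16 (s / 2)

/-- Here 64 = 16^(3/2) and s ≤ 2 · 16^(κ+1), whence a summable decay s^(-3/2). A single transverse
coordinate would have 8 = 16^(3/4) in place of 64, and s^(-3/4) is not summable: this is the role of
the third dimension. -/
theorem gapBound_le {s : ℕ} (hs : 1 ≤ s) :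
    gapBound s ≤ 16 * 32 ^ (3 / 2 : ℝ) * (1 / (s : ℝ) ^ (3 / 2 : ℝ)) := by
  set κ := Nat.log 16 (s / 2) with hκ
  have hs' : (0 : ℝ) < s := by exact_mod_cast hs
  have h1 : s / 2 < 16 ^ (κ + 1) := Nat.lt_pow_succ_log_self (by norm_num) _
  have h2 : (s : ℝ) ≤ 32 * (4 ^ κ) ^ 2 := by
    have e : (32 : ℝ) * (4 ^ κ) ^ 2 = ((2 * 16 ^ (κ + 1) : ℕ) : ℝ) := by
      push_cast
      rw [← pow_mul, mul_comm κ 2, pow_mul]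
      norm_num
      ring
    rw [e]
    exact_mod_cast (by omega : s ≤ 2 * 16 ^ (κ + 1))
  have h3 : (s : ℝ) ^ (3 / 2 : ℝ) ≤ 32 ^ (3 / 2 : ℝ) * 64 ^ κ := by
    calc (s : ℝ) ^ (3 / 2 : ℝ) ≤ (32 * (4 ^ κ) ^ 2) ^ (3 / 2 : ℝ) :=
          Real.rpow_le_rpow hs'.le h2 (by norm_num)
      _ = 32 ^ (3 / 2 : ℝ) * (((4 : ℝ) ^ κ) ^ 2) ^ (3 / 2 : ℝ) :=
          Real.mul_rpow (by norm_num) (by positivity)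
      _ = 32 ^ (3 / 2 : ℝ) * 64 ^ κ := by
          congr 1
          rw [← Real.rpow_natCast ((4 : ℝ) ^ κ) 2, ← Real.rpow_mul (by positivity)]
          norm_num
          rw [← pow_mul, mul_comm κ 3, pow_mul]
          norm_num
  rw [gapBound, ← hκ, mul_one_div, div_le_div_iff₀ (by positivity) (by positivity)]
  linarith

theorem exists_sum_gapBound_le : ∃ Q : ℝ, 0 < Q ∧
    ∀ m, ∑ j ∈ Finset.range m, gapBound (j + 1) ≤ Q := by
  have hsum : Summable fun s : ℕ => 1 / (s : ℝ) ^ (3 / 2 : ℝ) :=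
    Real.summable_one_div_nat_rpow.mpr (by norm_num)
  have hsum' := (summable_nat_add_iff 1).mpr hsum
  set T := ∑' s : ℕ, 1 / (((s + 1 : ℕ) : ℝ)) ^ (3 / 2 : ℝ) with hT
  have hT0 : 0 ≤ T := tsum_nonneg fun s => by positivity
  refine ⟨16 * 32 ^ (3 / 2 : ℝ) * T + 1, by positivity, fun m => ?_⟩
  calc ∑ j ∈ Finset.range m, gapBound (j + 1)
      ≤ ∑ j ∈ Finset.range m, 16 * 32 ^ (3 / 2 : ℝ) * (1 / (((j + 1 : ℕ) : ℝ)) ^ (3 / 2 : ℝ)) :=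
        Finset.sum_le_sum fun j _ => gapBound_le (by omega)
    _ = 16 * 32 ^ (3 / 2 : ℝ) * ∑ j ∈ Finset.range m, 1 / (((j + 1 : ℕ) : ℝ)) ^ (3 / 2 : ℝ) := by
        rw [Finset.mul_sum]
    _ ≤ 16 * 32 ^ (3 / 2 : ℝ) * T := by
        gcongr
        exact hsum'.sum_le_tsum _ fun s _ => by positivity
    _ ≤ _ := by linarith

open Classical in
theorem sum_mul_hits_le {n t s : ℕ} (m : ℕ → ℤ × ℤ) (h1 : s ≤ t) (h2 : t + s ≤ n)
    {g : NodeConfig n → ℝ} (hg0 : ∀ x, 0 ≤ g x)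
    (hg : ∀ x y, (∀ r, (r + s ≤ t ∨ t + s ≤ r) → (Hits m r x ↔ Hits m r y)) → g x = g y) :
    ∑ x, g x * (if Hits m t x then 1 else 0) ≤ gapBound s * ∑ x, g x := by
  -- For s < 32 no scale fits into the gap, but then the bound equals 16 and is trivial.
  rcases Nat.eq_zero_or_pos (Nat.log 16 (s / 2)) with h0 | h0
  · rw [gapBound, h0, Finset.mul_sum]
    refine Finset.sum_le_sum fun x _ => ?_
    have := hg0 x
    split_ifs <;> linarith
  · obtain ⟨k, hk⟩ : ∃ k, Nat.log 16 (s / 2) = k + 1 := ⟨_, (Nat.succ_pred_eq_of_pos h0).symm⟩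
    have hs : 16 ^ (k + 1) ≤ s / 2 := by
      rw [← hk]
      refine Nat.pow_log_le_self 16 ?_
      intro h
      rw [h] at hk
      simp at hk
    have hkn : k < n := by
      have : k < 16 ^ k := Nat.lt_pow_self (by norm_num)
      have : 16 ^ k ≤ 16 ^ (k + 1) := Nat.pow_le_pow_right (by norm_num) (by omega)
      omega
    obtain ⟨i, hi, hind, hcard⟩ := exists_resampling_site_hits m hkn
      (t := t) (by omega) (by omega)
    have hgi (x : NodeConfig n) (a) : g (Function.update x i a) = g x :=
      hg _ _ fun r hr => hind r (by omega) x a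
    refine sum_mul_indicator_le i hg0 hgi fun x => ?_
    have e : (Fintype.card (Fin (8 ^ (i.1.1 + 1)) × Fin (8 ^ (i.1.1 + 1))) : ℝ) =
        64 ^ (k + 1) := by
      rw [Fintype.card_prod, Fintype.card_fin, hi]
      push_cast
      rw [← mul_pow]
      norm_num
    rw [e, gapBound, hk, div_mul_cancel₀ _ (by positivity)]
    exact_mod_cast hcard x

open Classical in
-- The enumeration `τ` lets one argument serve both reading directions. Its hypotheses say that the
-- `u`-th time is at least `u + 1` away from both ends and at least `u - s` away from the times up
-- to the `s`-th.
theorem sum_prod_hits_le {n M : ℕ} (m : ℕ → ℤ × ℤ) (τ : ℕ → ℕ)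
    (hτ1 : ∀ u < M, u + 1 ≤ τ u) (hτ2 : ∀ u < M, τ u + (u + 1) ≤ n)
    (hτ3 : ∀ u < M, ∀ s < u, τ s + (u - s) ≤ τ u ∨ τ u + (u - s) ≤ τ s)
    (hτ4 : ∀ u < M, ∀ s < u, ∀ r < s, τ r + (u - s) ≤ τ u ∨ τ u + (u - s) ≤ τ r)
    {Q ε : ℝ} (hε : 0 ≤ ε) (hQε : ε * Q ≤ 1 / 2)
    (hQ : ∀ m, ∑ j ∈ Finset.range m, gapBound (j + 1) ≤ Q) :
    ∑ x : NodeConfig n, ∏ u ∈ Finset.range M, (1 + ε * (if Hits m (τ u) x then 1 else 0)) ≤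
      (1 + 2 * Q * ε) * Fintype.card (NodeConfig n) := by
  have hnn (u : ℕ) (x : NodeConfig n) : (0 : ℝ) ≤ if Hits m (τ u) x then 1 else 0 := by
    split_ifs <;> norm_num
  refine sum_prod_one_add_le (fun u x => if Hits m (τ u) x then 1 else 0) hnn
    gapBound hε hQε M hQ ?_ ?_
  · intro u hu
    have := sum_mul_hits_le m (hτ1 u hu) (hτ2 u hu) (g := fun _ => 1) (fun _ => zero_le_one)
      (fun _ _ _ => rfl)
    simpa using this
  · intro u hu s hs
    refine sum_mul_hits_le m (s := u - s) (by have := hτ1 u hu; omega)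
      (by have := hτ2 u hu; omega) (fun x => mul_nonneg (hnn s x) (Finset.prod_nonneg fun r _ => ?_)) ?_
    · have := mul_nonneg hε (hnn r x); linarith
    · intro x y hxy
      have e1 : Hits m (τ s) x ↔ Hits m (τ s) y := hxy _ (hτ3 u hu s hs)
      have e2 : ∀ r ∈ Finset.range s, (1 + ε * (if Hits m (τ r) x then 1 else 0) : ℝ) =
          1 + ε * (if Hits m (τ r) y then 1 else 0) := fun r hr => by
        simp only [hxy _ (hτ4 u hu s hs r (Finset.mem_range.mp hr))]
      simp only [e1]
      rw [Finset.prod_congr rfl e2]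

open Classical in
/-- The exponential intersection property: the number of coincidences with a fixed function has a
small exponential moment, uniformly in the length. -/
theorem exists_exponential_intersection : ∃ Q : ℝ, 0 < Q ∧ ∀ (n : ℕ) (m : ℕ → ℤ × ℤ) (ε : ℝ),
    0 ≤ ε → ε ≤ 1 → ε * Q ≤ 1 →
    ∑ x : NodeConfig n, ∏ t ∈ Finset.Ico 1 n, (1 + ε * (if Hits m t x then 1 else 0)) ≤
      (1 + Q * ε) * Fintype.card (NodeConfig n) := by
  obtain ⟨Q, hQ0, hQ⟩ := exists_sum_gapBound_le
  refine ⟨6 * Q, by positivity, fun n m ε hε0 hε1 hεQ => ?_⟩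
  -- Resampling needs room at both ends, so each half is read outward from its own end. The
  -- parameter `3 * ε` anticipates (1 + ε)² ≤ 1 + 3ε.
  have hfwd := sum_prod_hits_le (n := n) (M := n / 2) m (fun u => u + 1) (fun u hu => le_rfl)
    (fun u hu => by omega) (fun u hu s hs => by omega) (fun u hu s hs r hr => by omega)
    (Q := Q) (ε := 3 * ε) (by positivity) (by linarith) hQ
  have hbwd := sum_prod_hits_le (n := n) (M := n / 2) m (fun u => n - (u + 1))
    (fun u hu => by omega)
    (fun u hu => by omega) (fun u hu s hs => by omega) (fun u hu s hs r hr => by omega)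
    (Q := Q) (ε := 3 * ε) (by positivity) (by linarith) hQ
  -- The two halves are dependent; P₁P₂ ≤ (P₁² + P₂²)/2 separates them. A midpoint counted twice is
  -- harmless since all factors are at least 1.
  have hpt (x : NodeConfig n) :
      ∏ t ∈ Finset.Ico 1 n, (1 + ε * (if Hits m t x then 1 else 0) : ℝ) ≤
      ((∏ u ∈ Finset.range (n / 2), (1 + 3 * ε * (if Hits m (u + 1) x then 1 else 0))) +
        ∏ u ∈ Finset.range (n / 2), (1 + 3 * ε * (if Hits m (n - (u + 1)) x then 1 else 0))) / 2 := by
    set f : ℕ → ℝ := fun t => 1 + ε * (if Hits m t x then 1 else 0) with hf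
    have hf1 (t : ℕ) : 1 ≤ f t := by
      simp only [hf]; split_ifs <;> linarith
    have hf2 (t : ℕ) : f t ^ 2 ≤ 1 + 3 * ε * (if Hits m t x then 1 else 0) := by
      simp only [hf]; split_ifs <;> nlinarith
    have hf0 (t : ℕ) : 0 ≤ f t := zero_le_one.trans (hf1 t)
    have hsub : Finset.Ico 1 n ⊆ (Finset.range (n / 2)).image (fun u => u + 1) ∪
        (Finset.range (n / 2)).image (fun u => n - (u + 1)) := by
      intro t ht
      rw [Finset.mem_Ico] at ht
      rw [Finset.mem_union, Finset.mem_image, Finset.mem_image]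
      rcases le_or_gt t (n / 2) with h | h
      · exact Or.inl ⟨t - 1, Finset.mem_range.mpr (by omega), by omega⟩
      · exact Or.inr ⟨n - t - 1, Finset.mem_range.mpr (by omega), by omega⟩
    set P1 := ∏ u ∈ Finset.range (n / 2), f (u + 1)
    set P2 := ∏ u ∈ Finset.range (n / 2), f (n - (u + 1))
    have hP : ∏ t ∈ Finset.Ico 1 n, f t ≤ P1 * P2 := by
      calc ∏ t ∈ Finset.Ico 1 n, f t
          ≤ ∏ t ∈ (Finset.range (n / 2)).image (fun u => u + 1) ∪
              (Finset.range (n / 2)).image (fun u => n - (u + 1)), f t :=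
            Finset.prod_le_prod_of_subset_of_one_le hsub (fun t _ => hf0 t) fun t _ _ => hf1 t
        _ ≤ (∏ t ∈ (Finset.range (n / 2)).image (fun u => u + 1), f t) *
              ∏ t ∈ (Finset.range (n / 2)).image (fun u => n - (u + 1)), f t := by
            rw [← Finset.prod_union_inter]
            exact le_mul_of_one_le_right (Finset.prod_nonneg fun t _ => hf0 t)
              (Finset.one_le_prod fun t _ => hf1 t)
        _ = P1 * P2 := by
            rw [Finset.prod_image, Finset.prod_image]
            · intro a ha b hb hab
              simp only [Finset.coe_range, Set.mem_Iio] at ha hb hab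
              omega
            · intro a _ b _ hab
              simpa using hab
    have hs1 : P1 ^ 2 ≤ ∏ u ∈ Finset.range (n / 2),
        (1 + 3 * ε * (if Hits m (u + 1) x then 1 else 0)) := by
      rw [← Finset.prod_pow]
      exact Finset.prod_le_prod (fun u _ => sq_nonneg _) fun u _ => hf2 _
    have hs2 : P2 ^ 2 ≤ ∏ u ∈ Finset.range (n / 2),
        (1 + 3 * ε * (if Hits m (n - (u + 1)) x then 1 else 0)) := by
      rw [← Finset.prod_pow]
      exact Finset.prod_le_prod (fun u _ => sq_nonneg _) fun u _ => hf2 _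
    nlinarith [sq_nonneg (P1 - P2)]
  refine (Finset.sum_le_sum fun x _ => hpt x).trans ?_
  rw [← Finset.sum_div, Finset.sum_add_distrib]
  linarith

end

noncomputable section

/-! ### Lattice paths -/

/-- Three distinct coordinate axes with signs. -/
structure Frame (d : ℕ) where
  i : Fin d
  j : Fin d
  k : Fin d
  hij : i ≠ j
  hik : i ≠ k
  hjk : j ≠ k
  a : ℤ
  b : ℤ
  c : ℤ
  ha : a * a = 1
  hb : b * b = 1
  hc : c * c = 1

variable {d : ℕ}

/-- The lattice point with coordinates `u, v, w` in a frame based at `x`. -/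
def Frame.point (F : Frame d) (x : Fin d → ℤ) (u v w : ℤ) : Fin d → ℤ := fun l =>
  x l + ((if l = F.i then F.a * u else 0) + (if l = F.j then F.b * v else 0) +
    (if l = F.k then F.c * w else 0))

namespace Frame

variable (F : Frame d) (x : Fin d → ℤ)

theorem point_i (u v w : ℤ) : F.point x u v w F.i = x F.i + F.a * u := by
  simp [point, F.hij, F.hik]

theorem point_j (u v w : ℤ) : F.point x u v w F.j = x F.j + F.b * v := by
  simp [point, F.hij.symm, F.hjk]

theorem point_k (u v w : ℤ) : F.point x u v w F.k = x F.k + F.c * w := by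
  simp [point, F.hik.symm, F.hjk.symm]

theorem point_of_ne {l : Fin d} (hi : l ≠ F.i) (hj : l ≠ F.j) (hk : l ≠ F.k) (u v w : ℤ) :
    F.point x u v w l = x l := by
  simp [point, hi, hj, hk]

theorem point_zero : F.point x 0 0 0 = x := by
  funext l; simp [point]

theorem sum_abs_point_sub (u v w u' v' w' : ℤ) :
    ∑ l, |F.point x u v w l - F.point x u' v' w' l| = |u - u'| + |v - v'| + |w - w'| := by
  have habs {s : ℤ} (hs : s * s = 1) (t : ℤ) : |s * t| = |t| := by
    have : |s| = 1 := by
      rcases Int.mul_eq_one_iff_eq_one_or_neg_one.mp hs with h | h <;> simp [h.1]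
    rw [abs_mul, this, one_mul]
  have h (l : Fin d) : |F.point x u v w l - F.point x u' v' w' l| =
      (if l = F.i then |u - u'| else 0) + (if l = F.j then |v - v'| else 0) +
        (if l = F.k then |w - w'| else 0) := by
    by_cases h1 : l = F.i
    · subst h1
      rw [point_i, point_i, add_sub_add_left_eq_sub, ← mul_sub, habs F.ha]
      simp [F.hij, F.hik]
    by_cases h2 : l = F.j
    · subst h2
      rw [point_j, point_j, add_sub_add_left_eq_sub, ← mul_sub, habs F.hb]
      simp [F.hij.symm, F.hjk]
    by_cases h3 : l = F.k
    · subst h3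
      rw [point_k, point_k, add_sub_add_left_eq_sub, ← mul_sub, habs F.hc]
      simp [F.hik.symm, F.hjk.symm]
    · rw [point_of_ne _ _ h1 h2 h3, point_of_ne _ _ h1 h2 h3]
      simp [h1, h2, h3]
  simp only [h, Finset.sum_add_distrib, Finset.sum_ite_eq', Finset.mem_univ, if_true]

/-- The height of a lattice point in a frame. -/
def height (z : Fin d → ℤ) : ℤ :=
  F.a * (z F.i - x F.i) + F.b * (z F.j - x F.j) + F.c * (z F.k - x F.k)

theorem height_point (u v w : ℤ) : F.height x (F.point x u v w) = u + v + w := by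
  rw [height, point_i, point_j, point_k]
  linear_combination u * F.ha + v * F.hb + w * F.hc

/-- The lattice path attached to two integer functions with increments `0` or `1`. -/
def path (f g : ℕ → ℤ) (t : ℕ) : Fin d → ℤ :=
  F.point x (t - f ((t + 1) / 2) - g (t / 2)) (f ((t + 1) / 2)) (g (t / 2))

/-- Even steps may advance `f`, odd steps may advance `g`; when the chosen function stays put, the
path moves along the first axis instead. -/
theorem adj_path {f g : ℕ → ℤ} (hf : ∀ t, f (t + 1) = f t ∨ f (t + 1) = f t + 1)
    (hg : ∀ t, g (t + 1) = g t ∨ g (t + 1) = g t + 1) (t : ℕ) :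
    Adj (F.path x f g t) (F.path x f g (t + 1)) := by
  unfold Adj path
  rw [sum_abs_point_sub]
  rcases Nat.even_or_odd' t with ⟨u, rfl | rfl⟩
  · have e1 : (2 * u + 1) / 2 = u := by omega
    have e2 : (2 * u + 1 + 1) / 2 = u + 1 := by omega
    have e3 : 2 * u / 2 = u := by omega
    rw [e1, e2, e3]
    push_cast
    rcases hf u with h | h <;> rw [h] <;> ring_nf <;> simp
  · have e1 : (2 * u + 1 + 1 + 1) / 2 = u + 1 := by omega
    have e2 : (2 * u + 1 + 1) / 2 = u + 1 := by omega
    have e3 : (2 * u + 1) / 2 = u := by omega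
    rw [e1, e2, e3]
    push_cast
    rcases hg u with h | h <;> rw [h] <;> ring_nf <;> simp

theorem height_path (f g : ℕ → ℤ) (t : ℕ) : F.height x (F.path x f g t) = t := by
  rw [path, height_point]; ring

theorem point_injective {u v w u' v' w' : ℤ} (h : F.point x u v w = F.point x u' v' w') :
    v = v' ∧ w = w' := by
  have h1 := congrFun h F.j
  have h2 := congrFun h F.k
  rw [point_j, point_j] at h1
  rw [point_k, point_k] at h2
  constructor
  · linear_combination F.b * h1 - (v - v') * F.hb
  · linear_combination F.c * h2 - (w - w') * F.hc

/-- A shared vertex compares `f` and `g` at possibly different times; a shared edge compares both at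
time (t+1)/2. The value of `g` is read at the start of the edge for even `t` and at its end for odd
`t`. -/
theorem eq_of_path_eq {f g f' g' : ℕ → ℤ} {t : ℕ} (h1 : F.path x f g t = F.path x f' g' t)
    (h2 : F.path x f g (t + 1) = F.path x f' g' (t + 1)) :
    f ((t + 1) / 2) = f' ((t + 1) / 2) ∧ g ((t + 1) / 2) = g' ((t + 1) / 2) := by
  have k1 := F.point_injective x h1
  have k2 := F.point_injective x h2
  refine ⟨k1.1, ?_⟩
  rcases Nat.even_or_odd' t with ⟨u, rfl | rfl⟩
  · have e1 : (2 * u + 1) / 2 = 2 * u / 2 := by omega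
    rw [e1]; exact k1.2
  · exact k2.2

end Frame

theorem mono_of_increments {f : ℕ → ℤ} (hf : ∀ t, f (t + 1) = f t ∨ f (t + 1) = f t + 1) :
    Monotone f :=
  monotone_nat_of_le_succ fun t => by rcases hf t with h | h <;> omega

theorem sub_le_of_increments {f : ℕ → ℤ} (hf : ∀ t, f (t + 1) = f t ∨ f (t + 1) = f t + 1) :
    Monotone fun t : ℕ => (t : ℤ) - f t :=
  monotone_nat_of_le_succ fun t => by rcases hf t with h | h <;> push_cast <;> omega

theorem profileFst_succ {n : ℕ} (x : NodeConfig n) (t : ℕ) :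
    profileFst x (t + 1) = profileFst x t ∨ profileFst x (t + 1) = profileFst x t + 1 :=
  profile_succ n (nodes_nonneg _) (nodes_le _) t

theorem profileSnd_succ {n : ℕ} (x : NodeConfig n) (t : ℕ) :
    profileSnd x (t + 1) = profileSnd x t ∨ profileSnd x (t + 1) = profileSnd x t + 1 :=
  profile_succ n (nodes_nonneg _) (nodes_le _) t

theorem profile_even {m : ℕ} (x : ∀ i : Fin (2 * m) × Fin (2 * m + 1), Fin (8 ^ (i.1.1 + 1))) :
    profile (2 * m) (nodes x) (2 * m) = m := by
  rw [profile_last]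
  push_cast
  rw [mul_div_cancel_left₀ _ (two_ne_zero' ℝ), Int.floor_natCast]

/-- An interior time `u` is (t+1)/2 exactly for t = 2u-1 and t = 2u; the two extreme times occur
once each. -/
theorem prod_range_two_mul (F : ℕ → ℝ) {n : ℕ} (hn : 1 ≤ n) :
    ∏ t ∈ Finset.range (2 * n), F ((t + 1) / 2) =
      F 0 * (∏ u ∈ Finset.Ico 1 n, F u ^ 2) * F n := by
  induction n, hn using Nat.le_induction with
  | base => simp [Finset.prod_range_succ]
  | succ n hn ih =>
    have e1 : (2 * n + 1) / 2 = n := by omega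
    have e2 : (2 * n + 1 + 1) / 2 = n + 1 := by omega
    rw [show 2 * (n + 1) = 2 * n + 1 + 1 by ring, Finset.prod_range_succ, Finset.prod_range_succ, ih,
      e1, e2, Finset.prod_Ico_succ_top hn]
    ring

/-! ### Two-point bounds for diagonal displacements and neighbours. -/

/-- The region swept by the directed paths with displacement `(2m, m, m)` in a frame. -/
def Frame.Covers (F : Frame d) (x : Fin d → ℤ) (m : ℕ) (Λ : Finset (Fin d → ℤ)) : Prop :=
  ∀ u v w : ℤ, 0 ≤ u → u ≤ 2 * m → 0 ≤ v → v ≤ m → 0 ≤ w → w ≤ m → F.point x u v w ∈ Λ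

/-- Both the profiles and their complements `t - f t` are monotone with fixed endpoints, which
confines all three coordinates. -/
theorem Frame.path_mem {F : Frame d} {x : Fin d → ℤ} {m : ℕ} {Λ : Finset (Fin d → ℤ)}
    (hF : F.Covers x m Λ) (X : NodeConfig (2 * m)) {t : ℕ} (ht : t ≤ 2 * (2 * m)) :
    F.path x (profileFst X) (profileSnd X) t ∈ Λ := by
  have hf := profileFst_succ X
  have hg := profileSnd_succ X
  have f0 : profileFst X 0 = 0 := profile_zero _
  have g0 : profileSnd X 0 = 0 := profile_zero _
  have f1 : profileFst X (2 * m) = m := profile_even _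
  have g1 : profileSnd X (2 * m) = m := profile_even _
  have a1 := mono_of_increments hf (Nat.zero_le ((t + 1) / 2))
  have a2 := mono_of_increments hf (show (t + 1) / 2 ≤ 2 * m by omega)
  have b1 := mono_of_increments hg (Nat.zero_le (t / 2))
  have b2 := mono_of_increments hg (show t / 2 ≤ 2 * m by omega)
  have c1 := sub_le_of_increments hf (Nat.zero_le ((t + 1) / 2))
  have c2 := sub_le_of_increments hf (show (t + 1) / 2 ≤ 2 * m by omega)
  have d1 := sub_le_of_increments hg (Nat.zero_le (t / 2))
  have d2 := sub_le_of_increments hg (show t / 2 ≤ 2 * m by omega)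
  simp only at c1 c2 d1 d2
  rw [f0] at a1 c1
  rw [g0] at b1 d1
  rw [f1] at a2 c2
  rw [g1] at b2 d2
  push_cast at c1 c2 d1 d2
  apply hF <;> omega

open Classical in
-- Average over all node configurations. With one path fixed, shared edges of the other are
-- controlled by hits of a prescribed profile. Each hit time accounts for at most two edges of cost
-- `(lam β ^ 2)⁻¹`, hence the parameter `(lam β ^ 4)⁻¹ - 1`.
theorem exists_diagonal_bound : ∃ Q : ℝ, 0 < Q ∧ ∀ (β : ℝ), 0 < lam β → lam β ≤ 1 →
    ((lam β ^ 4)⁻¹ - 1) * Q ≤ 1 → ∀ {d : ℕ} {Λ : Finset (Fin d → ℤ)} (B : Finset (Fin d → ℤ)) (v : S3)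
      (F : Frame d) (x y : Λ) (m : ℕ), F.Covers x.1 m Λ → y.1 = F.point x.1 (2 * m) m m →
      1 - corr β (fixedSpins Λ B v) x y ≤ Q * ((lam β ^ 4)⁻¹ - 1) := by
  obtain ⟨Q, hQ0, hQ⟩ := exists_exponential_intersection
  refine ⟨1 + 2 * Q, by positivity, fun β hlam0 hlam1 hε d Λ B v F x y m hF hy => ?_⟩
  set ε := (lam β ^ 4)⁻¹ - 1 with hεdef
  have h4 : 1 ≤ (lam β ^ 4)⁻¹ := (one_le_inv₀ (by positivity)).mpr (pow_le_one₀ hlam0.le hlam1)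
  have hε0 : 0 ≤ ε := by linarith
  have hε1 : ε ≤ 1 := by nlinarith
  have hεQ : ε * Q ≤ 1 := by nlinarith
  rcases Nat.eq_zero_or_pos m with rfl | hm
  · have : y = x := by
      apply Subtype.ext
      rw [hy]
      simpa using F.point_zero x.1
    rw [this, corr_self, sub_self]
    positivity
  set n := 2 * m with hn
  set L := 2 * n with hL
  -- Stopping the time at `L` keeps the path inside `Λ` for all natural times.
  set p : NodeConfig n → ℕ → Λ := fun X t =>
    ⟨F.path x.1 (profileFst X) (profileSnd X) (min t L), F.path_mem hF X (by omega)⟩ with hp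
  have hpt (X : NodeConfig n) {t : ℕ} (ht : t ≤ L) :
      (p X t).1 = F.path x.1 (profileFst X) (profileSnd X) t := by
    simp only [hp, min_eq_left ht]
  have hdir (X : NodeConfig n) : IsDirectedPath (fun z : Λ => F.height x.1 z.1) L (p X) := by
    refine ⟨fun t ht => ?_, fun t ht => ?_⟩
    · rw [hpt X ht.le, hpt X (show t + 1 ≤ L from ht)]
      exact F.adj_path _ (profileFst_succ X) (profileSnd_succ X) t
    · rw [hpt X ht, F.height_path]
  have hstart (X : NodeConfig n) : p X 0 = x := by
    apply Subtype.ext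
    rw [hpt X (Nat.zero_le _), Frame.path]
    have f0 : profileFst X 0 = 0 := profile_zero _
    have g0 : profileSnd X 0 = 0 := profile_zero _
    simp [f0, g0, F.point_zero]
  have hend (X : NodeConfig n) : p X L = y := by
    apply Subtype.ext
    have f1 : profileFst X n = m := profile_even _
    have g1 : profileSnd X n = m := profile_even _
    have e1 : (L + 1) / 2 = n := by omega
    have e2 : L / 2 = n := by omega
    rw [hpt X le_rfl, Frame.path, e1, e2, f1, g1, hy]
    congr 1
    rw [hL, hn]; push_cast; ring
  have key := le_corr_of_paths β hlam0 B v p hdir hstart hend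
  have hl2 : 1 ≤ (lam β ^ 2)⁻¹ := (one_le_inv₀ (by positivity)).mpr (pow_le_one₀ hlam0.le hlam1)
  have hsq : (lam β ^ 2)⁻¹ ^ 2 = 1 + ε := by
    rw [hεdef, inv_pow, ← pow_mul]; ring
  have hrow (Y : NodeConfig n) :
      ∑ X, ∏ t ∈ Finset.range L,
        (if p X t = p Y t ∧ p X (t + 1) = p Y (t + 1) then (lam β ^ 2)⁻¹ else 1) ≤
      (1 + ε) * ((1 + Q * ε) * Fintype.card (NodeConfig n)) := by
    set M : ℕ → ℤ × ℤ := fun t => (profileFst Y t, profileSnd Y t) with hM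
    refine le_trans (Finset.sum_le_sum fun X _ => ?_)
      ((Finset.mul_sum _ _ _).symm.le.trans
        (mul_le_mul_of_nonneg_left (hQ n M ε hε0 hε1 hεQ) (by linarith : 0 ≤ 1 + ε)))
    set G : ℕ → ℝ := fun u => if Hits M u X then (lam β ^ 2)⁻¹ else 1 with hG
    have hG1 (u : ℕ) : 1 ≤ G u := by simp only [hG]; split_ifs <;> linarith
    have hG2 (u : ℕ) : G u ≤ (lam β ^ 2)⁻¹ := by simp only [hG]; split_ifs <;> linarith
    calc ∏ t ∈ Finset.range L,
          (if p X t = p Y t ∧ p X (t + 1) = p Y (t + 1) then (lam β ^ 2)⁻¹ else 1)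
        ≤ ∏ t ∈ Finset.range L, G ((t + 1) / 2) := by
          refine Finset.prod_le_prod (fun t _ => ?_) fun t ht => ?_
          · split_ifs <;> linarith
          · have htL := Finset.mem_range.mp ht
            split_ifs with h
            · have h1 := congrArg Subtype.val h.1
              have h2 := congrArg Subtype.val h.2
              rw [hpt X htL.le, hpt Y htL.le] at h1
              rw [hpt X (show t + 1 ≤ L from htL), hpt Y (show t + 1 ≤ L from htL)] at h2
              have h3 : Hits M ((t + 1) / 2) X := F.eq_of_path_eq x.1 h1 h2
              simp only [hG, if_pos h3, le_refl]
            · exact hG1 _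
      _ = G 0 * (∏ u ∈ Finset.Ico 1 n, G u ^ 2) * G n := prod_range_two_mul G (by omega)
      -- All paths agree at both extreme times; these two unavoidable factors cost 1 + ε in total.
      _ ≤ (lam β ^ 2)⁻¹ * (∏ u ∈ Finset.Ico 1 n, G u ^ 2) * (lam β ^ 2)⁻¹ := by
          have hP : 0 ≤ ∏ u ∈ Finset.Ico 1 n, G u ^ 2 := Finset.prod_nonneg fun u _ => sq_nonneg _
          have := hG1 n
          gcongr
          · exact hG2 0
          · exact hG2 n
      _ = (1 + ε) * ∏ u ∈ Finset.Ico 1 n, G u ^ 2 := by rw [← hsq]; ring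
      _ = (1 + ε) * ∏ t ∈ Finset.Ico 1 n, (1 + ε * (if Hits M t X then 1 else 0)) := by
          congr 1
          refine Finset.prod_congr rfl fun u _ => ?_
          simp only [hG]
          split_ifs
          · rw [hsq, mul_one]
          · ring
  have hN : (0 : ℝ) < Fintype.card (NodeConfig n) := by exact_mod_cast Fintype.card_pos
  have htot : (∑ X, ∑ Y, ∏ t ∈ Finset.range L,
        if p X t = p Y t ∧ p X (t + 1) = p Y (t + 1) then (lam β ^ 2)⁻¹ else 1) /
          (Fintype.card (NodeConfig n) : ℝ) ^ 2 ≤ (1 + ε) * (1 + Q * ε) := by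
    rw [div_le_iff₀ (by positivity), Finset.sum_comm]
    refine (Finset.sum_le_sum fun Y _ => hrow Y).trans (le_of_eq ?_)
    rw [Finset.sum_const, Finset.card_univ, nsmul_eq_mul]
    ring
  have hQε : Q * ε * ε ≤ Q * ε := mul_le_of_le_one_right (by positivity) hε1
  nlinarith

open Classical in
-- The estimator is the single edge itself: a family of one path of length one.
theorem one_sub_corr_le_of_adj {β : ℝ} (hlam0 : 0 < lam β) {Λ : Finset (Fin d → ℤ)}
    (B : Finset (Fin d → ℤ)) (v : S3) {x y : Λ} (h : Adj x.1 y.1) :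
    1 - corr β (fixedSpins Λ B v) x y ≤ (lam β ^ 2)⁻¹ - 1 := by
  have hxy : y ≠ x := by
    rintro rfl
    exact not_adj_self _ h
  have key := le_corr_of_paths (Γ := Unit) β hlam0 B v (x := x) (y := y) (L := 1)
    (ht := fun z => if z = x then 0 else 1) (fun _ t => if t = 0 then x else y)
    (fun _ => ⟨fun t ht => ?_, fun t ht => ?_⟩) (fun _ => by simp) (fun _ => by simp)
  · simp at key
    linarith
  · obtain rfl : t = 0 := by omega
    simpa using h
  · rcases Nat.le_one_iff_eq_zero_or_eq_one.mp ht with rfl | rfl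
    · simp
    · simp [hxy]

end

noncomputable section

variable {d : ℕ}

/-! ### Chaining -/

/-- A bound on `1 - corr` for neighbours and for diagonal displacements. -/
structure LocalBound (β η : ℝ) {Λ : Finset (Fin d → ℤ)} (ν : Measure (Spins Λ)) : Prop where
  nonneg : 0 ≤ η
  adj : ∀ x y : Λ, Adj x.1 y.1 → 1 - corr β ν x y ≤ η
  diag : ∀ (F : Frame d) (x y : Λ) (m : ℕ), F.Covers x.1 m Λ → y.1 = F.point x.1 (2 * m) m m →
    1 - corr β ν x y ≤ η

/-- The displacement of `x` by `t` along the axis `i`. -/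
def shift (x : Fin d → ℤ) (i : Fin d) (t : ℤ) : Fin d → ℤ := Function.update x i (x i + t)

theorem adj_shift (x : Fin d → ℤ) (i : Fin d) {σ : ℤ} (hσ : σ * σ = 1) (t : ℤ) :
    Adj (shift x i (σ * t)) (shift x i (σ * (t + 1))) := by
  unfold Adj
  rw [Finset.sum_eq_single i]
  · rcases Int.mul_eq_one_iff_eq_one_or_neg_one.mp hσ with h | h <;> simp [shift, h.1]
  · intro l _ hl
    simp [shift, hl]
  · simp

/-- The region used to connect `x` to its displacement by `n` along the axis `i`. -/
def AxisCovers (Λ : Finset (Fin d → ℤ)) (x : Fin d → ℤ) (i j k : Fin d) (σ : ℤ) (n : ℕ) : Prop :=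
  ∀ z : Fin d → ℤ, 0 ≤ σ * (z i - x i) → σ * (z i - x i) ≤ n → 4 * |z j - x j| ≤ n →
    4 * |z k - x k| ≤ n → (∀ l, l ≠ i → l ≠ j → l ≠ k → z l = x l) → z ∈ Λ

theorem AxisCovers.shift_mem {Λ : Finset (Fin d → ℤ)} {x : Fin d → ℤ} {i j k : Fin d} {σ : ℤ}
    {n : ℕ} (h : AxisCovers Λ x i j k σ n) (hij : i ≠ j) (hik : i ≠ k) (hσ : σ * σ = 1)
    {t : ℕ} (ht : t ≤ n) : shift x i (σ * t) ∈ Λ := by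
  have e : σ * (shift x i (σ * t) i - x i) = t := by
    simp only [shift, Function.update_self]
    linear_combination (t : ℤ) * hσ
  refine h _ (by omega) (by omega) ?_ ?_ fun l hl _ _ => ?_
  · simp [shift, hij.symm]
  · simp [shift, hik.symm]
  · simp [shift, hl]

/-- Write n = 4m + r with r ≤ 3. The displacements (2m, m, m) and (2m, -m, -m) add up to 4m along
the axis, and r unit steps finish the way. -/
theorem LocalBound.axis {β η : ℝ} {Λ : Finset (Fin d → ℤ)} {ν : Measure (Spins Λ)}
    [IsProbabilityMeasure ν] (hL : LocalBound β η ν) {x y : Λ} {i j k : Fin d} (hij : i ≠ j)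
    (hik : i ≠ k) (hjk : j ≠ k) {σ : ℤ} (hσ : σ * σ = 1) {n : ℕ}
    (h : AxisCovers Λ x.1 i j k σ n) (hy : y.1 = shift x.1 i (σ * n)) :
    1 - corr β ν x y ≤ 46 * η := by
  have hη := hL.nonneg
  obtain ⟨m, r, hr, hn⟩ : ∃ m r : ℕ, r ≤ 3 ∧ n = 4 * m + r :=
    ⟨n / 4, n % 4, by omega, by omega⟩
  have hmem {t : ℕ} (ht : t ≤ n) := h.shift_mem hij hik hσ ht
  have hbase : 1 - corr β ν x ⟨_, hmem (show 4 * m ≤ n by omega)⟩ ≤ 4 * η := by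
    set F1 : Frame d := ⟨i, j, k, hij, hik, hjk, σ, 1, 1, hσ, by norm_num, by norm_num⟩ with hF1
    set F2 : Frame d := ⟨i, j, k, hij, hik, hjk, σ, -1, -1, hσ, by norm_num, by norm_num⟩ with hF2
    have c1 : F1.Covers x.1 m Λ := by
      intro u v w hu hu' hv hv' hw hw'
      have e1 : F1.point x.1 u v w i = x.1 i + σ * u := F1.point_i x.1 u v w
      have e2 : F1.point x.1 u v w j = x.1 j + 1 * v := F1.point_j x.1 u v w
      have e3 : F1.point x.1 u v w k = x.1 k + 1 * w := F1.point_k x.1 u v w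
      have e4 : σ * (x.1 i + σ * u - x.1 i) = u := by linear_combination u * hσ
      refine h _ ?_ ?_ ?_ ?_ fun l h1 h2 h3 => F1.point_of_ne x.1 h1 h2 h3 u v w
      · rw [e1, e4]; exact hu
      · rw [e1, e4]; omega
      · rw [e2, show x.1 j + 1 * v - x.1 j = v by ring, abs_of_nonneg hv]; omega
      · rw [e3, show x.1 k + 1 * w - x.1 k = w by ring, abs_of_nonneg hw]; omega
    have hz : F1.point x.1 (2 * m) m m ∈ Λ := c1 _ _ _ (by omega) le_rfl (by omega) le_rfl
      (by omega) le_rfl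
    set z : Λ := ⟨_, hz⟩ with hzdef
    have z1 : z.1 i = x.1 i + σ * (2 * m) := F1.point_i x.1 _ _ _
    have z2 : z.1 j = x.1 j + 1 * m := F1.point_j x.1 _ _ _
    have z3 : z.1 k = x.1 k + 1 * m := F1.point_k x.1 _ _ _
    have z4 (l) (h1 : l ≠ i) (h2 : l ≠ j) (h3 : l ≠ k) : z.1 l = x.1 l :=
      F1.point_of_ne x.1 h1 h2 h3 _ _ _
    have c2 : F2.Covers z.1 m Λ := by
      intro u v w hu hu' hv hv' hw hw'
      have e1 : F2.point z.1 u v w i = z.1 i + σ * u := F2.point_i z.1 u v w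
      have e2 : F2.point z.1 u v w j = z.1 j + -1 * v := F2.point_j z.1 u v w
      have e3 : F2.point z.1 u v w k = z.1 k + -1 * w := F2.point_k z.1 u v w
      have e4 : σ * (x.1 i + σ * (2 * m) + σ * u - x.1 i) = 2 * m + u := by
        linear_combination (2 * m + u) * hσ
      refine h _ ?_ ?_ ?_ ?_ fun l h1 h2 h3 =>
        (F2.point_of_ne z.1 h1 h2 h3 u v w).trans (z4 l h1 h2 h3)
      · rw [e1, z1, e4]; omega
      · rw [e1, z1, e4]; omega
      · rw [e2, z2, show x.1 j + 1 * m + -1 * v - x.1 j = m - v by ring,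
          abs_of_nonneg (by omega)]
        omega
      · rw [e3, z3, show x.1 k + 1 * m + -1 * w - x.1 k = m - w by ring,
          abs_of_nonneg (by omega)]
        omega
    have hend : shift x.1 i (σ * (4 * m : ℕ)) = F2.point z.1 (2 * m) m m := by
      funext l
      by_cases h1 : l = i
      · subst h1
        have := F2.point_i z.1 (2 * m) m m
        rw [show F2.point z.1 (2 * m) m m l = _ from this, z1]
        simp only [shift, Function.update_self, hF2]
        push_cast; ring
      have hs : shift x.1 i (σ * (4 * m : ℕ)) l = x.1 l := by simp [shift, h1]
      by_cases h2 : l = j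
      · subst h2
        have := F2.point_j z.1 (2 * m) m m
        rw [hs, show F2.point z.1 (2 * m) m m l = _ from this, z2]
        simp [hF2]
      by_cases h3 : l = k
      · subst h3
        have := F2.point_k z.1 (2 * m) m m
        rw [hs, show F2.point z.1 (2 * m) m m l = _ from this, z3]
        simp [hF2]
      · rw [hs, F2.point_of_ne z.1 h1 h2 h3, z4 l h1 h2 h3]
    have b1 := hL.diag F1 x z m c1 rfl
    have b2 := hL.diag F2 z ⟨_, hmem (show 4 * m ≤ n by omega)⟩ m c2 hend
    have b3 := one_sub_corr_le ν β x z ⟨_, hmem (show 4 * m ≤ n by omega)⟩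
    linarith
  -- Each unit step turns a bound cη into (2c + 2)η; from 4 this runs through 10, 22 and 46.
  have hstep : ∀ s : ℕ, ∀ hs : s ≤ r,
      1 - corr β ν x ⟨_, hmem (show 4 * m + s ≤ n by omega)⟩ ≤ (6 * 2 ^ s - 2) * η := by
    intro s
    induction s with
    | zero => exact fun _ => hbase.trans_eq (by norm_num)
    | succ s ih =>
      intro hs
      have b1 := ih (by omega)
      have b2 := hL.adj ⟨_, hmem (show 4 * m + s ≤ n by omega)⟩
        ⟨_, hmem (show 4 * m + (s + 1) ≤ n by omega)⟩ (by
          have := adj_shift x.1 i hσ ((4 * m + s : ℕ) : ℤ)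
          simpa [add_assoc] using this)
      have b3 := one_sub_corr_le ν β x ⟨_, hmem (show 4 * m + s ≤ n by omega)⟩
        ⟨_, hmem (show 4 * m + (s + 1) ≤ n by omega)⟩
      rw [pow_succ]
      linarith
  have hfin := hstep r le_rfl
  have hy' : y = ⟨_, hmem (show 4 * m + r ≤ n by omega)⟩ := by
    apply Subtype.ext
    simp only [hy, ← hn]
  rw [hy']
  have h2r : (2 : ℝ) ^ r ≤ 2 ^ 3 := pow_le_pow_right₀ (by norm_num) hr
  nlinarith

theorem exists_two_axes_ne (hd : 3 ≤ d) (i : Fin d) : ∃ j k : Fin d, i ≠ j ∧ i ≠ k ∧ j ≠ k := by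
  have h : 1 < (Finset.univ.erase i).card := by
    rw [Finset.card_erase_of_mem (Finset.mem_univ i), Finset.card_univ, Fintype.card_fin]
    omega
  obtain ⟨j, hj, k, hk, hjk⟩ := Finset.one_lt_card.mp h
  exact ⟨j, k, (Finset.ne_of_mem_erase hj).symm, (Finset.ne_of_mem_erase hk).symm, hjk⟩

/-- Points in the box spanned by `x` and `y`, widened by n/4 along two axes, have squared distance
at most N²/2 + n²/2 ≤ N² from the midpoint, where N = ‖x - y‖; this is well within radius 2N. -/
theorem mem_ball_of_coord {x y z : Fin d → ℤ} (hxy : x ≠ y) (j k : Fin d) (n : ℝ)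
    (hn0 : 0 ≤ n) (hn : n ≤ ‖toE x - toE y‖)
    (hz : ∀ l, |2 * (z l : ℝ) - x l - y l| ≤ |(x l : ℝ) - y l| +
      ((if l = j then n / 2 else 0) + (if l = k then n / 2 else 0))) :
    toE z ∈ Metric.ball ((1 / 2 : ℝ) • (toE x + toE y)) (2 * ‖toE x - toE y‖) := by
  have hpos : 0 < ‖toE x - toE y‖ := by
    rw [norm_pos_iff, sub_ne_zero]
    intro h
    apply hxy
    funext l
    have : (x l : ℝ) = y l := congrFun (congrArg WithLp.ofLp h) l
    exact_mod_cast this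
  set N := ‖toE x - toE y‖ with hN
  have hN2 : N ^ 2 = ∑ l, ((x l : ℝ) - y l) ^ 2 := by
    rw [hN, EuclideanSpace.real_norm_sq_eq]
    rfl
  rw [mem_ball_iff_norm, ← sq_lt_sq₀ (norm_nonneg _) (by positivity),
    EuclideanSpace.real_norm_sq_eq]
  have hcoord (l : Fin d) : ((toE z - (1 / 2 : ℝ) • (toE x + toE y)).ofLp l) ^ 2 ≤
      ((x l : ℝ) - y l) ^ 2 / 2 + ((if l = j then n ^ 2 / 4 else 0) +
        (if l = k then n ^ 2 / 4 else 0)) := by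
    have e : (toE z - (1 / 2 : ℝ) • (toE x + toE y)).ofLp l = (2 * (z l : ℝ) - x l - y l) / 2 := by
      simp [toE]; ring
    rw [e, div_pow, ← sq_abs (2 * (z l : ℝ) - x l - y l), ← sq_abs ((x l : ℝ) - y l)]
    have h1 := hz l
    have h0 := abs_nonneg (2 * (z l : ℝ) - x l - y l)
    set D := |(x l : ℝ) - y l|
    have hsq := pow_le_pow_left₀ h0 h1 2
    refine (div_le_div_of_nonneg_right hsq (by norm_num)).trans ?_
    split_ifs <;> nlinarith [sq_nonneg (D - n / 2), sq_nonneg (D - n), sq_nonneg D]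
  refine (Finset.sum_le_sum fun l _ => hcoord l).trans_lt ?_
  rw [Finset.sum_add_distrib, Finset.sum_add_distrib, ← Finset.sum_div, ← hN2]
  simp only [Finset.sum_ite_eq', Finset.mem_univ, if_true]
  nlinarith

/-- Change the coordinates of `x` into those of `y` one at a time. Each change costs 46η, and each
concatenation turns cη into (2c + 92)η, hence 92(2^s - 1) after `s` coordinates. -/
theorem LocalBound.general (hd : 3 ≤ d) {β η : ℝ} {Λ : Finset (Fin d → ℤ)}
    {ν : Measure (Spins Λ)} [IsProbabilityMeasure ν] (hL : LocalBound β η ν) {x y : Λ}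
    (hΛ : ∀ z : Fin d → ℤ,
      toE z ∈ Metric.ball ((1 / 2 : ℝ) • (toE x.1 + toE y.1)) (2 * ‖toE x.1 - toE y.1‖) →
        z ∈ Λ) :
    1 - corr β ν x y ≤ 92 * 2 ^ d * η := by
  classical
  have hη := hL.nonneg
  rcases eq_or_ne x y with rfl | hne
  · rw [corr_self, sub_self]; positivity
  have hxy : x.1 ≠ y.1 := fun h => hne (Subtype.ext h)
  set wp : Finset (Fin d) → Fin d → ℤ := fun s l => if l ∈ s then y.1 l else x.1 l with hwp
  have hmid {l : Fin d} {t : ℤ} (h : t = x.1 l ∨ t = y.1 l) :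
      |2 * (t : ℝ) - x.1 l - y.1 l| = |(x.1 l : ℝ) - y.1 l| := by
    rcases h with rfl | rfl
    · congr 1; ring
    · rw [← abs_neg]; congr 1; ring
  have hwl (s : Finset (Fin d)) (l : Fin d) : wp s l = x.1 l ∨ wp s l = y.1 l := by
    simp only [hwp]; split_ifs <;> simp
  have i0 : Fin d := ⟨0, by omega⟩
  have hmem (s : Finset (Fin d)) : wp s ∈ Λ := by
    refine hΛ _ (mem_ball_of_coord hxy i0 i0 0 le_rfl (norm_nonneg _) fun l => ?_)
    rw [hmid (hwl s l)]
    simp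
  have key (s : Finset (Fin d)) :
      1 - corr β ν x ⟨wp s, hmem s⟩ ≤ 92 * (2 ^ s.card - 1) * η := by
    induction s using Finset.induction_on with
    | empty =>
      have : (⟨wp ∅, hmem ∅⟩ : Λ) = x := Subtype.ext (by funext l; simp [hwp])
      rw [this, corr_self]; simp
    | insert i s his ih =>
      obtain ⟨j, k, hij, hik, hjk⟩ := exists_two_axes_ne hd i
      have hwi : wp s i = x.1 i := by simp [hwp, his]
      obtain ⟨σ, hσ, hσn⟩ : ∃ σ : ℤ, σ * σ = 1 ∧ σ * (y.1 i - x.1 i) = |y.1 i - x.1 i| := by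
        rcases le_total 0 (y.1 i - x.1 i) with h | h
        · exact ⟨1, by norm_num, by rw [abs_of_nonneg h, one_mul]⟩
        · exact ⟨-1, by norm_num, by rw [abs_of_nonpos h]; ring⟩
      set n := (y.1 i - x.1 i).natAbs with hn
      have hnZ : (n : ℤ) = |y.1 i - x.1 i| := Int.natCast_natAbs _
      have hnR : (n : ℝ) = |(y.1 i : ℝ) - x.1 i| := by
        have : ((n : ℤ) : ℝ) = ((|y.1 i - x.1 i| : ℤ) : ℝ) := by rw [hnZ]
        push_cast at this
        exact this
      have hnN : (n : ℝ) ≤ ‖toE x.1 - toE y.1‖ := by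
        have := PiLp.norm_apply_le (toE x.1 - toE y.1) i
        rw [hnR, abs_sub_comm]
        simpa [toE] using this
      have hend : wp (insert i s) = shift (wp s) i (σ * n) := by
        funext l
        by_cases hl : l = i
        · subst hl
          simp only [shift, Function.update_self, hwi]
          simp only [hwp, Finset.mem_insert_self, if_true]
          rw [hnZ, ← hσn]
          linear_combination -(y.1 l - x.1 l) * hσ
        · simp [shift, hl, hwp]
      have hcov : AxisCovers Λ (wp s) i j k σ n := by
        intro z h1 h2 h3 h4 h5
        refine hΛ _ (mem_ball_of_coord hxy j k n (Nat.cast_nonneg _) hnN fun l => ?_)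
        by_cases hli : l = i
        · subst hli
          rw [if_neg hij, if_neg hik, add_zero, add_zero]
          rw [hwi] at h1 h2
          rw [hnZ] at h2
          have h6 : |2 * z l - x.1 l - y.1 l| ≤ |x.1 l - y.1 l| := by
            rw [abs_sub_comm (x.1 l)]
            have e : σ * (2 * z l - x.1 l - y.1 l) =
                2 * (σ * (z l - x.1 l)) - |y.1 l - x.1 l| := by rw [← hσn]; ring
            have e2 : |2 * z l - x.1 l - y.1 l| = |σ * (2 * z l - x.1 l - y.1 l)| := by
              have : |σ| = 1 := by
                rcases Int.mul_eq_one_iff_eq_one_or_neg_one.mp hσ with h | h <;> simp [h.1]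
              rw [abs_mul, this, one_mul]
            rw [e2, e, abs_le]
            constructor <;> linarith
          exact_mod_cast h6
        · have htri : |2 * (z l : ℝ) - x.1 l - y.1 l| ≤
              |(x.1 l : ℝ) - y.1 l| + 2 * |(z l : ℝ) - wp s l| := by
            rw [← hmid (hwl s l)]
            have e : 2 * (z l : ℝ) - x.1 l - y.1 l =
              (2 * (wp s l : ℝ) - x.1 l - y.1 l) + 2 * ((z l : ℝ) - wp s l) := by ring
            rw [e]
            refine (abs_add_le _ _).trans ?_
            rw [abs_mul, abs_of_pos (show (0 : ℝ) < 2 by norm_num)]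
          refine htri.trans (add_le_add_right ?_ _)
          have hcast {l' : Fin d} (h : 4 * |z l' - wp s l'| ≤ n) :
              2 * |(z l' : ℝ) - wp s l'| ≤ n / 2 := by
            have : 4 * |(z l' : ℝ) - wp s l'| ≤ n := by exact_mod_cast h
            linarith
          by_cases hlj : l = j
          · subst hlj
            rw [if_pos rfl, if_neg hjk, add_zero]
            exact hcast h3
          by_cases hlk : l = k
          · subst hlk
            rw [if_pos rfl, if_neg hlj, zero_add]
            exact hcast h4
          · rw [if_neg hlj, if_neg hlk, h5 l hli hlj hlk]
            simp
      have b1 := hL.axis (x := ⟨wp s, hmem s⟩) (y := ⟨wp (insert i s), hmem _⟩) hij hik hjk hσ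
        hcov hend
      have b2 := one_sub_corr_le ν β x ⟨wp s, hmem s⟩ ⟨wp (insert i s), hmem _⟩
      rw [Finset.card_insert_of_notMem his, pow_succ]
      linarith
  have hfin := key Finset.univ
  have hy : (⟨wp Finset.univ, hmem _⟩ : Λ) = y := Subtype.ext (by funext l; simp [hwp])
  rw [hy, Finset.card_univ, Fintype.card_fin] at hfin
  linarith

end

noncomputable section

variable {d : ℕ}

/-! ### The symmetry of the quenched Gibbs measures -/

theorem map_tilted_of_measurePreserving {X Y : Type*} [MeasurableSpace X] [MeasurableSpace Y]
    {μ : Measure X} {ν : Measure Y} {T : X → Y} (hT : MeasurePreserving T μ ν) {f : Y → ℝ}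
    (hf : Measurable f) : (μ.tilted fun x => f (T x)).map T = ν.tilted f := by
  ext s hs
  have h1 : ∫ x, Real.exp (f (T x)) ∂μ = ∫ y, Real.exp (f y) ∂ν := by
    rw [← hT.map_eq, integral_map hT.measurable.aemeasurable]
    exact (Real.measurable_exp.comp hf).aestronglyMeasurable
  rw [Measure.map_apply hT.measurable hs, tilted_apply' _ _ (hT.measurable hs), tilted_apply' _ _ hs,
    h1, ← hT.map_eq, setLIntegral_map hs _ hT.measurable]
  exact ((Real.measurable_exp.comp hf).div_const _).ennreal_ofReal

theorem measurable_action {Λ : Finset (Fin d → ℤ)} (ω : Disorder Λ) :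
    Measurable fun S : Spins Λ => action ω S := by
  have h : Continuous fun S : Spins Λ => (ω, S) := by fun_prop
  have hc := (continuous_action (Λ := Λ)).comp h
  exact hc.measurable

theorem map_dirichletGibbs (β : ℝ) (Λ B : Finset (Fin d → ℤ)) (v : S3) (ω : Disorder Λ) (g : SU2) :
    (dirichletGibbs β Λ B v ω).map (fun S i => rightIsoclinic g (S i)) =
      dirichletGibbs β Λ B (rightIsoclinic g v) ω := by
  have hT := measurePreserving_fixedSpins (Λ := Λ) B v (rightIsoclinic g v)
    (fun _ => rightIsoclinic g) (fun _ => measurePreserving_rightIsoclinic g) (fun _ _ => rfl)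
  have := map_tilted_of_measurePreserving hT (f := fun S => β / 2 * action ω S)
    ((measurable_action ω).const_mul _)
  simp only [action_rightIsoclinic] at this
  exact this

theorem freeGibbs_eq (β : ℝ) (Λ : Finset (Fin d → ℤ)) (v : S3) (ω : Disorder Λ) :
    freeGibbs β Λ ω = dirichletGibbs β Λ ∅ v ω := by
  rw [freeGibbs, dirichletGibbs, freeSpins_eq_fixedSpins Λ v]

theorem map_freeGibbs (β : ℝ) (Λ : Finset (Fin d → ℤ)) (ω : Disorder Λ) (g : SU2) :
    (freeGibbs β Λ ω).map (fun S i => rightIsoclinic g (S i)) = freeGibbs β Λ ω := by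
  rw [freeGibbs_eq β Λ (basisS3 0) ω, map_dirichletGibbs, ← freeGibbs_eq, ← freeGibbs_eq]

/-! ### Long-range order and spontaneous magnetization -/

theorem avgFree_eq_corr (β : ℝ) {Λ : Finset (Fin d → ℤ)} (v : S3) (x y : Λ) :
    avgFree β Λ (fun S => inner ℝ (S x).1 (S y).1) = corr β (fixedSpins Λ ∅ v) x y := by
  unfold avgFree corr quenchedAvg freeGibbs
  rw [freeSpins_eq_fixedSpins Λ v]

/-- The spin at a site of `B` equals `v` almost surely, so magnetization is a two-point function
with a pinned site. -/
theorem avgDirichlet_eq_corr (β : ℝ) {Λ : Finset (Fin d → ℤ)} (B : Finset (Fin d → ℤ)) (v : S3)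
    (x y : Λ) (hy : y.1 ∈ B) :
    avgDirichlet β Λ B v (fun S => inner ℝ (S x).1 v.1) = corr β (fixedSpins Λ B v) x y := by
  unfold avgDirichlet corr quenchedAvg dirichletGibbs
  refine integral_congr_ae (Eventually.of_forall fun ω => integral_congr_ae ?_)
  refine (tilted_absolutelyContinuous _ _).ae_le ?_
  filter_upwards [ae_fixedSpins B v y hy] with S hS
  rw [hS]

theorem corr_le_one (β : ℝ) {Λ : Finset (Fin d → ℤ)} (ν : Measure (Spins Λ))
    [IsProbabilityMeasure ν] (x y : Λ) : corr β ν x y ≤ 1 := by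
  rw [← quenchedAvg_const ν β 1]
  refine quenchedAvg_mono ν β (continuous_inner_spins x y) continuous_const fun S => ?_
  rw [inner_eq_chi]
  exact (abs_le.mp (abs_chi_le_one _)).2

theorem exists_localBound : ∃ C : ℝ, 0 < C ∧ ∃ δ : ℝ, 0 < δ ∧ ∀ β : ℝ, 3 ≤ β →
    Real.log β / β ≤ δ → ∀ {d : ℕ} (Λ B : Finset (Fin d → ℤ)) (v : S3),
      LocalBound β (C * (Real.log β / β)) (fixedSpins Λ B v) := by
  obtain ⟨Q, hQ0, hQ⟩ := exists_diagonal_bound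
  obtain ⟨C, hC0, hC⟩ := exists_one_sub_lam_le
  -- The first threshold gives `lam β ≥ 1 / 2`, so that λ⁻⁴ - 1 ≤ 16 · 4(1 - λ) ≤ 64Cr; the second
  -- provides the smallness needed for diagonal displacements.
  refine ⟨(Q + 1) * (64 * C), by positivity, min (1 / (2 * C)) (1 / (64 * C * Q)), by positivity,
    fun β hβ hδ d Λ B v => ?_⟩
  set r := Real.log β / β with hr
  have hr0 : 0 ≤ r := div_nonneg (Real.log_nonneg (by linarith)) (by linarith)
  have h1 := hC β hβ
  rw [← hr] at h1
  have h2 : r * (2 * C) ≤ 1 := by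
    rw [← le_div_iff₀ (by positivity)]; exact hδ.trans (min_le_left _ _)
  have h3 : r * (64 * C * Q) ≤ 1 := by
    rw [← le_div_iff₀ (by positivity)]; exact hδ.trans (min_le_right _ _)
  have hlam : 1 / 2 ≤ lam β := by linarith
  have hlam0 : 0 < lam β := by linarith
  have hlam1 : lam β ≤ 1 := by
    have : lam β ≤ ∫ _U, (1 : ℝ) ∂(rho β) :=
      integral_mono (integrable_of_continuous continuous_chi) (integrable_const _)
        fun U => (abs_le.mp (abs_chi_le_one U)).2
    simpa using this
  have hε : (lam β ^ 4)⁻¹ - 1 ≤ 64 * C * r := by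
    have e : (lam β ^ 4)⁻¹ - 1 = (1 - lam β ^ 4) / lam β ^ 4 := by field_simp
    rw [e, div_le_iff₀ (by positivity)]
    have h4 : (1 / 2 : ℝ) ^ 4 ≤ lam β ^ 4 := by gcongr
    have h5 : 1 - lam β ^ 4 ≤ 4 * (1 - lam β) := by
      nlinarith [sq_nonneg (lam β ^ 2 - 1), sq_nonneg (lam β - 1)]
    have h6 := mul_le_mul_of_nonneg_left h4 (show 0 ≤ 64 * C * r by positivity)
    linarith
  have h2ε : (lam β ^ 2)⁻¹ - 1 ≤ (lam β ^ 4)⁻¹ - 1 := by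
    gcongr ?_ - 1
    exact inv_anti₀ (by positivity) (pow_le_pow_of_le_one hlam0.le hlam1 (by norm_num))
  have hQr : 0 ≤ Q * (64 * C * r) := by positivity
  have hCr : 0 ≤ 64 * C * r := by positivity
  refine ⟨by positivity, fun x y h => ?_, fun F x y m hF hy => ?_⟩
  · have := one_sub_corr_le_of_adj hlam0 B v h
    linarith
  · have h7 := hQ β hlam0 hlam1 (by nlinarith) B v F x y m hF hy
    have h8 := mul_le_mul_of_nonneg_left hε hQ0.le
    linarith

theorem innerBoundary_subset (Λ : Finset (Fin d → ℤ)) : innerBoundary Λ ⊆ Λ := by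
  classical
  intro z hz
  unfold innerBoundary at hz
  exact Finset.mem_of_mem_filter z hz

theorem shift_mem_innerBoundary_box (n : ℕ) (i : Fin d) :
    shift (0 : Fin d → ℤ) i n ∈ innerBoundary (box d n) := by
  classical
  simp only [innerBoundary, Finset.mem_filter]
  refine ⟨?_, shift 0 i (n + 1), ?_, ?_⟩
  · rw [box, Fintype.mem_piFinset]
    intro l
    by_cases h : l = i
    · subst h; simp [shift]
    · simp [shift, h]
  · simpa using adj_shift (0 : Fin d → ℤ) i (show (1 : ℤ) * 1 = 1 by norm_num) n
  · rw [box, Fintype.mem_piFinset]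
    intro h
    have := h i
    simp [shift] at this

/-- One axis suffices to join the origin to a boundary site, and the transverse excursions, at most
n/4, stay in the box. -/
theorem LocalBound.box (hd : 3 ≤ d) {β η : ℝ} {n : ℕ} {B : Finset (Fin d → ℤ)}
    (hB : innerBoundary (box d n) ⊆ B) {v : S3}
    (hL : LocalBound β η (fixedSpins (IsoclinicO4.box d n) B v)) :
    1 - 46 * η ≤ avgDirichlet β (IsoclinicO4.box d n) B v
      (fun S => inner ℝ (S ⟨0, zero_mem_box d n⟩).1 v.1) := by
  set i : Fin d := ⟨0, by omega⟩
  obtain ⟨j, k, hij, hik, hjk⟩ := exists_two_axes_ne hd i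
  have hy := shift_mem_innerBoundary_box n i
  rw [avgDirichlet_eq_corr β B v _ ⟨shift 0 i n, innerBoundary_subset _ hy⟩ (hB hy)]
  have := hL.axis (x := ⟨0, zero_mem_box d n⟩) (y := ⟨shift 0 i n, innerBoundary_subset _ hy⟩)
    hij hik hjk (σ := 1) (by norm_num) (n := n) ?_ (by simp)
  · linarith
  · intro z h1 h2 h3 h4 h5
    rw [IsoclinicO4.box, Fintype.mem_piFinset]
    intro l
    rw [Finset.mem_Icc]
    simp only [Pi.zero_apply, sub_zero, one_mul] at h1 h2 h3 h4 h5
    by_cases e1 : l = i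
    · subst e1; omega
    by_cases e2 : l = j
    · subst e2
      have := abs_le.mp (show |z l| ≤ n by have := abs_nonneg (z l); omega)
      exact this
    by_cases e3 : l = k
    · subst e3
      have := abs_le.mp (show |z l| ≤ n by have := abs_nonneg (z l); omega)
      exact this
    · rw [h5 l e1 e2 e3]; omega

theorem exists_log_div_le {δ : ℝ} (hδ : 0 < δ) :
    ∃ b : ℝ, 3 ≤ b ∧ ∀ β : ℝ, b ≤ β → Real.log β / β ≤ δ := by
  have h := (Real.isLittleO_log_id_atTop.tendsto_div_nhds_zero).eventually (gt_mem_nhds hδ)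
  obtain ⟨b, hb⟩ := eventually_atTop.mp h
  exact ⟨max b 3, le_max_right _ _, fun β hβ => (hb β ((le_max_left _ _).trans hβ)).le⟩

end

end IsoclinicO4

theorem mainTheorem6 (d : ℕ) (hd : 3 ≤ d) :
    -- right-isoclinic rotations are a symmetry of the model for every realization of the disorder
    (∀ (β : ℝ) (Λ : Finset (Fin d → ℤ)) (ω : Disorder Λ) (g : SU2),
      (freeGibbs β Λ ω).map (fun S i => rightIsoclinic g (S i)) = freeGibbs β Λ ω ∧
      ∀ (B : Finset (Fin d → ℤ)) (v : S3),
        (dirichletGibbs β Λ B v ω).map (fun S i => rightIsoclinic g (S i)) =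
          dirichletGibbs β Λ B (rightIsoclinic g v) ω) ∧
    ∃ βstar > (0 : ℝ), ∃ a > (0 : ℝ), ∀ β ≥ βstar,
      -- the lower bound below is strictly positive
      0 < 1 - Real.sqrt (a * Real.log β / β) ∧
      -- long-range order
      (∀ (Λ : Finset (Fin d → ℤ)) (x y : Λ),
        (∀ z : Fin d → ℤ,
          toE z ∈ Metric.ball ((1 / 2 : ℝ) • (toE x.1 + toE y.1)) (2 * ‖toE x.1 - toE y.1‖) →
            z ∈ Λ) →
        1 - Real.sqrt (a * Real.log β / β) ≤
          avgFree β Λ (fun S => inner ℝ (S x).1 (S y).1)) ∧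
      -- breaking of the symmetry: spontaneous magnetization in every boundary direction
      (∀ (v : S3) (B : ℕ → Finset (Fin d → ℤ)),
        (∀ n, innerBoundary (box d n) ⊆ B n ∧ B n ⊆ box d n) →
        1 - Real.sqrt (a * Real.log β / β) ≤
          liminf (fun n : ℕ =>
            avgDirichlet β (box d n) (B n) v
              (fun S => inner ℝ (S ⟨0, zero_mem_box d n⟩).1 v.1)) atTop) := by
  refine ⟨fun β Λ ω g => ⟨map_freeGibbs β Λ ω g, fun B v => map_dirichletGibbs β Λ B v ω g⟩, ?_⟩
  obtain ⟨C, hC0, δ, hδ0, hloc⟩ := exists_localBound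
  set K := 92 * 2 ^ d * C with hK
  have hK0 : 0 < K := by positivity
  obtain ⟨b, hb3, hb⟩ := exists_log_div_le (δ := min δ (min (1 / 2) (1 / K ^ 2))) (by positivity)
  -- The deficit is at most Kr with r = log β / β, and Kr ≤ √r once r ≤ 1/K²; so `a = 1` suffices
  -- and only the threshold for β depends on `d`.
  refine ⟨b, by linarith, 1, one_pos, fun β hβ => ?_⟩
  have hβ3 : 3 ≤ β := hb3.trans hβ
  rw [one_mul]
  set r := Real.log β / β with hr
  have hr0 : 0 ≤ r := div_nonneg (Real.log_nonneg (by linarith)) (by linarith)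
  have hrb := hb β hβ
  have hrδ : r ≤ δ := hrb.trans (min_le_left _ _)
  have hr2 : r ≤ 1 / 2 := hrb.trans ((min_le_right _ _).trans (min_le_left _ _))
  have hrK : r ≤ 1 / K ^ 2 := hrb.trans ((min_le_right _ _).trans (min_le_right _ _))
  have hKr : K * r ≤ Real.sqrt r := by
    refine Real.le_sqrt_of_sq_le ?_
    rw [le_div_iff₀ (by positivity)] at hrK
    nlinarith [mul_le_mul_of_nonneg_left hrK hr0]
  have hloc' {Λ : Finset (Fin d → ℤ)} (B : Finset (Fin d → ℤ)) (v : S3) := hloc β hβ3 hrδ Λ B v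
  refine ⟨?_, fun Λ x y hΛ => ?_, fun v B hB => ?_⟩
  · rw [sub_pos, Real.sqrt_lt' one_pos]
    linarith
  · rw [avgFree_eq_corr β (basisS3 0)]
    have h1 := (hloc' ∅ (basisS3 0)).general hd hΛ
    rw [← mul_assoc, ← hK] at h1
    linarith
  · refine le_liminf_of_le ?_ (Eventually.of_forall fun n => ?_)
    -- The real-valued liminf requires an upper bound along the sequence; correlations are at most
    -- 1.
    · refine IsCoboundedUnder.of_frequently_le (a := 1) (Frequently.of_forall fun n => ?_)
      have hy := shift_mem_innerBoundary_box (d := d) n ⟨0, by omega⟩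
      rw [avgDirichlet_eq_corr β (B n) v _ ⟨_, innerBoundary_subset _ hy⟩ ((hB n).1 hy)]
      exact corr_le_one _ _ _ _
    · have h1 := LocalBound.box hd (hB n).1 (hloc' (B n) v)
      have h2 : 46 * (C * r) ≤ K * r := by
        have h3 : (1 : ℝ) ≤ 2 ^ d := one_le_pow₀ (by norm_num)
        have h4 : 0 ≤ C * r := by positivity
        rw [hK]
        nlinarith
      linarith
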